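/- **Setting.** $D(0,R)$ is the open disc, $\dot D(0,R)=D(0,R)\setminus\{0\}$; all angular conditions are understood modulo $2\pi$. Let $S\ge 1$, let $\mathcal A\subset\mathbb N^3$ be finite, let $P\not\equiv0$ be a complex polynomial with all roots in $\{\mathrm{Re}>0\}$, and for $\underline k=(k_0,k_1,k_2)\in\mathcal A$ let $c_{\underline k}(z,\epsilon)$ be bounded and holomorphic on $D(0,\rho)\times D(0,\epsilon_0)$, $\rho,\epsilon_0>0$. Consider $$P(\epsilon t^2\partial_t)\,\partial_z^S u(t,z,\epsilon)=\sum_{\underline k\in\mathcal A}c_{\underline k}(z,\epsilon)\,\big((t^2\partial_t)^{k_0}\partial_z^{k_1}u\big)\Big(\frac{t}{1+k_2\epsilon t},z,\epsilon\Big)\qquad(1)$$ with Cauchy data $(\partial_z^ju)(t,0,\epsilon)=\varphi_j(t,\epsilon)$, $0\le j\le S-1$. Let $\xi>0$, $b>1$ satisfy, for all $\underline k\in\mathcal A$, $$S\ge k_1+bk_0+\frac{bk_2}{\xi},\qquad S>k_1,$$ let $\zeta(b)=\sum_{m\ge0}(m+1)^{-b}$ and $M>\zeta(b)$, and let $\sigma_1',\sigma_2',\sigma_3',\varsigma_2',\varsigma_3'>0$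 with $\xi\le\min(\sigma_3',\varsigma_3')$. *Strips.* Let $n\ge1$ and, for $-n\le k\le n$, $H_k=\{a_k\le\mathrm{Im}\,\tau\le b_k,\ \mathrm{Re}\,\tau\le0\}$ and $J_k=\{c_k\le\mathrm{Im}\,\tau\le d_k,\ \mathrm{Re}\,\tau\le0\}$, where $a_k<b_k$, $c_0<0<d_0$, $c_k<a_k<d_k$ for all $k$, $c_{k+1}<b_k<d_{k+1}$, $b_k<a_{k+1}$, $d_k<c_{k+1}$ for $k<n$, and $d_n<b_n$. Let $HJ_n=\bigcup_k(H_k\cup J_k)$. *Sectors in the Borel plane.* Let $\iota\ge2$, $r>0$ with $D(0,r)\cap\{\mathrm{Re}\le0\}\subset J_0$, and for $0\le p\le\iota-1$ let $S_{d_p}\subset\{\mathrm{Re}>0\}$ be an open unbounded sector with vertex $0$ and bisecting direction $d_p$, such that $\bar S_{d_p}\cup\bar D(0,r)$ contains no root of $P$, $d_p<d_{p+1}$ and $S_{d_p}\cap S_{d_{p+1}}=\emptyset$. *Norms.* For $\epsilon\ne0$ put $$\|v\|_{H,\epsilon}=\sup_{\tau\in H\setminus\{0\}}\frac{|v(\tau)|}{|\tau|}e^{-\frac{\sigma_1'}{|\epsilon|}|\tau|+\sigma_2'(M-1)e^{\sigma_3'|\tau|}},\quad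 \|v\|_{J,\epsilon}=\sup_{\tau\in J\setminus\{0\}}\frac{|v(\tau)|}{|\tau|}e^{-\frac{\sigma_1'}{|\epsilon|}|\tau|-\varsigma_2'e^{\varsigma_3'|\tau|}},$$ $$\|v\|_{p,\epsilon}=\sup_{\tau\in(\bar S_{d_p}\cup\bar D(0,r))\setminus\{0\}}\frac{|v(\tau)|}{|\tau|}e^{-\frac{\sigma_1'}{|\epsilon|}|\tau|}.$$ *Sectors in $t$ and $\epsilon$.* Let $\mathcal T$ be a bounded open sector with vertex $0$ and bisecting direction $0$, and let $\mathcal E^k_{HJ_n}$ ($-n\le k\le n$, of aperture $<\pi$) and $\mathcal E_{S_{d_p}}$ ($0\le p\le\iota-1$) be open bounded sectors with vertex $0$ in $D(0,\epsilon_0)$. Suppose that for each of the following conditions there is $\eta>0$ such that for all $t\in\mathcal T$ and all $\epsilon$ in the relevant sector: (i) $\pi-\arg t-\arg\epsilon\in(-\frac\pi2+\eta,\frac\pi2-\eta)$ on $\mathcal E^k_{HJ_n}$; (ii) $\arg A_k-\arg\epsilon-\arg t\in(-\frac\pi2+\eta,\frac\pi2-\eta)$ on $\mathcal E^k_{HJ_n}$,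 where $A_k\in H_k\setminus\{0\}$ is a fixed point; (iii) on $\mathcal E_{S_{d_p}}$ a direction $\gamma_{d_p}=\gamma_{d_p}(t,\epsilon)$ is chosen with $e^{i\gamma_{d_p}}\in S_{d_p}$ and $\gamma_{d_p}-\arg t-\arg\epsilon\in(-\frac\pi2+\eta,\frac\pi2-\eta)$. Suppose that these sectors form a good covering: $\mathcal E^k_{HJ_n}\cap\mathcal E^{k+1}_{HJ_n}$ ($k<n$), $\mathcal E_{S_{d_p}}\cap\mathcal E_{S_{d_{p+1}}}$ ($p\le\iota-2$), $\mathcal E^{-n}_{HJ_n}\cap\mathcal E_{S_{d_0}}$ and $\mathcal E^{n}_{HJ_n}\cap\mathcal E_{S_{d_{\iota-1}}}$ are non-empty, the union of all the sectors is $\mathcal U\setminus\{0\}$ for a neighbourhood $\mathcal U$ of $0$, and no three of them have a common point. Let $P_k$ be the segment from $0$ to $A_k$ followed by the halfline $\{A_k-s: s\ge0\}$, and $L_{\gamma}=\mathbb R_+e^{i\gamma}$. *Borel data.* For $0\le j\le S-1$ let $w_j(\tau,\epsilon)$ be holomorphic on $\mathring{HJ}_n\times\dot D(0,\epsilon_0)$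 and continuous on $HJ_n\times\dot D(0,\epsilon_0)$ and, for each $p$, holomorphic on $(S_{d_p}\cup D(0,r))\times\dot D(0,\epsilon_0)$ and continuous on $(\bar S_{d_p}\cup\bar D(0,r))\times\dot D(0,\epsilon_0)$; for each $\epsilon$ the function on $\mathring{HJ}_n$ and those on the $S_{d_p}$ are analytic continuations of one function holomorphic on $D(0,r)$; and the norms $\|w_j\|_{H_k,\epsilon}$, $\|w_j\|_{J_k,\epsilon}$, $\|w_j\|_{p,\epsilon}$ are bounded uniformly in $\epsilon\in\dot D(0,\epsilon_0)$. **Theorem 1.** There are constants $I>0$, $0<\delta<\rho$ and $0<\delta_1<1$, depending neither on $\epsilon$ nor on the $w_j$, such that the following holds whenever $$\sum_{j=0}^{S-1-h}\|w_{j+h}(\cdot,\epsilon)\|\frac{\delta^j}{j!}\le I\qquad(0\le h\le S-1,\ \epsilon\in\dot D(0,\epsilon_0))$$ for each of the norms $\|\cdot\|_{H_k,\epsilon}$, $\|\cdot\|_{J_k,\epsilon}$ ($-n\le k\le n$) and $\|\cdot\|_{p,\epsilon}$ ($0\le p\le\iota-1$). For some $r_{\mathcal T}>0$, with $\mathcal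 T'=\mathcal T\cap D(0,r_{\mathcal T})$ and $D=D(0,\delta\delta_1)$: 1) For $-n\le k\le n$ the problem (1) with $\varphi_j(t,\epsilon)=\int_{P_k}w_j(u,\epsilon)e^{-u/(\epsilon t)}\frac{du}u$ has a bounded holomorphic solution $u^k_{HJ}$ on $\mathcal T'\times D\times\mathcal E^k_{HJ_n}$. (Here and below, a solution extends holomorphically in $t$ to the images of $\mathcal T'$ under $t\mapsto t/(1+k_2\epsilon t)$, $\underline k\in\mathcal A$, where $1+k_2\epsilon t\neq0$, and (1) holds at every point of the domain.) Moreover $$u^k_{HJ}(t,z,\epsilon)=\int_{P_k}w_{HJ_n}(u,z,\epsilon)e^{-u/(\epsilon t)}\frac{du}u,$$ where $w_{HJ_n}$, the same for all $k$, is holomorphic on $\mathring{HJ}_n\times D\times\dot D(0,\epsilon_0)$ and continuous on $HJ_n\times D\times\dot D(0,\epsilon_0)$, and for all $\sigma_1>\sigma_1'$, $0<\sigma_2<\sigma_2'$, $\varsigma_2>\varsigma_2'$ and all $k$ there are $C_{H_k},C_{J_k}>0$ with $$|w_{HJ_n}(\tau,z,\epsilon)|\le C_{H_k}|\tau|\exp\Big(\tfrac{\sigma_1}{|\epsilon|}\zeta(b)|\tau|-\sigma_2(M-\zeta(b))e^{\sigma_3'|\tau|}\Big)\quad(\tau\in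 H_k),$$ $$|w_{HJ_n}(\tau,z,\epsilon)|\le C_{J_k}|\tau|\exp\Big(\tfrac{\sigma_1}{|\epsilon|}\zeta(b)|\tau|+\varsigma_2\zeta(b)e^{\varsigma_3'|\tau|}\Big)\quad(\tau\in J_k)$$ for all $z\in D$, $\epsilon\in\dot D(0,\epsilon_0)$. For $-n\le k\le n-1$ there are $M_{k,1},M_{k,2}>0$, $M_{k,3}>1$ with $$|u^{k+1}_{HJ}-u^k_{HJ}|\le M_{k,1}\exp\Big(-\frac{M_{k,2}}{|\epsilon|}\log\frac{M_{k,3}}{|\epsilon|}\Big)\quad\text{on }\mathcal T'\times D\times(\mathcal E^k_{HJ_n}\cap\mathcal E^{k+1}_{HJ_n}).$$ 2) For $0\le p\le\iota-1$ the problem (1) with $\varphi_j(t,\epsilon)=\int_{L_{\gamma_{d_p}}}w_j(u,\epsilon)e^{-u/(\epsilon t)}\frac{du}u$ has a bounded holomorphic solution $u_{S_{d_p}}$ on $\mathcal T'\times D\times\mathcal E_{S_{d_p}}$, and $$u_{S_{d_p}}(t,z,\epsilon)=\int_{L_{\gamma_{d_p}}}w_{S_{d_p}}(u,z,\epsilon)e^{-u/(\epsilon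 t)}\frac{du}u,$$ where $w_{S_{d_p}}$ is holomorphic on $(S_{d_p}\cup D(0,r))\times D\times\dot D(0,\epsilon_0)$, continuous on $(\bar S_{d_p}\cup\bar D(0,r))\times D\times\dot D(0,\epsilon_0)$, and for every $\sigma_1>\sigma_1'$ there is $C_{S_{d_p}}>0$ with $|w_{S_{d_p}}(\tau,z,\epsilon)|\le C_{S_{d_p}}|\tau|\exp(\frac{\sigma_1}{|\epsilon|}\zeta(b)|\tau|)$ for $\tau\in S_{d_p}\cup D(0,r)$, $z\in D$, $\epsilon\in\dot D(0,\epsilon_0)$. For $0\le p\le\iota-2$ there are $M_{p,1},M_{p,2}>0$ with $|u_{S_{d_{p+1}}}-u_{S_{d_p}}|\le M_{p,1}e^{-M_{p,2}/|\epsilon|}$ on $\mathcal T'\times D\times(\mathcal E_{S_{d_{p+1}}}\cap\mathcal E_{S_{d_p}})$. 3) There are $M_{n,1},M_{n,2}>0$ with $|u^{-n}_{HJ}-u_{S_{d_0}}|\le M_{n,1}e^{-M_{n,2}/|\epsilon|}$ on $\mathcal T'\times D\times(\mathcal E^{-n}_{HJ_n}\cap\mathcal E_{S_{d_0}})$ and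 $|u^{n}_{HJ}-u_{S_{d_{\iota-1}}}|\le M_{n,1}e^{-M_{n,2}/|\epsilon|}$ on $\mathcal T'\times D\times(\mathcal E^{n}_{HJ_n}\cap\mathcal E_{S_{d_{\iota-1}}})$. All constants $C$ and $M$ with subscripts are independent of $t$, $z$, $\epsilon$. -/

import Mathlib

open scoped ENNReal Topology

noncomputable section

namespace SPCP

/-! ### Strips, sectors and directions -/

/-- The closed horizontal half-strip `{a ≤ Im z ≤ b, Re z ≤ 0}`. -/
def strip (a b : ℝ) : Set ℂ := {z | a ≤ z.im ∧ z.im ≤ b ∧ z.re ≤ 0}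

/-- The constraints on the strips `H k = strip (a k) (b k)` and `J k = strip (c k) (d k)`,
for integers `-n ≤ k ≤ n`: `J (-n), H (-n), J (-n+1), …, J n, H n` overlap consecutively, the
`H k` are disjoint, the `J k` are disjoint, and `0 ∈ (c 0, d 0)`. -/
structure IsStripSystem (n : ℕ) (a b c d : ℤ → ℝ) : Prop where
  lt_H : ∀ k : ℤ, -(n : ℤ) ≤ k → k ≤ n → a k < b k
  zero_mem : c 0 < 0 ∧ 0 < d 0
  overlap : ∀ k : ℤ, -(n : ℤ) ≤ k → k ≤ n → c k < a k ∧ a k < d k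
  overlap_succ : ∀ k : ℤ, -(n : ℤ) ≤ k → k < n → c (k + 1) < b k ∧ b k < d (k + 1)
  last : d n < b n
  disjoint_H : ∀ k : ℤ, -(n : ℤ) ≤ k → k < n → b k < a (k + 1)
  disjoint_J : ∀ k : ℤ, -(n : ℤ) ≤ k → k < n → d k < c (k + 1)

/-- The open unbounded sector with vertex `0`, bisecting direction `α`, half-aperture `θ`. -/
def unbSector (α θ : ℝ) : Set ℂ :=
  {z | z ≠ 0 ∧ |Complex.arg (z * Complex.exp (-(α : ℂ) * Complex.I))| < θ}

/-- The open bounded sector with vertex `0`, radius `R`, bisecting direction `α`,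
half-aperture `θ`. -/
def bddSector (R α θ : ℝ) : Set ℂ := unbSector α θ ∩ Metric.ball 0 R

/-- `x ∈ (-π/2 + η, π/2 - η)` modulo `2π` (arguments are only defined modulo `2π`). -/
def InCone (η x : ℝ) : Prop :=
  ∃ m : ℤ, x + 2 * Real.pi * m ∈ Set.Ioo (-(Real.pi / 2) + η) (Real.pi / 2 - η)

/-- The punctured disc of radius `R`. -/
def pdisc (R : ℝ) : Set ℂ := Metric.ball 0 R \ {0}

/-! ### Weighted sup norms -/

/-- `ζ(b) = ∑_{n ≥ 0} 1/(n+1)^b`. -/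
def zetaR (b : ℝ) : ℝ := ∑' n : ℕ, 1 / ((n : ℝ) + 1) ^ b

/-- `r_b(β) = ∑_{n=0}^β 1/(n+1)^b`. -/
def rSeq (b : ℝ) (β : ℕ) : ℝ := ∑ n ∈ Finset.range (β + 1), 1 / ((n : ℝ) + 1) ^ b

/-- `s_b(β) = M - r_b(β)`. -/
def sSeq (b M : ℝ) (β : ℕ) : ℝ := M - rSeq b β

/-- Norm of the space of functions with super-exponential decay on the strip `H`
(`∞` if the supremum is infinite). -/
def sedNorm (b M : ℝ) (β : ℕ) (σ₁ σ₂ σ₃ : ℝ) (H : Set ℂ) (ε : ℂ) (v : ℂ → ℂ) : ℝ≥0∞ :=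
  ⨆ τ ∈ H, ENNReal.ofReal (‖v τ‖ / ‖τ‖ *
    Real.exp (-(σ₁ / ‖ε‖ * rSeq b β * ‖τ‖) + σ₂ * sSeq b M β * Real.exp (σ₃ * ‖τ‖)))

/-- Norm of the space of functions with super-exponential growth on the strip `J`. -/
def segNorm (b : ℝ) (β : ℕ) (σ₁ ς₂ ς₃ : ℝ) (J : Set ℂ) (ε : ℂ) (v : ℂ → ℂ) : ℝ≥0∞ :=
  ⨆ τ ∈ J, ENNReal.ofReal (‖v τ‖ / ‖τ‖ *
    Real.exp (-(σ₁ / ‖ε‖ * rSeq b β * ‖τ‖) - ς₂ * rSeq b β * Real.exp (ς₃ * ‖τ‖)))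

/-- Norm of the space of functions with exponential growth on the set `Ω`
(`Ω` is the union of a closed sector and a closed disc). -/
def egNorm (b : ℝ) (β : ℕ) (σ₁ : ℝ) (Ω : Set ℂ) (ε : ℂ) (v : ℂ → ℂ) : ℝ≥0∞ :=
  ⨆ τ ∈ Ω, ENNReal.ofReal (‖v τ‖ / ‖τ‖ * Real.exp (-(σ₁ / ‖ε‖ * rSeq b β * ‖τ‖)))

/-- The smallness condition `∑_{j=0}^{S-1-h} N_{j+h} δ^j/j! ≤ I` for `0 ≤ h ≤ S-1`,
where `N j` is a norm of the `j`-th initial datum. -/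
def SmallData (S : ℕ) (δ I : ℝ) (N : ℕ → ℝ≥0∞) : Prop :=
  ∀ h < S, ∑ j ∈ Finset.range (S - h), N (j + h) * ENNReal.ofReal (δ ^ j / (j.factorial : ℝ))
    ≤ ENNReal.ofReal I

/-! ### Admissible initial data -/

/-- `w(τ, ε)` is holomorphic on `interior HJ × pdisc ε₀`, continuous on `HJ × pdisc ε₀`, and
uniformly in `ε` its norms on all strips `H k` (decay) and `J k` (growth) are bounded. -/
def AdmissibleHJ (b M ε₀ : ℝ) (n : ℕ) (aH bH cJ dJ : ℤ → ℝ) (σ₁ σ₂ σ₃ ς₂ ς₃ : ℝ)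
    (w : ℂ → ℂ → ℂ) : Prop :=
  DifferentiableOn ℂ (fun q : ℂ × ℂ => w q.1 q.2)
      (interior (strip (cJ (-n)) (bH n)) ×ˢ pdisc ε₀) ∧
  ContinuousOn (fun q : ℂ × ℂ => w q.1 q.2) (strip (cJ (-n)) (bH n) ×ˢ pdisc ε₀) ∧
  ∃ Iw : ℝ, 0 < Iw ∧ ∀ ε ∈ pdisc ε₀, ∀ k : ℤ, -(n : ℤ) ≤ k → k ≤ n →
    sedNorm b M 0 σ₁ σ₂ σ₃ (strip (aH k) (bH k)) ε (fun τ => w τ ε) ≤ ENNReal.ofReal Iw ∧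
    segNorm b 0 σ₁ ς₂ ς₃ (strip (cJ k) (dJ k)) ε (fun τ => w τ ε) ≤ ENNReal.ofReal Iw

/-- `w(τ, ε)` is holomorphic on `(Sd ∪ D(0,r)) × pdisc ε₀`, continuous up to the closures in
`τ`, with a uniformly bounded norm of exponential growth. -/
def AdmissibleS (b ε₀ : ℝ) (Sd : Set ℂ) (r σ₁ : ℝ) (w : ℂ → ℂ → ℂ) : Prop :=
  DifferentiableOn ℂ (fun q : ℂ × ℂ => w q.1 q.2) ((Sd ∪ Metric.ball 0 r) ×ˢ pdisc ε₀) ∧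
  ContinuousOn (fun q : ℂ × ℂ => w q.1 q.2)
      ((closure Sd ∪ Metric.closedBall 0 r) ×ˢ pdisc ε₀) ∧
  ∃ Iw : ℝ, 0 < Iw ∧ ∀ ε ∈ pdisc ε₀,
    egNorm b 0 σ₁ (closure Sd ∪ Metric.closedBall 0 r) ε (fun τ => w τ ε) ≤ ENNReal.ofReal Iw

/-- `𝓔` is an open sector inside `D(0,ε₀)` of aperture less than `π`, and
`π - arg t - arg ε` stays in a compact part of `(-π/2, π/2)` for `ε ∈ 𝓔`, `t ∈ 𝒯`. -/
def SectorHJ (ε₀ : ℝ) (𝒯 𝓔 : Set ℂ) : Prop :=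
  (∃ R α θ : ℝ, 0 < R ∧ 0 < θ ∧ θ < Real.pi / 2 ∧ 𝓔 = bddSector R α θ) ∧
  𝓔 ⊆ Metric.ball 0 ε₀ ∧
  ∃ η > 0, ∀ ε ∈ 𝓔, ∀ t ∈ 𝒯, InCone η (Real.pi - Complex.arg t - Complex.arg ε)

/-- `A` is a point of the strip `H`, the argument of which is compatible with `𝓔` and `𝒯`. -/
def PathPoint (𝒯 𝓔 H : Set ℂ) (A : ℂ) : Prop :=
  A ∈ H ∧ A ≠ 0 ∧
  ∃ η > 0, ∀ ε ∈ 𝓔, ∀ t ∈ 𝒯, InCone η (Complex.arg A - Complex.arg ε - Complex.arg t)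

/-- `𝓔` is an open sector inside `D(0,ε₀)`, and `γ t ε` is a direction in `Sd` compatible
with `t ∈ 𝒯`, `ε ∈ 𝓔`. -/
def SectorS (ε₀ : ℝ) (𝒯 𝓔 Sd : Set ℂ) (γ : ℂ → ℂ → ℝ) : Prop :=
  (∃ R α θ : ℝ, 0 < R ∧ 0 < θ ∧ θ ≤ Real.pi ∧ 𝓔 = bddSector R α θ) ∧
  𝓔 ⊆ Metric.ball 0 ε₀ ∧
  ∃ η > 0, ∀ ε ∈ 𝓔, ∀ t ∈ 𝒯, Complex.exp (γ t ε * Complex.I) ∈ Sd ∧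
    InCone η (γ t ε - Complex.arg t - Complex.arg ε)

/-- The family of all sectors, `EH k` for `-n ≤ k ≤ n` and `ES p` for `0 ≤ p < ι`. -/
def sectorFamily (n ι : ℕ) (EH : ℤ → Set ℂ) (ES : ℕ → Set ℂ) :
    (Set.Icc (-(n : ℤ)) n) ⊕ Fin ι → Set ℂ :=
  Sum.elim (fun k => EH k) (fun p => ES p)

/-- Good covering: neighbouring sectors intersect, their union is a punctured neighbourhood
of `0`, and no three of them have a common point. -/
structure IsGoodCovering (n ι : ℕ) (EH : ℤ → Set ℂ) (ES : ℕ → Set ℂ) : Prop where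
  inter_H : ∀ k : ℤ, -(n : ℤ) ≤ k → k < n → (EH k ∩ EH (k + 1)).Nonempty
  inter_S : ∀ p : ℕ, p + 1 < ι → (ES (p + 1) ∩ ES p).Nonempty
  inter_first : (EH (-n) ∩ ES 0).Nonempty
  inter_last : (EH n ∩ ES (ι - 1)).Nonempty
  cover : ∃ U ∈ 𝓝 (0 : ℂ), ⋃ i, sectorFamily n ι EH ES i = U \ {0}
  triple : ∀ i j l, i ≠ j → i ≠ l → j ≠ l →
    sectorFamily n ι EH ES i ∩ sectorFamily n ι EH ES j ∩ sectorFamily n ι EH ES l = ∅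

/-! ### Laplace transforms -/

/-- The integrand `w(u) exp(-u/x) / u`; here `x` stands for `ε t`. -/
def lapKernel (w : ℂ → ℂ) (x u : ℂ) : ℂ := w u * Complex.exp (-(u / x)) / u

/-- `∫_P w(u) exp(-u/x) du/u` converges absolutely with value `v`, where `P` is the segment
from `0` to `A` followed by the halfline `{A - s : s ≥ 0}`. -/
def HasBrokenLaplace (A : ℂ) (w : ℂ → ℂ) (x v : ℂ) : Prop :=
  IntervalIntegrable (fun s : ℝ => lapKernel w x (s * A) * A) MeasureTheory.volume 0 1 ∧
  MeasureTheory.IntegrableOn (fun s : ℝ => lapKernel w x (A - s)) (Set.Ioi 0) ∧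
  (∫ s in (0 : ℝ)..1, lapKernel w x (s * A) * A)
    + (∫ s in Set.Ioi (0 : ℝ), lapKernel w x (A - s) * (-1)) = v

/-- `∫_L w(u) exp(-u/x) du/u` converges absolutely with value `v`, where `L` is the halfline
`{s exp(iγ) : s ≥ 0}`. -/
def HasRayLaplace (γ : ℝ) (w : ℂ → ℂ) (x v : ℂ) : Prop :=
  MeasureTheory.IntegrableOn (fun s : ℝ =>
    lapKernel w x (s * Complex.exp (γ * Complex.I)) * Complex.exp (γ * Complex.I)) (Set.Ioi 0) ∧
  (∫ s in Set.Ioi (0 : ℝ),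
    lapKernel w x (s * Complex.exp (γ * Complex.I)) * Complex.exp (γ * Complex.I)) = v

/-! ### The Cauchy problem -/

/-- The operator `μ t² ∂_t`. -/
def irrD (μ : ℂ) (v : ℂ → ℂ) : ℂ → ℂ := fun t => μ * t ^ 2 * deriv v t

/-- The Moebius map `t ↦ t / (1 + k ε t)`. -/
def moebius (k : ℕ) (ε t : ℂ) : ℂ := t / (1 + k * ε * t)

/-- The equation
`P(ε t² ∂_t) ∂_z^S u = ∑_k c_k(z,ε) ((t² ∂_t)^{k₀} ∂_z^{k₁} u)(t/(1 + k₂ ε t), z, ε)`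
at the point `(t, z, ε)`, with `k = (k₀, k₁, k₂)`. -/
def EquationAt (S : ℕ) (P : Polynomial ℂ) (𝒜 : Finset (ℕ × ℕ × ℕ))
    (c : ℕ × ℕ × ℕ → ℂ → ℂ → ℂ) (u : ℂ → ℂ → ℂ → ℂ) (t z ε : ℂ) : Prop :=
  P.sum (fun i p =>
      p * ((irrD ε)^[i] (fun t' => iteratedDeriv S (fun z' => u t' z' ε) z)) t)
    = ∑ k ∈ 𝒜, c k z ε *
      ((irrD 1)^[k.1] (fun t' => iteratedDeriv k.2.1 (fun z' => u t' z' ε) z))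
        (moebius k.2.2 ε t)

/-- The points `(t, z, ε)` with `z ∈ B`, `ε ∈ 𝓔`, and `t` in `𝒯` or in the image of `𝒯` under one
of the Moebius maps of the equation. The right-hand side of the equation on
`𝒯 × B × 𝓔` is about the values of the unknown on this set. -/
def extDomain (𝒜 : Finset (ℕ × ℕ × ℕ)) (𝒯 B 𝓔 : Set ℂ) : Set (ℂ × ℂ × ℂ) :=
  {q | q.2.1 ∈ B ∧ q.2.2 ∈ 𝓔 ∧
    (q.1 ∈ 𝒯 ∨ ∃ k ∈ 𝒜, ∃ t ∈ 𝒯, q.1 = moebius k.2.2 q.2.2 t)}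

/-- `u` is a solution of the equation, bounded and holomorphic on `𝒯 × B × 𝓔` (it is holomorphic
on `extDomain` too, and the equation holds at all points of `𝒯 × B × 𝓔`). -/
def IsBoundedHolSolution (S : ℕ) (P : Polynomial ℂ) (𝒜 : Finset (ℕ × ℕ × ℕ))
    (c : ℕ × ℕ × ℕ → ℂ → ℂ → ℂ) (𝒯 B 𝓔 : Set ℂ) (u : ℂ → ℂ → ℂ → ℂ) : Prop :=
  DifferentiableOn ℂ (fun q : ℂ × ℂ × ℂ => u q.1 q.2.1 q.2.2) (extDomain 𝒜 𝒯 B 𝓔) ∧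
  (∃ K : ℝ, ∀ t ∈ 𝒯, ∀ z ∈ B, ∀ ε ∈ 𝓔, ‖u t z ε‖ ≤ K) ∧
  ∀ t ∈ 𝒯, ∀ z ∈ B, ∀ ε ∈ 𝓔,
    (∀ k ∈ 𝒜, 1 + (k.2.2 : ℂ) * ε * t ≠ 0) ∧ EquationAt S P 𝒜 c u t z ε

end SPCP

end

open scoped ENNReal Topology

open scoped ENNReal Topology

noncomputable section

namespace SPCP

open MeasureTheory Set Filter

/-! ### Holomorphic dependence of integrals and sums on parameters -/

/-! Seek u as a Laplace transform ∫ W(τ, z, ε) e^{-τ/(εt)} dτ/τ. In the variable y = 1/(εt) the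
operator ε t²∂_t is -∂_y, which multiplies W by τ, and t ↦ t/(1 + k₂εt) is the translation y ↦ y +
k₂, which multiplies W by e^{-k₂τ}. Hence (1) follows from a Cauchy problem in z in which τ and ε
are mere parameters: P(τ) ∂_z^S W = ∑ c_k (τ/ε)^{k₀} e^{-k₂τ} ∂_z^{k₁} W (`BorelProblem.equation`,
`BorelPath.equationAt`).

The Taylor coefficients of W in z obey an explicit recursion (`cauchySeq`) and are estimated
pointwise in (τ, ε), without any function space. The n-th one is at most D R^n n! exp(r_b(n) L),
where L = σ₁|τ|/|ε| + X and X is 0 or a multiple of e^{σ₃|τ|} (`norm_cauchySeq_le`). One step of the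
recursion loses a factor (|τ|/|ε|)^{k₀} |e^{-k₂τ}|. The increment of r_b, at least (S - k₁) N^{-b}
with N = n + S + 1, absorbs it at the price of N^{bk₀ + bk₂/ξ} ≤ N^{S - k₁} (`norm_qCoef_le`), and
the factorials pay for this power (`factorial_step`). As r_b(n) ≤ ζ(b), the weights stay finite. The
rate R depends neither on the point nor on the data, so one disc in z serves everywhere
(`exists_growth_rate`).

Along the paths W grows at most like e^{κ|τ|/|ε|} with κ = σ₁ζ(b): the segment is bounded, and on
the halfline in H_k the decaying weight applies. The cone conditions make e^{-u/(εt)} decay at a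
rate D/|ε|, where D is as large as desired once |t| is small. This gives convergence, boundedness
and holomorphy (`isBoundedHolSolution`). On the sectors the direction varies with (t, ε), but the
value of the integral does not (`SectorData.pathLap_eq`).

To compare two solutions, cut both paths at a parameter l and join the ends by a segment. Cauchy's
theorem on a convex set with 0 on its boundary (`IsHolConvex.segInt_add`) leaves the tails and this
segment, of order e^{-θl/|ε|} (`norm_pathLap_sub_le`). When a sector is involved, the two Borel
functions are compared only on the disc D(0, r), so l is constant and the difference is
exponentially small. Between two strips the whole of HJ_n is available, but W may grow there like
exp(ς e^{ς₃|τ|}). Taking l proportional to log(M₃/|ε|) keeps this growth below e^{O(1/|ε|)}, and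
e^{-θl/|ε|} becomes the asserted bound with the logarithm. -/

lemma aestronglyMeasurable_fderiv {E : Type*} [NormedAddCommGroup E] [NormedSpace ℂ E]
    [FiniteDimensional ℂ E] {X : Type*} [MeasurableSpace X] {μ : Measure X} {F : E → X → ℂ}
    {U : Set E} (hU : IsOpen U) (hmeas : ∀ x ∈ U, AEStronglyMeasurable (F x) μ)
    (hdiff : ∀ᵐ a ∂μ, DifferentiableOn ℂ (fun x => F x a) U) {x₀ : E} (hx₀ : x₀ ∈ U) :
    AEStronglyMeasurable (fun a => fderiv ℂ (fun x => F x a) x₀) μ := by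
  have key : ∀ v : E, AEStronglyMeasurable (fun a => fderiv ℂ (fun x => F x a) x₀ v) μ := by
    intro v
    have hlim : Tendsto (fun n : ℕ => x₀ + ((n : ℂ))⁻¹ • v) atTop (𝓝 x₀) := by
      have h1 : Tendsto (fun n : ℕ => ((n : ℂ))⁻¹) atTop (𝓝 0) :=
        tendsto_inv_atTop_nhds_zero_nat
      simpa using (h1.smul_const v).const_add x₀
    obtain ⟨N, hN⟩ := eventually_atTop.1 (hlim.eventually (hU.mem_nhds hx₀))
    -- The derivative along v is a limit of difference quotients at the points x₀ + v/n; the shift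
    -- by N keeps these points in U.
    refine aestronglyMeasurable_of_tendsto_ae (u := atTop) (f := fun n : ℕ => fun a =>
      ((n + N : ℕ) : ℂ) • (F (x₀ + (((n + N : ℕ) : ℂ))⁻¹ • v) a - F x₀ a)) (fun n => ?_) ?_
    · exact ((hmeas _ (hN _ (Nat.le_add_left N n))).sub (hmeas _ hx₀)).const_smul (((n + N : ℕ) : ℂ))
    · filter_upwards [hdiff] with a ha
      have hd : HasFDerivAt (fun x => F x a) (fderiv ℂ (fun x => F x a) x₀) x₀ :=
        (ha.differentiableAt (hU.mem_nhds hx₀)).hasFDerivAt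
      have h2 : Tendsto (fun n : ℕ => ‖((n : ℂ))‖) atTop atTop := by
        simpa using tendsto_natCast_atTop_atTop (R := ℝ)
      exact ((hd.lim v h2).comp (tendsto_add_atTop_nat N))
  let b := Module.finBasis ℂ E
  have : (fun a => fderiv ℂ (fun x => F x a) x₀) = fun a => ∑ i,
      (fderiv ℂ (fun x => F x a) x₀ (b i)) • (LinearMap.toContinuousLinearMap (b.coord i)) := by
    funext a
    ext w
    have hw : w = ∑ i, b.repr w i • b i := (b.sum_repr w).symm
    conv_lhs => rw [hw, map_sum]
    simp only [map_smul, smul_eq_mul, mul_comm, _root_.sum_apply,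
      _root_.smul_apply, LinearMap.coe_toContinuousLinearMap', Module.Basis.coord_apply]
  rw [this]
  exact Finset.aestronglyMeasurable_fun_sum _ fun i _ => (key (b i)).smul_const _

/-- An integral of functions depending holomorphically on a parameter, locally uniformly dominated
by an integrable function, is holomorphic in the parameter. -/
theorem differentiableOn_integral_of_dominated {E : Type*} [NormedAddCommGroup E] [NormedSpace ℂ E]
    [FiniteDimensional ℂ E] {X : Type*} [MeasurableSpace X] {μ : Measure X} {F : E → X → ℂ}
    {U : Set E} (hU : IsOpen U) (hmeas : ∀ x ∈ U, AEStronglyMeasurable (F x) μ)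
    (hdiff : ∀ᵐ a ∂μ, DifferentiableOn ℂ (fun x => F x a) U)
    (hbd : ∀ x₀ ∈ U, ∃ V ∈ 𝓝 x₀, ∃ g : X → ℝ, Integrable g μ ∧
      ∀ᵐ a ∂μ, ∀ x ∈ V, ‖F x a‖ ≤ g a) :
    DifferentiableOn ℂ (fun x => ∫ a, F x a ∂μ) U := by
  intro x₀ hx₀
  obtain ⟨V, hV, g, hg, hFg⟩ := hbd x₀ hx₀
  obtain ⟨r, hr, hrV⟩ := Metric.mem_nhds_iff.1 (inter_mem hV (hU.mem_nhds hx₀))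
  have hsub : ∀ x ∈ Metric.ball x₀ (r / 2), Metric.ball x (r / 2) ⊆ V ∩ U := by
    intro x hx
    refine subset_trans (Metric.ball_subset_ball' ?_) hrV
    have := Metric.mem_ball.1 hx
    linarith
  have hx₀V : x₀ ∈ V := mem_of_mem_nhds hV
  refine (hasFDerivAt_integral_of_dominated_of_fderiv_le
    (F' := fun x a => fderiv ℂ (fun x => F x a) x)
    (bound := fun a => (2 * g a) / (r / 2)) (Metric.ball_mem_nhds x₀ (half_pos hr))
    ?_ ?_ (aestronglyMeasurable_fderiv hU hmeas hdiff hx₀) ?_ ?_ ?_).differentiableAt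
      |>.differentiableWithinAt
  · filter_upwards [hU.mem_nhds hx₀] with x hx using hmeas x hx
  · exact hg.mono' (hmeas x₀ hx₀) (hFg.mono fun a ha => ha x₀ hx₀V)
  · filter_upwards [hFg, hdiff] with a ha hd x hx
    -- Cauchy's estimate on a ball of radius r/2 about x bounds the derivative by the oscillation
    -- 2g, so dominating the functions alone suffices.
    refine Complex.norm_fderiv_le_div_of_mapsTo_ball
      (hd.mono fun y hy => (hsub x hx hy).2) ?_ (half_pos hr)
    intro y hy
    rw [mem_closedBall_iff_norm]
    have h1 := ha y (hsub x hx hy).1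
    have h2 := ha x (hsub x hx (Metric.mem_ball_self (half_pos hr))).1
    calc _ ≤ ‖F y a‖ + ‖F x a‖ := norm_sub_le _ _
      _ ≤ 2 * g a := by linarith
  · exact (hg.const_mul 2).div_const _
  · filter_upwards [hdiff] with a hd x hx
    exact (hd.differentiableAt (hU.mem_nhds
      (hsub x hx (Metric.mem_ball_self (half_pos hr))).2)).hasFDerivAt

/-- A series of holomorphic functions, locally uniformly dominated by a summable sequence,
is holomorphic. -/
theorem differentiableOn_tsum_of_dominated {E : Type*} [NormedAddCommGroup E] [NormedSpace ℂ E]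
    [FiniteDimensional ℂ E] {F : ℕ → E → ℂ}
    {U : Set E} (hU : IsOpen U) (hdiff : ∀ n, DifferentiableOn ℂ (F n) U)
    (hbd : ∀ x₀ ∈ U, ∃ V ∈ 𝓝 x₀, ∃ g : ℕ → ℝ, Summable g ∧ ∀ n, ∀ x ∈ V, ‖F n x‖ ≤ g n) :
    DifferentiableOn ℂ (fun x => ∑' n, F n x) U := by
  -- A series is an integral for the counting measure.
  have h : DifferentiableOn ℂ (fun x => ∫ n, F n x ∂Measure.count) U := by
    refine differentiableOn_integral_of_dominated (F := fun x n => F n x) hU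
      (fun x _ => (measurable_of_countable _).aestronglyMeasurable)
      (ae_of_all _ hdiff) fun x₀ hx₀ => ?_
    obtain ⟨V, hV, g, hg, hFg⟩ := hbd x₀ hx₀
    exact ⟨V, hV, g, integrable_count_iff.2 hg.norm, ae_of_all _ hFg⟩
  refine h.congr fun x hx => ?_
  obtain ⟨V, hV, g, hg, hFg⟩ := hbd x hx
  have hs : Summable fun n => ‖F n x‖ :=
    Summable.of_nonneg_of_le (fun _ => norm_nonneg _) (fun n => hFg n x (mem_of_mem_nhds hV)) hg
  rw [integral_countable (integrable_count_iff.2 hs)]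
  simp [Measure.real]

/-- A series of functions continuous on a set, locally uniformly dominated by a summable
sequence, is continuous. -/
theorem continuousOn_tsum_of_dominated {E : Type*} [TopologicalSpace E] {F : ℕ → E → ℂ}
    {K : Set E} (hcont : ∀ n, ContinuousOn (F n) K)
    (hbd : ∀ x₀ ∈ K, ∃ V ∈ 𝓝 x₀, ∃ g : ℕ → ℝ, Summable g ∧ ∀ n, ∀ x ∈ V ∩ K, ‖F n x‖ ≤ g n) :
    ContinuousOn (fun x => ∑' n, F n x) K := by
  intro x₀ hx₀
  obtain ⟨V, hV, g, hg, hFg⟩ := hbd x₀ hx₀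
  have := continuousOn_tsum (s := V ∩ K) (fun n => (hcont n).mono inter_subset_right) hg
    (fun n x hx => hFg n x hx)
  refine (this x₀ ⟨mem_of_mem_nhds hV, hx₀⟩).mono_of_mem_nhdsWithin ?_
  exact inter_mem (mem_nhdsWithin_of_mem_nhds hV) self_mem_nhdsWithin

/-- A function continuous on `K × Q` and holomorphic in the second variable over a set `U` with
`K ⊆ closure U` is holomorphic in the second variable over `K`. -/
theorem differentiableOn_of_mem_closure {K U Q : Set ℂ} (hQ : IsOpen Q) (hUK : U ⊆ K)
    (hKU : K ⊆ closure U) {f : ℂ → ℂ → ℂ}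
    (hf : ContinuousOn (fun q : ℂ × ℂ => f q.1 q.2) (K ×ˢ Q))
    (hd : ∀ τ ∈ U, DifferentiableOn ℂ (f τ) Q) {τ : ℂ} (hτ : τ ∈ K) :
    DifferentiableOn ℂ (f τ) Q := by
  obtain ⟨u, huU, hu⟩ := mem_closure_iff_seq_limit.1 (hKU hτ)
  refine TendstoLocallyUniformlyOn.differentiableOn (φ := atTop) (F := fun n => f (u n)) ?_
    (Eventually.of_forall fun n => hd _ (huU n)) hQ
  rw [tendstoLocallyUniformlyOn_iff_forall_isCompact hQ]
  intro C hCQ hC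
  -- On the compact set {τ} ∪ {u n}, times C, the function f is uniformly continuous, so f (u n) → f
  -- τ uniformly on C.
  set L : Set ℂ := insert τ (range u) with hL
  have hLc : IsCompact L := hu.isCompact_insert_range
  have hLK : L ⊆ K := by
    rintro x (rfl | ⟨n, rfl⟩)
    exacts [hτ, hUK (huU n)]
  have huc := (hLc.prod hC).uniformContinuousOn_of_continuous (hf.mono (prod_mono hLK hCQ))
  rw [Metric.uniformContinuousOn_iff] at huc
  rw [Metric.tendstoUniformlyOn_iff]
  intro e he
  obtain ⟨δ, hδ, hh⟩ := huc e he
  filter_upwards [Metric.tendsto_nhds.1 hu δ hδ] with n hn x hx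
  refine hh (τ, x) ⟨mem_insert _ _, hx⟩ (u n, x) ⟨mem_insert_of_mem _ ⟨n, rfl⟩, hx⟩ ?_
  rw [Prod.dist_eq, dist_self, max_eq_left dist_nonneg, dist_comm]
  exact hn

end SPCP

end

/-! ### Cauchy's theorem up to the boundary and comparison of path integrals -/

open scoped ENNReal Topology

noncomputable section

namespace SPCP

open MeasureTheory Set Filter

/-! ### Cauchy's theorem on convex sets, up to the boundary -/

/-- The integral of `f` along the segment from `a` to `b`. -/
def segInt (f : ℂ → ℂ) (a b : ℂ) : ℂ := ∫ s in (0 : ℝ)..1, f (a + s * (b - a)) * (b - a)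

lemma norm_segInt_le {f : ℂ → ℂ} {a b : ℂ} {C : ℝ} (h : ∀ u ∈ segment ℝ a b, ‖f u‖ ≤ C) :
    ‖segInt f a b‖ ≤ C * ‖b - a‖ := by
  have := intervalIntegral.norm_integral_le_of_norm_le_const (a := (0 : ℝ)) (b := 1)
    (f := fun s : ℝ => f (a + s * (b - a)) * (b - a)) (C := C * ‖b - a‖) ?_
  · simpa [segInt] using this
  · intro s hs
    rw [uIoc_of_le zero_le_one] at hs
    rw [norm_mul]
    refine mul_le_mul_of_nonneg_right (h _ ?_) (norm_nonneg _)
    rw [segment_eq_image']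
    exact ⟨s, ⟨hs.1.le, hs.2⟩, by simp⟩

/-- `f` is holomorphic inside the convex set `K` containing `0`, continuous on `K \ {0}` and
bounded on bounded subsets of `K`. -/
structure IsHolConvex (f : ℂ → ℂ) (K : Set ℂ) : Prop where
  convex : Convex ℝ K
  nonempty : (interior K).Nonempty
  zero_mem : (0 : ℂ) ∈ K
  diff : DifferentiableOn ℂ f (interior K)
  cont : ContinuousOn f (K \ {0})
  bdd : ∀ R : ℝ, ∃ C : ℝ, ∀ u ∈ K, ‖u‖ ≤ R → ‖f u‖ ≤ C

lemma segInt_eq_sub_of_hasDerivAt {f g : ℂ → ℂ} {U : Set ℂ} (hU : Convex ℝ U)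
    (hg : ∀ u ∈ U, HasDerivAt g (f u) u) (hf : ContinuousOn f U) {a b : ℂ} (ha : a ∈ U)
    (hb : b ∈ U) : segInt f a b = g b - g a := by
  have hmem : ∀ s ∈ uIcc (0 : ℝ) 1, a + s * (b - a) ∈ U := by
    intro s hs
    rw [uIcc_of_le zero_le_one] at hs
    have := hU.add_smul_sub_mem ha hb hs
    simpa using this
  have hγ : ∀ s : ℝ, HasDerivAt (fun s : ℝ => a + s * (b - a)) (b - a) s := by
    intro s
    simpa using ((Complex.ofRealCLM.hasDerivAt (x := s)).mul_const (b - a)).const_add a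
  have := intervalIntegral.integral_eq_sub_of_hasDerivAt
    (f := fun s : ℝ => g (a + s * (b - a)))
    (f' := fun s : ℝ => f (a + s * (b - a)) * (b - a)) (a := 0) (b := 1)
    (fun s hs => (hg _ (hmem s hs)).comp s (hγ s)) ?_
  · simpa [segInt] using this
  · refine ContinuousOn.intervalIntegrable ?_
    refine ContinuousOn.mul (hf.comp ?_ hmem) continuousOn_const
    exact (continuous_iff_continuousAt.2 fun s => (hγ s).continuousAt).continuousOn

/-- A homothety towards the interior point p moves the whole segment into the interior, and
boundedness on bounded sets provides the domination. Pointwise convergence can fail only where the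
segment meets 0, a single parameter value if a ≠ b. If a = b, both integrands vanish. -/
lemma IsHolConvex.tendsto_segInt {f : ℂ → ℂ} {K : Set ℂ} (h : IsHolConvex f K) {a b p : ℂ}
    (ha : a ∈ K) (hb : b ∈ K) (hp : p ∈ interior K) :
    Tendsto (fun n : ℕ => segInt f (a + ((1 / ((n : ℝ) + 1) : ℝ) : ℂ) * (p - a))
      (b + ((1 / ((n : ℝ) + 1) : ℝ) : ℂ) * (p - b))) atTop (𝓝 (segInt f a b)) := by
  set l : ℕ → ℝ := fun n => 1 / ((n : ℝ) + 1) with hl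
  have hl0 : ∀ n, l n ∈ Ioc (0 : ℝ) 1 := fun n =>
    ⟨Nat.one_div_pos_of_nat, by rw [hl]; simpa using Nat.one_div_le_one_div (α := ℝ) (Nat.zero_le n)⟩
  have hlt : Tendsto l atTop (𝓝 0) := tendsto_one_div_add_atTop_nhds_zero_nat
  have hltC : Tendsto (fun n => (l n : ℂ)) atTop (𝓝 0) := by
    have := (Complex.continuous_ofReal.tendsto 0).comp hlt
    rwa [Complex.ofReal_zero] at this
  set γ : ℝ → ℂ := fun s => a + s * (b - a) with hγ
  have hγK : ∀ s ∈ Icc (0 : ℝ) 1, γ s ∈ K := fun s hs => by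
    simpa [hγ] using h.convex.add_smul_sub_mem ha hb hs
  have hpt : ∀ n (s : ℝ), a + (l n : ℂ) * (p - a) + s * (b + (l n : ℂ) * (p - b)
      - (a + (l n : ℂ) * (p - a))) = γ s + (l n : ℂ) * (p - γ s) := by
    intro n s; simp only [hγ]; ring
  have hptK : ∀ n, ∀ s ∈ Icc (0 : ℝ) 1, γ s + (l n : ℂ) * (p - γ s) ∈ interior K := by
    intro n s hs
    simpa using h.convex.add_smul_sub_mem_interior (hγK s hs) hp (hl0 n)
  obtain ⟨C, hC⟩ := h.bdd (‖a‖ + ‖b - a‖ + (‖p‖ + (‖a‖ + ‖b - a‖)))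
  have hγn : ∀ s ∈ Icc (0 : ℝ) 1, ‖γ s‖ ≤ ‖a‖ + ‖b - a‖ := by
    intro s hs
    refine (norm_add_le _ _).trans (add_le_add_right ?_ _)
    rw [norm_mul, Complex.norm_real, Real.norm_of_nonneg hs.1]
    exact mul_le_of_le_one_left (norm_nonneg _) hs.2
  have hdiffn : ∀ n, ‖b + (l n : ℂ) * (p - b) - (a + (l n : ℂ) * (p - a))‖ ≤ ‖b - a‖ := by
    intro n
    have : b + (l n : ℂ) * (p - b) - (a + (l n : ℂ) * (p - a))
        = ((1 - l n : ℝ) : ℂ) * (b - a) := by push_cast; ring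
    rw [this, norm_mul, Complex.norm_real, Real.norm_of_nonneg (by linarith [(hl0 n).2])]
    exact mul_le_of_le_one_left (norm_nonneg _) (by linarith [(hl0 n).1])
  change Tendsto (fun n : ℕ => segInt f (a + (l n : ℂ) * (p - a)) (b + (l n : ℂ) * (p - b)))
    atTop _
  unfold segInt
  simp only [hpt]
  refine intervalIntegral.tendsto_integral_filter_of_dominated_convergence
    (fun _ => C * ‖b - a‖) ?_ ?_ ?_ ?_
  · refine Eventually.of_forall fun n => ?_
    rw [uIoc_of_le zero_le_one]
    refine ContinuousOn.aestronglyMeasurable ?_ measurableSet_Ioc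
    refine ContinuousOn.mul (h.diff.continuousOn.comp ?_
      fun s hs => hptK n s ⟨hs.1.le, hs.2⟩) continuousOn_const
    simp only [hγ]
    fun_prop
  · refine Eventually.of_forall fun n => ae_of_all _ fun s hs => ?_
    rw [uIoc_of_le zero_le_one] at hs
    have hs' : s ∈ Icc (0 : ℝ) 1 := ⟨hs.1.le, hs.2⟩
    have hfC : ‖f (γ s + (l n : ℂ) * (p - γ s))‖ ≤ C := by
      refine hC _ (interior_subset (hptK n s hs')) ((norm_add_le _ _).trans ?_)
      refine add_le_add (hγn s hs') ?_
      rw [norm_mul, Complex.norm_real, Real.norm_of_nonneg (hl0 n).1.le]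
      refine (mul_le_of_le_one_left (norm_nonneg _) (hl0 n).2).trans ?_
      exact (norm_sub_le _ _).trans (add_le_add_right (hγn s hs') _)
    rw [norm_mul]
    exact mul_le_mul hfC (hdiffn n) (norm_nonneg _) ((norm_nonneg _).trans hfC)
  · exact intervalIntegrable_const
  · by_cases hab : a = b
    · subst hab
      refine ae_of_all _ fun s _ => ?_
      simp
    · have hnull : ∀ᵐ s : ℝ, γ s ≠ 0 := by
        have hsub : {s : ℝ | γ s = 0}.Subsingleton := by
          intro s hs s' hs'
          have h1 : a + s * (b - a) = a + s' * (b - a) := by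
            exact (show γ s = 0 from hs).trans (show γ s' = 0 from hs').symm
          have h2 := mul_right_cancel₀ (sub_ne_zero.2 (Ne.symm hab)) (add_left_cancel h1)
          exact_mod_cast h2
        have := hsub.measure_zero (volume : Measure ℝ)
        rw [ae_iff]
        simpa using this
      filter_upwards [hnull] with s hs0 hs
      rw [uIoc_of_le zero_le_one] at hs
      have hs' : s ∈ Icc (0 : ℝ) 1 := ⟨hs.1.le, hs.2⟩
      have hlim : Tendsto (fun n => γ s + (l n : ℂ) * (p - γ s)) atTop (𝓝 (γ s)) := by
        simpa using (hltC.mul_const (p - γ s)).const_add (γ s)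
      refine Tendsto.mul ?_ ?_
      · refine (h.cont (γ s) ⟨hγK s hs', hs0⟩).tendsto.comp ?_
        refine tendsto_nhdsWithin_iff.2 ⟨hlim, ?_⟩
        filter_upwards [hlim.eventually_ne hs0] with n hn
        exact ⟨interior_subset (hptK n s hs'), hn⟩
      · simpa using ((hltC.mul_const (p - b)).const_add b).sub
          ((hltC.mul_const (p - a)).const_add a)

/-- The interior is convex, so f has a primitive there and the relation is exact for segments pushed
inside; `tendsto_segInt` carries it to the boundary. This matters because the Laplace kernel has a
factor 1/u and every path starts at 0. -/
theorem IsHolConvex.segInt_add {f : ℂ → ℂ} {K : Set ℂ} (h : IsHolConvex f K) {a b c : ℂ}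
    (ha : a ∈ K) (hb : b ∈ K) (hc : c ∈ K) : segInt f a b + segInt f b c = segInt f a c := by
  obtain ⟨p, hp⟩ := h.nonempty
  obtain ⟨g, hg⟩ := h.convex.interior.exists_forall_hasDerivWithinAt h.diff
  have hg' : ∀ u ∈ interior K, HasDerivAt g (f u) u := fun u hu =>
    (hg u hu).hasDerivAt (isOpen_interior.mem_nhds hu)
  have hmem : ∀ x ∈ K, ∀ n : ℕ, x + ((1 / ((n : ℝ) + 1) : ℝ) : ℂ) * (p - x) ∈ interior K := by
    intro x hx n
    have := h.convex.add_smul_sub_mem_interior hx hp (t := 1 / ((n : ℝ) + 1))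
      ⟨Nat.one_div_pos_of_nat, by simpa using Nat.one_div_le_one_div (α := ℝ) (Nat.zero_le n)⟩
    simpa using this
  refine tendsto_nhds_unique ((h.tendsto_segInt ha hb hp).add (h.tendsto_segInt hb hc hp)) ?_
  refine (h.tendsto_segInt ha hc hp).congr fun n => ?_
  have hi := h.convex.interior
  have hcf := h.diff.continuousOn
  rw [segInt_eq_sub_of_hasDerivAt hi hg' hcf (hmem a ha n) (hmem b hb n),
    segInt_eq_sub_of_hasDerivAt hi hg' hcf (hmem b hb n) (hmem c hc n),
    segInt_eq_sub_of_hasDerivAt hi hg' hcf (hmem a ha n) (hmem c hc n)]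
  ring

/-! ### Integrals along broken paths -/

/-- The path going from `0` to `A` for `s ∈ [0, 1]` and along `A + (s - 1) d` for `s ≥ 1`. -/
def bPath (A d : ℂ) (s : ℝ) : ℂ := (min s 1 : ℝ) * A + (max (s - 1) 0 : ℝ) * d

/-- The velocity of `bPath`. -/
def bVel (A d : ℂ) (s : ℝ) : ℂ := if s ≤ 1 then A else d

lemma bPath_of_le {A d : ℂ} {s : ℝ} (hs : s ≤ 1) : bPath A d s = s * A := by
  simp [bPath, min_eq_left hs, max_eq_right (sub_nonpos.2 hs)]

lemma bPath_of_ge {A d : ℂ} {s : ℝ} (hs : 1 ≤ s) : bPath A d s = A + (s - 1 : ℝ) * d := by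
  rw [bPath, min_eq_right hs, max_eq_left (sub_nonneg.2 hs)]; simp

lemma continuous_bPath (A d : ℂ) : Continuous (bPath A d) := by
  unfold bPath; fun_prop

lemma measurable_bVel (A d : ℂ) : Measurable (bVel A d) :=
  Measurable.ite measurableSet_Iic measurable_const measurable_const

lemma norm_bVel_le (A d : ℂ) (s : ℝ) : ‖bVel A d s‖ ≤ ‖A‖ + ‖d‖ := by
  unfold bVel; split_ifs
  · linarith [norm_nonneg d]
  · linarith [norm_nonneg A]

lemma integral_line_eq_segInt (f : ℂ → ℂ) (A d : ℂ) {l : ℝ} :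
    ∫ s in (0 : ℝ)..l, f (A + s * d) * d = segInt f A (A + l * d) := by
  rcases eq_or_ne l 0 with rfl | hl
  · simp [segInt]
  · have := intervalIntegral.smul_integral_comp_mul_left (a := 0) (b := 1)
      (fun s : ℝ => f (A + s * d) * d) l
    simp only [mul_zero, mul_one] at this
    rw [← this, segInt, ← intervalIntegral.integral_smul]
    refine intervalIntegral.integral_congr fun s _ => ?_
    simp only [Complex.real_smul]
    push_cast
    rw [show A + (s : ℂ) * (A + l * d - A) = A + l * s * d by ring]
    ring

lemma IsHolConvex.integral_bPath {f : ℂ → ℂ} {K : Set ℂ} (h : IsHolConvex f K) {A d : ℂ}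
    {l : ℝ} (hl : 0 < l) (hK : ∀ s ∈ Icc 0 l, bPath A d s ∈ K)
    (hint : IntervalIntegrable (fun s => f (bPath A d s) * bVel A d s) volume 0 l) :
    ∫ s in (0 : ℝ)..l, f (bPath A d s) * bVel A d s = segInt f 0 (bPath A d l) := by
  have h1 : ∀ m ∈ Icc (0 : ℝ) 1, ∫ s in (0 : ℝ)..m, f (bPath A d s) * bVel A d s
      = segInt f 0 (bPath A d m) := by
    intro m hm
    rw [bPath_of_le hm.2]
    have := integral_line_eq_segInt f 0 A (l := m)
    rw [zero_add] at this
    rw [← this]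
    refine intervalIntegral.integral_congr fun s hs => ?_
    rw [uIcc_of_le hm.1] at hs
    have hs1 : s ≤ 1 := hs.2.trans hm.2
    simp [bPath_of_le hs1, bVel, hs1]
  rcases le_total l 1 with hl1 | hl1
  · exact h1 l ⟨hl.le, hl1⟩
  · have hsub1 : uIcc (0 : ℝ) 1 ⊆ uIcc 0 l := by
      rw [uIcc_of_le zero_le_one, uIcc_of_le hl.le]; exact Icc_subset_Icc_right hl1
    have hsub2 : uIcc (1 : ℝ) l ⊆ uIcc 0 l := by
      rw [uIcc_of_le hl1, uIcc_of_le hl.le]; exact Icc_subset_Icc_left zero_le_one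
    rw [← intervalIntegral.integral_add_adjacent_intervals (hint.mono_set hsub1)
      (hint.mono_set hsub2), h1 1 ⟨zero_le_one, le_rfl⟩]
    have h2 : ∫ s in (1 : ℝ)..l, f (bPath A d s) * bVel A d s
        = segInt f (bPath A d 1) (bPath A d l) := by
      have e1 : bPath A d 1 = A := by simp [bPath_of_le le_rfl]
      rw [bPath_of_ge hl1, e1, ← integral_line_eq_segInt]
      have := intervalIntegral.integral_comp_sub_right (a := 1) (b := l)
        (fun s : ℝ => f (A + s * d) * d) 1
      rw [sub_self] at this
      rw [← this]
      refine intervalIntegral.integral_congr_ae ?_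
      rw [uIoc_of_le hl1]
      refine ae_of_all _ fun s hs => ?_
      rw [bPath_of_ge hs.1.le, bVel, if_neg (not_le.2 hs.1)]
    rw [h2]
    exact h.segInt_add h.zero_mem (hK 1 ⟨zero_le_one, hl1⟩) (hK l ⟨hl.le, le_rfl⟩)

lemma norm_tail_integral_le {F : ℝ → ℂ} {B m l : ℝ} (hm : 0 < m)
    (hF : ∀ s ∈ Ioi l, ‖F s‖ ≤ B * Real.exp (-(m * s))) :
    ‖∫ s in Ioi l, F s‖ ≤ B * (Real.exp (-(m * l)) / m) := by
  have hi : IntegrableOn (fun s => Real.exp (-m * s)) (Ioi l) := exp_neg_integrableOn_Ioi l hm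
  have h2 := norm_integral_le_of_norm_le (hi.const_mul B)
    (f := F) ((ae_restrict_mem measurableSet_Ioi).mono fun s hs => by
      simpa [neg_mul] using hF s hs)
  refine h2.trans (le_of_eq ?_)
  rw [integral_const_mul, integral_exp_mul_Ioi (by linarith) l]
  ring_nf

/-- Two integrals along broken paths that can be deformed into each other up to the parameter
value `l` differ by the tails and by the integral over the segment joining the points reached. -/
theorem norm_integral_bPath_sub_le {f : ℂ → ℂ} {K : Set ℂ} (h : IsHolConvex f K)
    {A₁ d₁ A₂ d₂ : ℂ} {F₁ F₂ : ℝ → ℂ} {l m B B' : ℝ} (hl : 0 < l) (hm : 0 < m)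
    (hF₁ : IntegrableOn F₁ (Ioi 0)) (hF₂ : IntegrableOn F₂ (Ioi 0))
    (hK₁ : ∀ s ∈ Icc 0 l, bPath A₁ d₁ s ∈ K) (hK₂ : ∀ s ∈ Icc 0 l, bPath A₂ d₂ s ∈ K)
    (h₁ : ∀ s ∈ Ioc 0 l, F₁ s = f (bPath A₁ d₁ s) * bVel A₁ d₁ s)
    (h₂ : ∀ s ∈ Ioc 0 l, F₂ s = f (bPath A₂ d₂ s) * bVel A₂ d₂ s)
    (hB₁ : ∀ s ∈ Ioi l, ‖F₁ s‖ ≤ B * Real.exp (-(m * s)))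
    (hB₂ : ∀ s ∈ Ioi l, ‖F₂ s‖ ≤ B * Real.exp (-(m * s)))
    (hB' : ∀ u ∈ segment ℝ (bPath A₂ d₂ l) (bPath A₁ d₁ l), ‖f u‖ ≤ B') :
    ‖(∫ s in Ioi 0, F₁ s) - ∫ s in Ioi 0, F₂ s‖ ≤
      2 * (B * (Real.exp (-(m * l)) / m)) + B' * ‖bPath A₁ d₁ l - bPath A₂ d₂ l‖ := by
  -- Up to l, each path integral is replaced by the integral over the chord from 0 to the point
  -- reached; only the chords and the tails remain to be compared.
  have split : ∀ {F : ℝ → ℂ} {A d : ℂ}, IntegrableOn F (Ioi 0) →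
      (∀ s ∈ Icc 0 l, bPath A d s ∈ K) →
      (∀ s ∈ Ioc 0 l, F s = f (bPath A d s) * bVel A d s) →
      ∫ s in Ioi 0, F s = segInt f 0 (bPath A d l) + ∫ s in Ioi l, F s := by
    intro F A d hF hK hFe
    have hi : IntegrableOn F (Ioc 0 l) := hF.mono_set Ioc_subset_Ioi_self
    have hi' : IntegrableOn (fun s => f (bPath A d s) * bVel A d s) (Ioc 0 l) :=
      hi.congr_fun hFe measurableSet_Ioc
    rw [← Ioc_union_Ioi_eq_Ioi hl.le, setIntegral_union Ioc_disjoint_Ioi_same measurableSet_Ioi hi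
      (hF.mono_set (Ioi_subset_Ioi hl.le)), setIntegral_congr_fun measurableSet_Ioc hFe,
      ← intervalIntegral.integral_of_le hl.le, h.integral_bPath hl hK
        ((intervalIntegrable_iff_integrableOn_Ioc_of_le hl.le).2 hi')]
  have hadd := h.segInt_add h.zero_mem (hK₂ l ⟨hl.le, le_rfl⟩) (hK₁ l ⟨hl.le, le_rfl⟩)
  have e : (∫ s in Ioi 0, F₁ s) - ∫ s in Ioi 0, F₂ s = (∫ s in Ioi l, F₁ s)
      - (∫ s in Ioi l, F₂ s) + segInt f (bPath A₂ d₂ l) (bPath A₁ d₁ l) := by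
    rw [split hF₁ hK₁ h₁, split hF₂ hK₂ h₂, ← hadd]; ring
  rw [e]
  have t₁ := norm_tail_integral_le hm hB₁
  have t₂ := norm_tail_integral_le hm hB₂
  have t₃ := norm_segInt_le hB'
  calc _ ≤ ‖(∫ s in Ioi l, F₁ s) - ∫ s in Ioi l, F₂ s‖ + _ := norm_add_le _ _
    _ ≤ (‖∫ s in Ioi l, F₁ s‖ + ‖∫ s in Ioi l, F₂ s‖) + _ :=
      add_le_add_left (norm_sub_le _ _) _
    _ ≤ _ := by linarith

end SPCP

end

/-! ### The recursion for the Taylor coefficients in z and its majorant -/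

open scoped ENNReal Topology

noncomputable section

namespace SPCP

open Set Filter Finset

/-! ### The sequence of Taylor coefficients of the solution in the Borel plane -/

/-- The solution of the recursion
`w (n + S) = ∑_k q_k ∑_{i + j = n} (n! / j!) c_{k,i} w (j + k₁)` with initial values `w j`,
`j < S`. -/
def cauchySeq (S : ℕ) (𝒜 : Finset (ℕ × ℕ × ℕ)) (q : ℕ × ℕ × ℕ → ℂ) (c : ℕ × ℕ × ℕ → ℕ → ℂ)
    (w : ℕ → ℂ) (n : ℕ) : ℂ :=
  if n < S then w n else
    ∑ k ∈ 𝒜, q k * ∑ p ∈ antidiagonal (n - S), ((n - S).factorial / p.2.factorial : ℂ) * c k p.1 *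
      (if _h : p.2 + k.2.1 < n then cauchySeq S 𝒜 q c w (p.2 + k.2.1) else 0)
  termination_by n

section

variable {S : ℕ} {𝒜 : Finset (ℕ × ℕ × ℕ)}

lemma cauchySeq_of_lt (q : ℕ × ℕ × ℕ → ℂ) (c : ℕ × ℕ × ℕ → ℕ → ℂ) (w : ℕ → ℂ) {n : ℕ}
    (hn : n < S) : cauchySeq S 𝒜 q c w n = w n := by
  rw [cauchySeq, if_pos hn]

/-- The guard in the definition of `cauchySeq` serves termination only: for k₁ < S it always holds.
-/
lemma cauchySeq_add (hS : ∀ k ∈ 𝒜, k.2.1 < S) (q : ℕ × ℕ × ℕ → ℂ) (c : ℕ × ℕ × ℕ → ℕ → ℂ)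
    (w : ℕ → ℂ) (n : ℕ) : cauchySeq S 𝒜 q c w (n + S) =
      ∑ k ∈ 𝒜, q k * ∑ p ∈ antidiagonal n, (n.factorial / p.2.factorial : ℂ) * c k p.1 *
        cauchySeq S 𝒜 q c w (p.2 + k.2.1) := by
  rw [cauchySeq, if_neg (by omega)]
  refine Finset.sum_congr rfl fun k hk => ?_
  rw [Nat.add_sub_cancel]
  congr 1
  refine Finset.sum_congr rfl fun p hp => ?_
  have := hS k hk
  have := mem_antidiagonal.1 hp
  rw [dif_pos (by omega)]

/-- A class of functions closed under the ring operations contains the terms of the sequence. -/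
lemma cauchySeq_mem (hS : ∀ k ∈ 𝒜, k.2.1 < S) {E : Type*} (𝓕 : Subalgebra ℂ (E → ℂ))
    {q : ℕ × ℕ × ℕ → E → ℂ} {c : ℕ × ℕ × ℕ → ℕ → E → ℂ} {w : ℕ → E → ℂ}
    (hq : ∀ k ∈ 𝒜, q k ∈ 𝓕) (hc : ∀ k ∈ 𝒜, ∀ m, c k m ∈ 𝓕) (hw : ∀ j < S, w j ∈ 𝓕) (n : ℕ) :
    (fun x => cauchySeq S 𝒜 (fun k => q k x) (fun k m => c k m x) (fun j => w j x) n) ∈ 𝓕 := by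
  induction n using Nat.strong_induction_on with
  | _ n ih =>
    rcases lt_or_ge n S with hn | hn
    · convert hw n hn using 2 with x
      exact cauchySeq_of_lt _ _ _ hn
    · obtain ⟨m, rfl⟩ := Nat.exists_eq_add_of_le' hn
      have : (fun x => cauchySeq S 𝒜 (fun k => q k x) (fun k m => c k m x) (fun j => w j x)
          (m + S)) = ∑ k ∈ 𝒜, q k * ∑ p ∈ antidiagonal m,
            ((m.factorial / p.2.factorial : ℂ) • c k p.1) * (fun x => cauchySeq S 𝒜
              (fun k => q k x) (fun k m => c k m x) (fun j => w j x) (p.2 + k.2.1)) := by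
        funext x
        rw [cauchySeq_add hS]
        simp [Finset.sum_apply, mul_assoc]
      rw [this]
      refine sum_mem fun k hk => mul_mem (hq k hk) (sum_mem fun p hp => mul_mem
        (𝓕.smul_mem (hc k hk _) _) (ih _ ?_))
      have := hS k hk
      have := mem_antidiagonal.1 hp
      omega

lemma rSeq_mono (b : ℝ) : Monotone (rSeq b) := by
  intro m n hmn
  refine Finset.sum_le_sum_of_subset_of_nonneg (by simpa using hmn) fun i _ _ => by positivity

/-- Between the indices n + k and n + s the sum r_b gains s - k terms, each at least (n + s +
1)^{-b}. This gain in the exponential weight is what absorbs the coefficients of the equation. -/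
lemma rSeq_add_le {b : ℝ} (hb : 0 ≤ b) {i n s k : ℕ} (hin : i ≤ n + k) (hk : k ≤ s) :
    rSeq b i + (s - k : ℕ) * (1 / ((n + s + 1 : ℕ) : ℝ) ^ b) ≤ rSeq b (n + s) := by
  refine (add_le_add_left (rSeq_mono b hin) _).trans ?_
  unfold rSeq
  rw [← Finset.sum_range_add_sum_Ico _ (show n + k + 1 ≤ n + s + 1 by omega)]
  refine add_le_add_right ?_ _
  have hcard : (Finset.Ico (n + k + 1) (n + s + 1)).card = s - k := by
    rw [Nat.card_Ico]; omega
  rw [← hcard, ← nsmul_eq_mul]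
  refine Finset.card_nsmul_le_sum _ _ _ fun m hm => ?_
  have hm' : ((m : ℝ) + 1) ≤ ((n + s + 1 : ℕ) : ℝ) := by
    have := (Finset.mem_Ico.1 hm).2
    exact_mod_cast this
  gcongr

/-- The quotient (j + k)!/j! costs at most k factors N = n + s + 1, while n!/(n + s)! gains s
factors n + 1, and N ≤ (n + 1)(s + 1). The surplus of s - k factors N is available to pay for the
coefficients, up to the constant (s + 1)^s. -/
lemma factorial_step {n j k s : ℕ} (hjn : j ≤ n) (hk : k ≤ s) :
    n.factorial * (j + k).factorial * (n + s + 1) ^ (s - k) ≤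
      j.factorial * ((n + s).factorial * (s + 1) ^ s) := by
  have h1 : (j + k).factorial ≤ j.factorial * (n + s + 1) ^ k := by
    rw [← Nat.factorial_mul_ascFactorial]
    gcongr
    exact (Nat.ascFactorial_le_pow_add _ _).trans (Nat.pow_le_pow_left (by omega) _)
  have h2 : n.factorial * (n + 1) ^ s ≤ (n + s).factorial := Nat.factorial_mul_pow_le_factorial
  have h3 : (n + s + 1) ^ s ≤ (n + 1) ^ s * (s + 1) ^ s := by
    rw [← mul_pow]
    refine Nat.pow_le_pow_left ?_ _
    nlinarith
  calc _ ≤ n.factorial * (j.factorial * (n + s + 1) ^ k) * (n + s + 1) ^ (s - k) := by gcongr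
    _ = j.factorial * (n.factorial * (n + s + 1) ^ s) := by
      rw [← Nat.add_sub_of_le hk, pow_add, Nat.add_sub_cancel_left]; ring
    _ ≤ j.factorial * (n.factorial * ((n + 1) ^ s * (s + 1) ^ s)) := by gcongr
    _ = j.factorial * (n.factorial * (n + 1) ^ s * (s + 1) ^ s) := by ring
    _ ≤ _ := by gcongr

/-- Induction along the recursion, balancing three scales: `hexp` matches the exponential weights,
`hfac` matches the power N^{S - k₁} with the factorials, and `hpow` keeps a factor 1/R that beats
the remaining constants. The numbers L and D are arbitrary, so one statement serves the decaying,
the growing and the purely exponential weights, with the same R. -/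
theorem norm_cauchySeq_le (hS : ∀ k ∈ 𝒜, k.2.1 < S) {q : ℕ × ℕ × ℕ → ℂ}
    {c : ℕ × ℕ × ℕ → ℕ → ℂ} {w : ℕ → ℂ} {b L D C₀ Kc ρ R : ℝ} (hb : 0 ≤ b) (hL : 0 ≤ L)
    (hD : 0 ≤ D) (hC₀ : 0 ≤ C₀) (hKc : 0 ≤ Kc) (hρ : 0 < ρ) (hR1 : 1 ≤ R) (hρR : 2 ≤ ρ * R)
    (hR : 2 * #𝒜 * Kc * C₀ * (S + 1) ^ S ≤ R)
    (hw : ∀ j < S, ‖w j‖ ≤ D * Real.exp (rSeq b 0 * L))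
    (hq : ∀ k ∈ 𝒜, ∀ N : ℕ, 1 ≤ N →
      ‖q k‖ ≤ C₀ * (N : ℝ) ^ (S - k.2.1) * Real.exp ((S - k.2.1 : ℕ) * (1 / (N : ℝ) ^ b) * L))
    (hc : ∀ k ∈ 𝒜, ∀ m, ‖c k m‖ ≤ Kc * ρ⁻¹ ^ m) (n : ℕ) :
    ‖cauchySeq S 𝒜 q c w n‖ ≤ D * (R ^ n * n.factorial) * Real.exp (rSeq b n * L) := by
  have hR0 : 0 < R := by linarith
  induction n using Nat.strong_induction_on with
  | _ n ih =>
    rcases lt_or_ge n S with hn | hn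
    · rw [cauchySeq_of_lt _ _ _ hn]
      refine (hw n hn).trans ?_
      have h1 : 1 ≤ R ^ n * n.factorial := one_le_mul_of_one_le_of_one_le (one_le_pow₀ hR1)
        (by exact_mod_cast n.factorial_pos)
      have h2 := rSeq_mono b (Nat.zero_le n)
      gcongr
      exact le_mul_of_one_le_right hD h1
    · obtain ⟨m, rfl⟩ := Nat.exists_eq_add_of_le' hn
      rw [cauchySeq_add hS]
      set X := D * (R ^ (m + S) * (m + S).factorial) * Real.exp (rSeq b (m + S) * L) with hX
      have hX0 : 0 ≤ X := by positivity
      have hterm : ∀ k ∈ 𝒜, ∀ p ∈ antidiagonal m,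
          ‖q k * ((m.factorial / p.2.factorial : ℂ) * c k p.1 *
            cauchySeq S 𝒜 q c w (p.2 + k.2.1))‖ ≤
          (Kc * C₀ * (S + 1) ^ S) / R * X * (1 / 2) ^ p.1 := by
        intro k hk p hp
        have hkS := hS k hk
        have hpm := mem_antidiagonal.1 hp
        -- N = m + S + 1 is the base occurring both in `rSeq_add_le` and in `factorial_step`.
        have hq' := hq k hk (m + S + 1) (by omega)
        have hc' := hc k hk p.1
        have hih := ih (p.2 + k.2.1) (by omega)
        have hr := rSeq_add_le hb (show p.2 + k.2.1 ≤ m + k.2.1 by omega) hkS.le (s := S)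
        have hfac : (m.factorial : ℝ) / p.2.factorial * (p.2 + k.2.1).factorial *
            ((m + S + 1 : ℕ) : ℝ) ^ (S - k.2.1) ≤ (m + S).factorial * (S + 1) ^ S := by
          rw [div_mul_eq_mul_div, div_mul_eq_mul_div, div_le_iff₀' (by positivity)]
          exact_mod_cast factorial_step (show p.2 ≤ m by omega) hkS.le
        -- Since k₁ ≤ S - 1, a factor 1/R is left over; ρR ≥ 2 makes the sum over the antidiagonal
        -- geometric.
        have hpow : ρ⁻¹ ^ p.1 * R ^ (p.2 + k.2.1) ≤ R ^ (m + S) / R * (1 / 2) ^ p.1 := by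
          have h1 : ρ⁻¹ ≤ R * (1 / 2) := by
            rw [inv_le_iff_one_le_mul₀ hρ]; linarith
          calc _ ≤ (R * (1 / 2)) ^ p.1 * R ^ (p.2 + k.2.1) := by gcongr
            _ = R ^ (m + k.2.1) * (1 / 2) ^ p.1 := by
              rw [mul_pow, ← hpm]; ring
            _ ≤ R ^ (m + (S - 1)) * (1 / 2) ^ p.1 := by
              gcongr
              omega
            _ = _ := by
              rw [show m + S = m + (S - 1) + 1 by omega, pow_succ]
              field_simp
        have hexp : Real.exp (rSeq b (p.2 + k.2.1) * L) *
            Real.exp ((S - k.2.1 : ℕ) * (1 / ((m + S + 1 : ℕ) : ℝ) ^ b) * L)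
            ≤ Real.exp (rSeq b (m + S) * L) := by
          rw [← Real.exp_add, ← add_mul]
          gcongr
        have hnf : ‖(m.factorial / p.2.factorial : ℂ)‖ = (m.factorial : ℝ) / p.2.factorial := by
          rw [norm_div, Complex.norm_natCast, Complex.norm_natCast]
        rw [norm_mul, norm_mul, norm_mul, hnf]
        calc _ ≤ (C₀ * ((m + S + 1 : ℕ) : ℝ) ^ (S - k.2.1) *
              Real.exp ((S - k.2.1 : ℕ) * (1 / ((m + S + 1 : ℕ) : ℝ) ^ b) * L)) *
              ((m.factorial : ℝ) / p.2.factorial * (Kc * ρ⁻¹ ^ p.1) *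
              (D * (R ^ (p.2 + k.2.1) * (p.2 + k.2.1).factorial) *
                Real.exp (rSeq b (p.2 + k.2.1) * L))) := by gcongr
          _ = Kc * C₀ * D * ((m.factorial : ℝ) / p.2.factorial * (p.2 + k.2.1).factorial *
            ((m + S + 1 : ℕ) : ℝ) ^ (S - k.2.1)) * (ρ⁻¹ ^ p.1 * R ^ (p.2 + k.2.1)) *
            (Real.exp (rSeq b (p.2 + k.2.1) * L) *
            Real.exp ((S - k.2.1 : ℕ) * (1 / ((m + S + 1 : ℕ) : ℝ) ^ b) * L)) := by ring
          _ ≤ Kc * C₀ * D * ((m + S).factorial * (S + 1) ^ S) *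
            (R ^ (m + S) / R * (1 / 2) ^ p.1) * Real.exp (rSeq b (m + S) * L) := by gcongr
          _ = _ := by rw [hX]; ring
      have hsum : ∀ k ∈ 𝒜, ‖q k * ∑ p ∈ antidiagonal m, (m.factorial / p.2.factorial : ℂ) *
          c k p.1 * cauchySeq S 𝒜 q c w (p.2 + k.2.1)‖ ≤
          (Kc * C₀ * (S + 1) ^ S) / R * X * 2 := by
        intro k hk
        rw [Finset.mul_sum]
        refine (norm_sum_le_of_le _ (hterm k hk)).trans ?_
        rw [← Finset.mul_sum]
        refine mul_le_mul_of_nonneg_left ?_ (by positivity)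
        rw [Finset.Nat.sum_antidiagonal_eq_sum_range_succ (fun i _ => (1 / 2 : ℝ) ^ i)]
        exact sum_geometric_two_le _
      refine (norm_sum_le_of_le _ hsum).trans ?_
      rw [Finset.sum_const, nsmul_eq_mul]
      calc _ = (2 * #𝒜 * Kc * C₀ * (S + 1) ^ S) / R * X := by ring
        _ ≤ 1 * X := by
          gcongr
          exact (div_le_one hR0).2 hR
        _ = X := one_mul X

end

/-! ### The coefficients of the recursion -/

/-- The factor `ε^{-k₀} τ^{k₀} e^{-k₂ τ} / P(τ)`. -/
def qCoef (P : Polynomial ℂ) (k : ℕ × ℕ × ℕ) (τ ε : ℂ) : ℂ :=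
  τ ^ k.1 / ε ^ k.1 * Complex.exp (-(k.2.2 * τ)) / P.eval τ

lemma rpow_le_mul_exp {p x : ℝ} (hp : 0 ≤ p) (hx : 0 ≤ x) :
    x ^ p ≤ (⌈p⌉₊.factorial : ℝ) * Real.exp x := by
  have hf : (1 : ℝ) ≤ ⌈p⌉₊.factorial := by exact_mod_cast Nat.factorial_pos _
  rcases le_total x 1 with h | h
  · calc x ^ p ≤ 1 := Real.rpow_le_one hx h hp
      _ ≤ 1 * Real.exp x := by rw [one_mul]; exact Real.one_le_exp hx
      _ ≤ _ := by gcongr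
  · calc x ^ p ≤ x ^ ((⌈p⌉₊ : ℕ) : ℝ) := Real.rpow_le_rpow_of_exponent_le h (Nat.le_ceil p)
      _ = x ^ ⌈p⌉₊ := Real.rpow_natCast _ _
      _ ≤ _ := by
        have := Real.pow_div_factorial_le_exp x hx ⌈p⌉₊
        rwa [div_le_iff₀' (by positivity)] at this

/-- The double exponential weights absorb the exponential factors. -/
lemma exp_mul_le {ξ b σ₂ σ₃ : ℝ} (hξ : 0 < ξ) (_hb : 0 ≤ b) (hσ₂ : 0 < σ₂) (hσ : ξ ≤ σ₃) (k : ℕ) :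
    ∃ C : ℝ, 0 ≤ C ∧ ∀ x : ℝ, ∀ N : ℕ, 1 ≤ N →
      Real.exp (k * x) ≤
        C * (N : ℝ) ^ (b * k / ξ) * Real.exp (1 / (N : ℝ) ^ b * (σ₂ * Real.exp (σ₃ * x))) := by
  have hσ₃ : 0 < σ₃ := hξ.trans_le hσ
  -- Write e^{kx} = (e^{σ₃x})^p, where e^{σ₃x} is N^b/σ₂ times the exponent y below; then y^p is
  -- absorbed by e^y.
  set p : ℝ := k / σ₃ with hp
  have hp0 : 0 ≤ p := by positivity
  refine ⟨(1 / σ₂) ^ p * (⌈p⌉₊.factorial : ℝ), by positivity, fun x N hN => ?_⟩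
  have hN0 : (0 : ℝ) < N := by exact_mod_cast hN
  have hN1 : (1 : ℝ) ≤ N := by exact_mod_cast hN
  set y : ℝ := 1 / (N : ℝ) ^ b * (σ₂ * Real.exp (σ₃ * x)) with hy
  have hy0 : 0 ≤ y := by positivity
  have e1 : Real.exp (k * x) = ((1 / σ₂) * (N : ℝ) ^ b * y) ^ p := by
    have : (1 / σ₂) * (N : ℝ) ^ b * y = Real.exp (σ₃ * x) := by
      rw [hy]; field_simp
    rw [this, ← Real.exp_mul]
    congr 1
    rw [hp]; field_simp
  rw [e1, Real.mul_rpow (by positivity) hy0, Real.mul_rpow (by positivity) (by positivity),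
    ← Real.rpow_mul hN0.le]
  -- The assumption ξ ≤ σ₃ enters here.
  have h2 : (N : ℝ) ^ (b * p) ≤ (N : ℝ) ^ (b * k / ξ) := by
    refine Real.rpow_le_rpow_of_exponent_le hN1 ?_
    rw [hp, mul_div_assoc]
    gcongr
  have h3 := rpow_le_mul_exp hp0 hy0
  calc _ ≤ (1 / σ₂) ^ p * (N : ℝ) ^ (b * k / ξ) * ((⌈p⌉₊.factorial : ℝ) * Real.exp y) := by gcongr
    _ = _ := by ring

/-- The factor (|τ|/|ε|)^{k₀} is bounded by N^{bk₀} exp(N^{-b}σ₁|τ|/|ε|), and e^{-k₂τ} by N^{bk₂/ξ}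
exp(N^{-b}X), up to constants. The condition S ≥ k₁ + bk₀ + bk₂/ξ says exactly that the product of
the powers is at most N^{S - k₁}. As S - k₁ ≥ 1, the exponent may be multiplied by S - k₁, which
gives the increment of `rSeq_add_le`. -/
lemma norm_qCoef_le {P : Polynomial ℂ} {k : ℕ × ℕ × ℕ} {S : ℕ} {ξ b σ₁ cP C X : ℝ} {τ ε : ℂ}
    (hk : (k.2.1 : ℝ) + b * k.1 + b * k.2.2 / ξ ≤ S ∧ k.2.1 < S)
    (hσ₁ : 0 < σ₁) (hX : 0 ≤ X) (hC : 0 ≤ C) (hcP : 0 < cP) (hP : cP ≤ ‖P.eval τ‖)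
    (hexp : ∀ N : ℕ, 1 ≤ N → ‖Complex.exp (-(k.2.2 * τ))‖ ≤
      C * (N : ℝ) ^ (b * k.2.2 / ξ) * Real.exp (1 / (N : ℝ) ^ b * X)) {N : ℕ} (hN : 1 ≤ N) :
    ‖qCoef P k τ ε‖ ≤ (k.1.factorial / σ₁ ^ k.1 * C / cP) * (N : ℝ) ^ (S - k.2.1) *
      Real.exp ((S - k.2.1 : ℕ) * (1 / (N : ℝ) ^ b) * (σ₁ / ‖ε‖ * ‖τ‖ + X)) := by
  have hN0 : (0 : ℝ) < N := by exact_mod_cast hN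
  have hN1 : (1 : ℝ) ≤ N := by exact_mod_cast hN
  set x : ℝ := ‖τ‖ / ‖ε‖ with hx
  have hx0 : 0 ≤ x := by positivity
  have h1 : x ^ k.1 ≤ k.1.factorial / σ₁ ^ k.1 * (N : ℝ) ^ (b * k.1) *
      Real.exp (1 / (N : ℝ) ^ b * (σ₁ * x)) := by
    have := Real.pow_div_factorial_le_exp (1 / (N : ℝ) ^ b * (σ₁ * x)) (by positivity) k.1
    rw [div_le_iff₀' (by positivity)] at this
    have e : x ^ k.1 = (1 / (N : ℝ) ^ b * (σ₁ * x)) ^ k.1 * ((N : ℝ) ^ (b * k.1) / σ₁ ^ k.1) := by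
      rw [Real.rpow_mul hN0.le, Real.rpow_natCast, ← div_pow, ← mul_pow]
      congr 1
      field_simp
    rw [e]
    calc _ ≤ (k.1.factorial * Real.exp (1 / (N : ℝ) ^ b * (σ₁ * x))) *
        ((N : ℝ) ^ (b * k.1) / σ₁ ^ k.1) := by gcongr
      _ = _ := by ring
  have h2 := hexp N hN
  have hpow : (N : ℝ) ^ (b * k.1) * (N : ℝ) ^ (b * k.2.2 / ξ) ≤ (N : ℝ) ^ (S - k.2.1) := by
    rw [← Real.rpow_add hN0, ← Real.rpow_natCast]
    refine Real.rpow_le_rpow_of_exponent_le hN1 ?_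
    rw [Nat.cast_sub hk.2.le]
    linarith [hk.1]
  have hS1 : (1 : ℝ) ≤ (S - k.2.1 : ℕ) := by
    have := hk.2
    exact_mod_cast (show 1 ≤ S - k.2.1 by omega)
  have hee : Real.exp (1 / (N : ℝ) ^ b * (σ₁ * x)) * Real.exp (1 / (N : ℝ) ^ b * X) ≤
      Real.exp ((S - k.2.1 : ℕ) * (1 / (N : ℝ) ^ b) * (σ₁ / ‖ε‖ * ‖τ‖ + X)) := by
    rw [← Real.exp_add, ← mul_add]
    refine Real.exp_le_exp.2 ?_
    rw [mul_assoc]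
    have e : σ₁ / ‖ε‖ * ‖τ‖ = σ₁ * x := by rw [hx]; ring
    rw [e]
    exact le_mul_of_one_le_left (by positivity) hS1
  have e3 : ‖qCoef P k τ ε‖ = x ^ k.1 * ‖Complex.exp (-(k.2.2 * τ))‖ / ‖P.eval τ‖ := by
    rw [qCoef, norm_div, norm_mul, norm_div, norm_pow, norm_pow, hx, div_pow]
  rw [e3]
  calc _ ≤ (k.1.factorial / σ₁ ^ k.1 * (N : ℝ) ^ (b * k.1) *
      Real.exp (1 / (N : ℝ) ^ b * (σ₁ * x))) * (C * (N : ℝ) ^ (b * k.2.2 / ξ) *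
        Real.exp (1 / (N : ℝ) ^ b * X)) / cP := by gcongr
    _ = (k.1.factorial / σ₁ ^ k.1 * C / cP) * ((N : ℝ) ^ (b * k.1) * (N : ℝ) ^ (b * k.2.2 / ξ)) *
      (Real.exp (1 / (N : ℝ) ^ b * (σ₁ * x)) * Real.exp (1 / (N : ℝ) ^ b * X)) := by ring
    _ ≤ _ := by gcongr

end SPCP

end

/-! ### Generating series and the Cauchy problem with τ and ε as parameters -/

open scoped ENNReal Topology

noncomputable section

namespace SPCP

open Set Filter Finset

/-! ### Exponential generating series -/

/-- The series `∑ w n z^n / n!`. -/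
def egs (w : ℕ → ℂ) (z : ℂ) : ℂ := ∑' n : ℕ, w n * z ^ n / n.factorial

lemma norm_egs_term_le {w : ℕ → ℂ} {D Q : ℝ} (hQ : 0 ≤ Q)
    (hw : ∀ n, ‖w n‖ ≤ D * (Q ^ n * n.factorial)) {z : ℂ} (hz : 2 * Q * ‖z‖ ≤ 1) (n : ℕ) :
    ‖w n * z ^ n / n.factorial‖ ≤ D * (1 / 2) ^ n := by
  have hf : (0 : ℝ) < n.factorial := by exact_mod_cast n.factorial_pos
  have hD : 0 ≤ D := by simpa using (norm_nonneg _).trans (hw 0)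
  rw [norm_div, norm_mul, norm_pow, Complex.norm_natCast, div_le_iff₀ hf]
  calc _ ≤ D * (Q ^ n * n.factorial) * ‖z‖ ^ n := by gcongr; exact hw n
    _ = D * (Q * ‖z‖) ^ n * n.factorial := by rw [mul_pow]; ring
    _ ≤ D * (1 / 2) ^ n * n.factorial := by gcongr; linarith

lemma summable_half_pow (D : ℝ) : Summable fun n : ℕ => D * (1 / 2 : ℝ) ^ n :=
  summable_geometric_two.mul_left D

lemma summable_norm_egs {w : ℕ → ℂ} {D Q : ℝ} (hQ : 0 ≤ Q)
    (hw : ∀ n, ‖w n‖ ≤ D * (Q ^ n * n.factorial)) {z : ℂ} (hz : 2 * Q * ‖z‖ ≤ 1) :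
    Summable fun n : ℕ => ‖w n * z ^ n / n.factorial‖ :=
  Summable.of_nonneg_of_le (fun _ => norm_nonneg _) (norm_egs_term_le hQ hw hz)
    (summable_half_pow D)

lemma norm_egs_le {w : ℕ → ℂ} {D Q : ℝ} (hQ : 0 ≤ Q)
    (hw : ∀ n, ‖w n‖ ≤ D * (Q ^ n * n.factorial)) {z : ℂ} (hz : 2 * Q * ‖z‖ ≤ 1) :
    ‖egs w z‖ ≤ D * 2 := by
  rw [← tsum_geometric_two, ← tsum_mul_left]
  exact tsum_of_norm_bounded (summable_half_pow D).hasSum (norm_egs_term_le hQ hw hz)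

lemma egs_zero (w : ℕ → ℂ) : egs w 0 = w 0 := by
  rw [egs, tsum_eq_single 0]
  · simp
  · intro n hn; simp [hn]

/-- The inequality (n + j)! ≤ 2^{n+j} n! j! doubles the rate once, whatever j is. All derivatives in
z are thus controlled on a common disc; this is the origin of the condition 4Rβ ≤ 1 in
`BorelProblem`. -/
lemma norm_shift_le {w : ℕ → ℂ} {D R : ℝ} (hD : 0 ≤ D) (hR : 0 ≤ R)
    (hw : ∀ n, ‖w n‖ ≤ D * (R ^ n * n.factorial)) (j n : ℕ) :
    ‖w (n + j)‖ ≤ D * ((2 * R) ^ j * j.factorial) * ((2 * R) ^ n * n.factorial) := by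
  have h : ((n + j).factorial : ℝ) ≤ 2 ^ (n + j) * (n.factorial * j.factorial) := by
    have h1 := Nat.add_choose_mul_factorial_mul_factorial n j
    have h2 : (n + j).choose n ≤ 2 ^ (n + j) := Nat.choose_le_two_pow _ _
    have : (n + j).factorial ≤ 2 ^ (n + j) * (n.factorial * j.factorial) := by
      rw [← h1, mul_assoc]; gcongr
      rw [← Nat.choose_symm_add]; exact h2
    exact_mod_cast this
  calc _ ≤ D * (R ^ (n + j) * (n + j).factorial) := hw _
    _ ≤ D * (R ^ (n + j) * (2 ^ (n + j) * (n.factorial * j.factorial))) := by gcongr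
    _ = _ := by rw [mul_pow, mul_pow]; ring

lemma hasDerivAt_egs {w : ℕ → ℂ} {D Q : ℝ} (hQ : 0 ≤ Q) {β : ℝ} (hβ : 2 * Q * β ≤ 1)
    (hw : ∀ n, ‖w (n + 1)‖ ≤ D * (Q ^ n * n.factorial)) {z : ℂ} (hz : z ∈ Metric.ball 0 β) :
    HasDerivAt (egs w) (egs (fun n => w (n + 1)) z) z := by
  have hβ0 : 0 < β := Metric.nonempty_ball.1 ⟨z, hz⟩
  have hle : ∀ y ∈ Metric.ball (0 : ℂ) β, 2 * Q * ‖y‖ ≤ 1 := by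
    intro y hy
    have : ‖y‖ ≤ β := by simpa using (mem_ball_zero_iff.1 hy).le
    exact (mul_le_mul_of_nonneg_left this (by positivity)).trans hβ
  -- The termwise derivative is written by cases, with value 0 at n = 0, so that the shifted series
  -- appears without subtraction in the index.
  set g' : ℕ → ℂ → ℂ := fun n y => match n with
    | 0 => 0
    | n + 1 => w (n + 1) * y ^ n / n.factorial with hg'
  set u : ℕ → ℝ := fun n => match n with
    | 0 => 0
    | n + 1 => D * (1 / 2) ^ n with hu
  have hus : Summable u := (summable_nat_add_iff 1).1 (summable_half_pow D)
  have hder : ∀ n, ∀ y ∈ Metric.ball (0 : ℂ) β,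
      HasDerivAt (fun y => w n * y ^ n / n.factorial) (g' n y) y := by
    intro n y _
    cases n with
    | zero => simpa [hg'] using hasDerivAt_const y (w 0)
    | succ n =>
      have h := ((hasDerivAt_pow (n + 1) y).const_mul (w (n + 1))).div_const
        ((n + 1).factorial : ℂ)
      convert! h using 1
      have : (n.factorial : ℂ) ≠ 0 := by exact_mod_cast n.factorial_ne_zero
      have : ((n : ℂ) + 1) ≠ 0 := by exact_mod_cast n.succ_ne_zero
      simp only [hg', Nat.factorial_succ, Nat.add_sub_cancel]
      push_cast
      field_simp
  have hb : ∀ n, ∀ y ∈ Metric.ball (0 : ℂ) β, ‖g' n y‖ ≤ u n := by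
    intro n y hy
    cases n with
    | zero => simp [hg', hu]
    | succ n => exact norm_egs_term_le (w := fun n => w (n + 1)) hQ hw (hle y hy) n
  have h0 : Summable fun n : ℕ => w n * (0 : ℂ) ^ n / n.factorial := by
    refine summable_of_ne_finset_zero (s := {0}) fun n hn => ?_
    have : n ≠ 0 := by simpa using hn
    simp [this]
  have main := hasDerivAt_tsum_of_isPreconnected hus Metric.isOpen_ball
    (convex_ball (0 : ℂ) β).isPreconnected hder hb (Metric.mem_ball_self hβ0) h0 hz
  have e : ∑' n, g' n z = egs (fun n => w (n + 1)) z := by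
    rw [Summable.tsum_eq_zero_add (Summable.of_norm_bounded hus fun n => hb n z hz)]
    simp [hg', egs]
  rw [e] at main
  exact main

/-- The recursion of `cauchySeq` as an equation between generating series. -/
lemma egs_cauchySeq {S : ℕ} {𝒜 : Finset (ℕ × ℕ × ℕ)} (hS : ∀ k ∈ 𝒜, k.2.1 < S)
    {q : ℕ × ℕ × ℕ → ℂ} {c : ℕ × ℕ × ℕ → ℕ → ℂ} {w : ℕ → ℂ} {z : ℂ}
    (hc : ∀ k ∈ 𝒜, Summable fun m => ‖c k m * z ^ m‖)
    (hw : ∀ k ∈ 𝒜, Summable fun n : ℕ =>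
      ‖cauchySeq S 𝒜 q c w (n + k.2.1) * z ^ n / n.factorial‖) :
    egs (fun n => cauchySeq S 𝒜 q c w (n + S)) z =
      ∑ k ∈ 𝒜, q k * ((∑' m, c k m * z ^ m) *
        egs (fun n => cauchySeq S 𝒜 q c w (n + k.2.1)) z) := by
  have hsum : ∀ k ∈ 𝒜, HasSum (fun n : ℕ => q k * ∑ p ∈ antidiagonal n, (c k p.1 * z ^ p.1) *
      (cauchySeq S 𝒜 q c w (p.2 + k.2.1) * z ^ p.2 / p.2.factorial))
      (q k * ((∑' m, c k m * z ^ m) *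
        egs (fun n => cauchySeq S 𝒜 q c w (n + k.2.1)) z)) := by
    intro k hk
    refine HasSum.mul_left _ ?_
    have h1 := tsum_mul_tsum_eq_tsum_sum_antidiagonal_of_summable_norm (hc k hk) (hw k hk)
    have h2 := (summable_norm_sum_mul_antidiagonal_of_summable_norm (hc k hk) (hw k hk)).of_norm
    rw [egs, h1]
    exact h2.hasSum
  have h := hasSum_sum hsum
  rw [← h.tsum_eq, egs]
  refine tsum_congr fun n => ?_
  rw [cauchySeq_add hS, Finset.sum_mul, Finset.sum_div]
  refine Finset.sum_congr rfl fun k hk => ?_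
  rw [mul_assoc, mul_div_assoc]
  congr 1
  rw [Finset.sum_mul, Finset.sum_div]
  refine Finset.sum_congr rfl fun p hp => ?_
  rw [← mem_antidiagonal.1 hp, pow_add]
  have h1 : ((p.1 + p.2).factorial : ℂ) ≠ 0 := by exact_mod_cast Nat.factorial_ne_zero _
  have h2 : ((p.2).factorial : ℂ) ≠ 0 := by exact_mod_cast Nat.factorial_ne_zero _
  field_simp

/-! ### The Cauchy problem in the Borel plane -/

/-- The `n`-th Taylor coefficient (times `n!`) in `z` of the solution in the Borel plane. -/
def borelCoef (S : ℕ) (P : Polynomial ℂ) (𝒜 : Finset (ℕ × ℕ × ℕ)) (ct : ℕ × ℕ × ℕ → ℕ → ℂ → ℂ)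
    (w : ℕ → ℂ → ℂ → ℂ) (n : ℕ) (τ ε : ℂ) : ℂ :=
  cauchySeq S 𝒜 (fun k => qCoef P k τ ε) (fun k m => ct k m ε) (fun j => w j τ ε) n

/-- The `j`-th derivative in `z` of the solution in the Borel plane. -/
def borelSol (S : ℕ) (P : Polynomial ℂ) (𝒜 : Finset (ℕ × ℕ × ℕ)) (ct : ℕ × ℕ × ℕ → ℕ → ℂ → ℂ)
    (w : ℕ → ℂ → ℂ → ℂ) (j : ℕ) (τ z ε : ℂ) : ℂ :=
  egs (fun n => borelCoef S P 𝒜 ct w (n + j) τ ε) z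

lemma isOpen_pdisc (R : ℝ) : IsOpen (pdisc R) := Metric.isOpen_ball.sdiff isClosed_singleton

lemma ne_zero_of_mem_pdisc {R : ℝ} {ε : ℂ} (h : ε ∈ pdisc R) : ε ≠ 0 := h.2

/-- Data of the Cauchy problem over a set `K` of the Borel plane, holomorphic in `τ ∈ U`, with
a bound of the Taylor coefficients in `z`. -/
structure BorelProblem (S : ℕ) (P : Polynomial ℂ) (𝒜 : Finset (ℕ × ℕ × ℕ))
    (c : ℕ × ℕ × ℕ → ℂ → ℂ → ℂ) (ct : ℕ × ℕ × ℕ → ℕ → ℂ → ℂ) (w : ℕ → ℂ → ℂ → ℂ)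
    (ε₀ R β : ℝ) (K U : Set ℂ) (Bd : ℂ → ℂ → ℝ) : Prop where
  lt_S : ∀ k ∈ 𝒜, k.2.1 < S
  isOpen : IsOpen U
  subset : U ⊆ K
  subset_closure : K ⊆ closure U
  eval_ne_zero : ∀ τ ∈ K, P.eval τ ≠ 0
  ct_diff : ∀ k ∈ 𝒜, ∀ m, DifferentiableOn ℂ (ct k m) (Metric.ball 0 ε₀)
  ct_sum : ∀ k ∈ 𝒜, ∀ ε ∈ Metric.ball (0 : ℂ) ε₀, ∀ z ∈ Metric.ball (0 : ℂ) β,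
    (Summable fun m => ‖ct k m ε * z ^ m‖) ∧ ∑' m, ct k m ε * z ^ m = c k z ε
  w_diff : ∀ j < S, DifferentiableOn ℂ (fun q : ℂ × ℂ => w j q.1 q.2) (U ×ˢ pdisc ε₀)
  w_cont : ∀ j < S, ContinuousOn (fun q : ℂ × ℂ => w j q.1 q.2) (K ×ˢ pdisc ε₀)
  bd_cont : ContinuousOn (fun q : ℂ × ℂ => Bd q.1 q.2) (univ ×ˢ pdisc ε₀)
  bd : ∀ τ ∈ K, ∀ ε ∈ pdisc ε₀, ∀ n,
    ‖borelCoef S P 𝒜 ct w n τ ε‖ ≤ Bd τ ε * (R ^ n * n.factorial)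
  R_pos : 0 < R
  R_le : 4 * R * β ≤ 1

/-- The algebra of functions holomorphic on a set. -/
def holSubalgebra {E : Type*} [NormedAddCommGroup E] [NormedSpace ℂ E] (U : Set E) :
    Subalgebra ℂ (E → ℂ) where
  carrier := {f | DifferentiableOn ℂ f U}
  mul_mem' hf hg := DifferentiableOn.mul hf hg
  add_mem' hf hg := DifferentiableOn.add hf hg
  algebraMap_mem' c := differentiableOn_const c

/-- The algebra of functions continuous on a set. -/
def contSubalgebra {E : Type*} [TopologicalSpace E] (U : Set E) :
    Subalgebra ℂ (E → ℂ) where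
  carrier := {f | ContinuousOn f U}
  mul_mem' hf hg := ContinuousOn.mul hf hg
  add_mem' hf hg := ContinuousOn.add hf hg
  algebraMap_mem' _ := continuousOn_const

namespace BorelProblem

variable {S : ℕ} {P : Polynomial ℂ} {𝒜 : Finset (ℕ × ℕ × ℕ)}
  {c : ℕ × ℕ × ℕ → ℂ → ℂ → ℂ} {ct : ℕ × ℕ × ℕ → ℕ → ℂ → ℂ} {w : ℕ → ℂ → ℂ → ℂ}
  {ε₀ R β : ℝ} {K U : Set ℂ} {Bd : ℂ → ℂ → ℝ}

lemma bd_nonneg (h : BorelProblem S P 𝒜 c ct w ε₀ R β K U Bd) {τ ε : ℂ} (hτ : τ ∈ K)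
    (hε : ε ∈ pdisc ε₀) : 0 ≤ Bd τ ε := by
  simpa using (norm_nonneg _).trans (h.bd τ hτ ε hε 0)

lemma differentiableOn_qCoef (h : BorelProblem S P 𝒜 c ct w ε₀ R β K U Bd) (k : ℕ × ℕ × ℕ) :
    DifferentiableOn ℂ (fun q : ℂ × ℂ => qCoef P k q.1 q.2) (K ×ˢ pdisc ε₀) := by
  unfold qCoef
  have hP : Differentiable ℂ fun q : ℂ × ℂ => P.eval q.1 := P.differentiable.comp differentiable_fst
  have h1 : ∀ q ∈ K ×ˢ pdisc ε₀, q.2 ^ k.1 ≠ 0 := fun q hq =>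
    pow_ne_zero _ (ne_zero_of_mem_pdisc hq.2)
  have h2 : ∀ q ∈ K ×ˢ pdisc ε₀, P.eval q.1 ≠ 0 := fun q hq => h.eval_ne_zero _ hq.1
  simp only [div_eq_mul_inv]
  have h3 : DifferentiableOn ℂ (fun q : ℂ × ℂ => (q.2 ^ k.1)⁻¹) (K ×ˢ pdisc ε₀) :=
    DifferentiableOn.fun_inv (by fun_prop) h1
  have h4 : DifferentiableOn ℂ (fun q : ℂ × ℂ => (P.eval q.1)⁻¹) (K ×ˢ pdisc ε₀) :=
    DifferentiableOn.fun_inv hP.differentiableOn h2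
  fun_prop

lemma continuousOn_coef (h : BorelProblem S P 𝒜 c ct w ε₀ R β K U Bd) (n : ℕ) :
    ContinuousOn (fun q : ℂ × ℂ => borelCoef S P 𝒜 ct w n q.1 q.2) (K ×ˢ pdisc ε₀) := by
  refine cauchySeq_mem h.lt_S (contSubalgebra (K ×ˢ pdisc ε₀))
    (q := fun k x => qCoef P k x.1 x.2) (c := fun k m x => ct k m x.2)
    (w := fun j x => w j x.1 x.2) ?_ ?_ ?_ n
  · exact fun k _ => (h.differentiableOn_qCoef k).continuousOn
  · exact fun k hk m => (h.ct_diff k hk m).continuousOn.comp continuousOn_snd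
      fun q hq => hq.2.1
  · exact h.w_cont

lemma differentiableOn_coef (h : BorelProblem S P 𝒜 c ct w ε₀ R β K U Bd) (n : ℕ) :
    DifferentiableOn ℂ (fun q : ℂ × ℂ => borelCoef S P 𝒜 ct w n q.1 q.2) (U ×ˢ pdisc ε₀) := by
  refine cauchySeq_mem h.lt_S (holSubalgebra (U ×ˢ pdisc ε₀))
    (q := fun k x => qCoef P k x.1 x.2) (c := fun k m x => ct k m x.2)
    (w := fun j x => w j x.1 x.2) ?_ ?_ ?_ n
  · exact fun k _ => (h.differentiableOn_qCoef k).mono (prod_mono h.subset subset_rfl)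
  · exact fun k hk m => (h.ct_diff k hk m).comp differentiableOn_snd fun q hq => hq.2.1
  · exact h.w_diff

/-- The paths may touch the boundary of K, where the data are only continuous in τ. Holomorphy in ε
survives there as a locally uniform limit from U, and it is what differentiation under the integral
sign requires. -/
lemma differentiableOn_coef_right (h : BorelProblem S P 𝒜 c ct w ε₀ R β K U Bd) (n : ℕ)
    {τ : ℂ} (hτ : τ ∈ K) :
    DifferentiableOn ℂ (fun ε => borelCoef S P 𝒜 ct w n τ ε) (pdisc ε₀) := by
  refine differentiableOn_of_mem_closure (isOpen_pdisc ε₀) h.subset h.subset_closure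
    (h.continuousOn_coef n) (fun τ hτ => ?_) hτ
  exact (h.differentiableOn_coef n).comp (f := fun ε : ℂ => (τ, ε)) (by fun_prop)
    fun ε hε => ⟨hτ, hε⟩

lemma eventually_bd (h : BorelProblem S P 𝒜 c ct w ε₀ R β K U Bd) {τ₁ ε₁ : ℂ}
    (hε₁ : ε₁ ∈ pdisc ε₀) :
    ∀ᶠ x : ℂ × ℂ in 𝓝 (τ₁, ε₁), x.2 ∈ pdisc ε₀ ∧ Bd x.1 x.2 ≤ |Bd τ₁ ε₁| + 1 := by
  have ho : IsOpen ((univ : Set ℂ) ×ˢ pdisc ε₀) := isOpen_univ.prod (isOpen_pdisc ε₀)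
  have hmem : ((univ : Set ℂ) ×ˢ pdisc ε₀) ∈ 𝓝 (τ₁, ε₁) := ho.mem_nhds ⟨mem_univ _, hε₁⟩
  have hc := h.bd_cont.continuousAt hmem
  have hlt : Bd τ₁ ε₁ < |Bd τ₁ ε₁| + 1 := by linarith [le_abs_self (Bd τ₁ ε₁)]
  filter_upwards [hmem, hc.eventually (gt_mem_nhds hlt)] with x hx hx'
  exact ⟨hx.2, hx'.le⟩

lemma two_mul_le (h : BorelProblem S P 𝒜 c ct w ε₀ R β K U Bd) {z : ℂ}
    (hz : z ∈ Metric.ball 0 β) : 2 * (2 * R) * ‖z‖ ≤ 1 := by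
  have h1 : ‖z‖ ≤ β := (mem_ball_zero_iff.1 hz).le
  have := h.R_pos
  calc _ ≤ 2 * (2 * R) * β := by gcongr
    _ ≤ 1 := by linarith [h.R_le]

lemma norm_term_le (h : BorelProblem S P 𝒜 c ct w ε₀ R β K U Bd) {D : ℝ} (j : ℕ) {τ ε z : ℂ}
    (hτ : τ ∈ K) (hε : ε ∈ pdisc ε₀) (hD : Bd τ ε ≤ D) (hz : z ∈ Metric.ball 0 β) (n : ℕ) :
    ‖borelCoef S P 𝒜 ct w (n + j) τ ε * z ^ n / n.factorial‖ ≤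
      D * ((2 * R) ^ j * j.factorial) * (1 / 2) ^ n := by
  have hR := h.R_pos
  refine norm_egs_term_le (Q := 2 * R) (w := fun n => borelCoef S P 𝒜 ct w (n + j) τ ε)
    (by positivity) ?_ (h.two_mul_le hz) n
  refine norm_shift_le (w := fun n => borelCoef S P 𝒜 ct w n τ ε)
    ((h.bd_nonneg hτ hε).trans hD) hR.le (fun n => (h.bd τ hτ ε hε n).trans ?_) j
  gcongr

lemma norm_borelSol_le (h : BorelProblem S P 𝒜 c ct w ε₀ R β K U Bd) {D : ℝ} (j : ℕ) {τ ε z : ℂ}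
    (hz : z ∈ Metric.ball 0 β)
    (hD : ∀ n, ‖borelCoef S P 𝒜 ct w n τ ε‖ ≤ D * (R ^ n * n.factorial)) :
    ‖borelSol S P 𝒜 ct w j τ z ε‖ ≤ D * ((2 * R) ^ j * j.factorial) * 2 := by
  have hR := h.R_pos
  have hD0 : 0 ≤ D := by simpa using (norm_nonneg _).trans (hD 0)
  exact norm_egs_le (Q := 2 * R) (by positivity)
    (norm_shift_le (w := fun n => borelCoef S P 𝒜 ct w n τ ε) hD0 hR.le hD j) (h.two_mul_le hz)

lemma continuousOn_borelSol (h : BorelProblem S P 𝒜 c ct w ε₀ R β K U Bd) (j : ℕ) :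
    ContinuousOn (fun q : ℂ × ℂ × ℂ => borelSol S P 𝒜 ct w j q.1 q.2.1 q.2.2)
      (K ×ˢ (Metric.ball (0 : ℂ) β ×ˢ pdisc ε₀)) := by
  refine continuousOn_tsum_of_dominated (fun n => ?_) fun x₀ hx₀ => ?_
  · refine ContinuousOn.div_const (ContinuousOn.mul ?_ (by fun_prop)) _
    exact (h.continuousOn_coef (n + j)).comp (f := fun q : ℂ × ℂ × ℂ => (q.1, q.2.2))
      (by fun_prop) fun q hq => ⟨hq.1, hq.2.2⟩
  · have hev := h.eventually_bd (τ₁ := x₀.1) hx₀.2.2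
    have hcont : Continuous fun q : ℂ × ℂ × ℂ => (q.1, q.2.2) := by fun_prop
    refine ⟨_, hcont.continuousAt.eventually hev, _, summable_half_pow
      ((|Bd x₀.1 x₀.2.2| + 1) * ((2 * R) ^ j * j.factorial)), fun n x hx => ?_⟩
    exact h.norm_term_le j hx.2.1 hx.2.2.2 hx.1.2 hx.2.2.1 n

lemma differentiableOn_borelSol (h : BorelProblem S P 𝒜 c ct w ε₀ R β K U Bd) (j : ℕ) :
    DifferentiableOn ℂ (fun q : ℂ × ℂ × ℂ => borelSol S P 𝒜 ct w j q.1 q.2.1 q.2.2)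
      (U ×ˢ (Metric.ball (0 : ℂ) β ×ˢ pdisc ε₀)) := by
  have ho : IsOpen (U ×ˢ (Metric.ball (0 : ℂ) β ×ˢ pdisc ε₀)) :=
    h.isOpen.prod (Metric.isOpen_ball.prod (isOpen_pdisc ε₀))
  refine differentiableOn_tsum_of_dominated ho (fun n => ?_) fun x₀ hx₀ => ?_
  · simp only [div_eq_mul_inv]
    refine DifferentiableOn.mul_const (DifferentiableOn.mul ?_ (by fun_prop)) _
    exact (h.differentiableOn_coef (n + j)).comp (f := fun q : ℂ × ℂ × ℂ => (q.1, q.2.2))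
      (by fun_prop) fun q hq => ⟨hq.1, hq.2.2⟩
  · have hev := h.eventually_bd (τ₁ := x₀.1) hx₀.2.2
    have hcont : Continuous fun q : ℂ × ℂ × ℂ => (q.1, q.2.2) := by fun_prop
    refine ⟨_, inter_mem (hcont.continuousAt.eventually hev) (ho.mem_nhds hx₀), _,
      summable_half_pow ((|Bd x₀.1 x₀.2.2| + 1) * ((2 * R) ^ j * j.factorial)), fun n x hx => ?_⟩
    exact h.norm_term_le j (h.subset hx.2.1) hx.2.2.2 hx.1.2 hx.2.2.1 n

lemma differentiableOn_borelSol_right (h : BorelProblem S P 𝒜 c ct w ε₀ R β K U Bd) (j : ℕ)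
    {τ : ℂ} (hτ : τ ∈ K) :
    DifferentiableOn ℂ (fun q : ℂ × ℂ => borelSol S P 𝒜 ct w j τ q.1 q.2)
      (Metric.ball (0 : ℂ) β ×ˢ pdisc ε₀) := by
  have ho : IsOpen (Metric.ball (0 : ℂ) β ×ˢ pdisc ε₀) :=
    Metric.isOpen_ball.prod (isOpen_pdisc ε₀)
  refine differentiableOn_tsum_of_dominated ho (fun n => ?_) fun x₀ hx₀ => ?_
  · simp only [div_eq_mul_inv]
    refine DifferentiableOn.mul_const (DifferentiableOn.mul ?_ (by fun_prop)) _
    exact (h.differentiableOn_coef_right (n + j) hτ).comp differentiableOn_snd fun q hq => hq.2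
  · have hev := h.eventually_bd (τ₁ := τ) hx₀.2
    have hcont : Continuous fun q : ℂ × ℂ => (τ, q.2) := by fun_prop
    refine ⟨_, inter_mem (hcont.continuousAt.eventually hev) (ho.mem_nhds hx₀), _,
      summable_half_pow ((|Bd τ x₀.2| + 1) * ((2 * R) ^ j * j.factorial)), fun n x hx => ?_⟩
    exact h.norm_term_le j hτ hx.2.2 hx.1.2 hx.2.1 n

lemma hasDerivAt_borelSol (h : BorelProblem S P 𝒜 c ct w ε₀ R β K U Bd) (j : ℕ) {τ ε z : ℂ}
    (hτ : τ ∈ K) (hε : ε ∈ pdisc ε₀) (hz : z ∈ Metric.ball 0 β) :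
    HasDerivAt (fun z => borelSol S P 𝒜 ct w j τ z ε) (borelSol S P 𝒜 ct w (j + 1) τ z ε) z := by
  have hR := h.R_pos
  have := hasDerivAt_egs (Q := 2 * R) (w := fun n => borelCoef S P 𝒜 ct w (n + j) τ ε)
    (D := Bd τ ε * ((2 * R) ^ (j + 1) * (j + 1).factorial))
    (by positivity) (by linarith [h.R_le]) (fun n => ?_) hz
  · convert! this using 1
    simp only [borelSol]
    congr 1
    funext n
    congr 1
    ring
  · have := norm_shift_le (w := fun n => borelCoef S P 𝒜 ct w n τ ε) (h.bd_nonneg hτ hε) hR.le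
      (h.bd τ hτ ε hε) (j + 1) n
    rwa [show n + 1 + j = n + (j + 1) by ring]

lemma borelSol_zero (w : ℕ → ℂ → ℂ → ℂ) {j : ℕ} (hj : j < S) (τ ε : ℂ) :
    borelSol S P 𝒜 ct w j τ 0 ε = w j τ ε := by
  rw [borelSol, egs_zero, zero_add, borelCoef, cauchySeq_of_lt _ _ _ hj]

/-- The form of (1) under the integral sign: τ stands for ε t²∂_t, τ/ε for t²∂_t, and e^{-k₂τ} for
the Moebius map. -/
lemma equation (h : BorelProblem S P 𝒜 c ct w ε₀ R β K U Bd) {τ ε z : ℂ}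
    (hτ : τ ∈ K) (hε : ε ∈ pdisc ε₀) (hz : z ∈ Metric.ball 0 β) :
    P.eval τ * borelSol S P 𝒜 ct w S τ z ε = ∑ k ∈ 𝒜, c k z ε * (τ ^ k.1 / ε ^ k.1 *
      Complex.exp (-(k.2.2 * τ)) * borelSol S P 𝒜 ct w k.2.1 τ z ε) := by
  have hR := h.R_pos
  have := egs_cauchySeq h.lt_S (q := fun k => qCoef P k τ ε) (c := fun k m => ct k m ε)
    (w := fun j => w j τ ε) (z := z) (fun k hk => (h.ct_sum k hk ε hε.1 z hz).1)
    fun k _ => summable_norm_egs (Q := 2 * R)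
      (w := fun n => borelCoef S P 𝒜 ct w (n + k.2.1) τ ε) (by positivity)
      (norm_shift_le (w := fun n => borelCoef S P 𝒜 ct w n τ ε) (h.bd_nonneg hτ hε) hR.le
      (h.bd τ hτ ε hε) k.2.1) (h.two_mul_le hz)
  have e : borelSol S P 𝒜 ct w S τ z ε = _ := this
  rw [e, Finset.mul_sum]
  refine Finset.sum_congr rfl fun k hk => ?_
  rw [(h.ct_sum k hk ε hε.1 z hz).2]
  simp only [borelSol, borelCoef, qCoef]
  have := h.eval_ne_zero τ hτ
  field_simp

end BorelProblem

end SPCP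

end

/-! ### Laplace transforms of the Borel solution and the equation in t -/

open scoped ENNReal Topology

noncomputable section

namespace SPCP

open MeasureTheory Set Filter

/-! ### Laplace transforms along broken paths -/

/-- The Laplace transform of `g` along the path `bPath A d`; here `y` stands for `1 / (ε t)`. -/
def pathLap (A d : ℂ) (g : ℂ → ℂ) (y : ℂ) : ℂ :=
  ∫ s in Ioi (0 : ℝ), lapKernel g y⁻¹ (bPath A d s) * bVel A d s

lemma norm_bPath_sub_le {A d : ℂ} (hd : ‖d‖ = 1) {s : ℝ} (hs : 0 ≤ s) :
    ‖bPath A d s - s * d‖ ≤ ‖A‖ + 1 := by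
  rcases le_total s 1 with h | h
  · rw [bPath_of_le h, ← mul_sub, norm_mul, Complex.norm_real, Real.norm_of_nonneg hs]
    calc _ ≤ 1 * ‖A - d‖ := by gcongr
      _ ≤ _ := by rw [one_mul, ← hd]; exact norm_sub_le _ _
  · rw [bPath_of_ge h]
    have : A + ((s - 1 : ℝ) : ℂ) * d - s * d = A - d := by push_cast; ring
    rw [this, ← hd]
    exact norm_sub_le _ _

lemma norm_lapKernel (g : ℂ → ℂ) (y u : ℂ) :
    ‖lapKernel g y⁻¹ u‖ = ‖g u‖ * Real.exp (-(u * y).re) / ‖u‖ := by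
  rw [lapKernel, norm_div, norm_mul, Complex.norm_exp, div_inv_eq_mul, Complex.neg_re]

/-- The gap between the decay of the kernel and the growth of the integrand is 4m. Near (y₁, ε₁) the
variation of κ/‖ε‖, the variation of Re(dy) and the power of the path variable cost m each, so
e^{-ms} remains. The path stays at bounded distance from the ray s d, which contributes only a
constant factor. -/
lemma eventually_path_dominated (A : ℂ) {d : ℂ} (hd : ‖d‖ = 1) {κ : ℝ} (hκ : 0 ≤ κ) {y₁ ε₁ : ℂ}
    (hε₁ : ε₁ ≠ 0) (h : κ / ‖ε₁‖ < (d * y₁).re) (i : ℕ) :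
    ∃ m C : ℝ, 0 < m ∧ 0 ≤ C ∧ ∀ᶠ q : ℂ × ℂ in 𝓝 (y₁, ε₁), ∀ s : ℝ, 0 < s →
      ‖bPath A d s‖ ^ i * Real.exp (κ / ‖q.2‖ * ‖bPath A d s‖) *
        Real.exp (-(bPath A d s * q.1).re) ≤ C * Real.exp (-(m * s)) := by
  set m : ℝ := ((d * y₁).re - κ / ‖ε₁‖) / 4 with hm
  have hm0 : 0 < m := by rw [hm]; linarith
  set c₀ := ‖A‖ + 1 with hc₀
  have hc₀0 : 0 ≤ c₀ := by positivity
  set a := κ / ‖ε₁‖ + m with ha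
  refine ⟨m, i.factorial / m ^ i * Real.exp (m * c₀ + a * c₀ + c₀ * (‖y₁‖ + 1)), hm0,
    by positivity, ?_⟩
  have e1 : ∀ᶠ q : ℂ × ℂ in 𝓝 (y₁, ε₁), κ / ‖q.2‖ < a := by
    have : ContinuousAt (fun q : ℂ × ℂ => κ / ‖q.2‖) (y₁, ε₁) :=
      continuousAt_const.div (by fun_prop) (norm_ne_zero_iff.2 hε₁)
    exact this.eventually (gt_mem_nhds (by simp only [ha]; linarith))
  have e2 : ∀ᶠ q : ℂ × ℂ in 𝓝 (y₁, ε₁), (d * y₁).re - m < (d * q.1).re := by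
    have : ContinuousAt (fun q : ℂ × ℂ => (d * q.1).re) (y₁, ε₁) :=
      (Complex.continuous_re.comp (by fun_prop)).continuousAt
    exact this.eventually (lt_mem_nhds (by simpa using hm0))
  have e3 : ∀ᶠ q : ℂ × ℂ in 𝓝 (y₁, ε₁), ‖q.1‖ < ‖y₁‖ + 1 := by
    have : ContinuousAt (fun q : ℂ × ℂ => ‖q.1‖) (y₁, ε₁) := by fun_prop
    exact this.eventually (gt_mem_nhds (by simp))
  filter_upwards [e1, e2, e3] with q h1 h2 h3 s hs
  have hsub := norm_bPath_sub_le (A := A) hd hs.le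
  have hn : ‖bPath A d s‖ ≤ s + c₀ := by
    calc _ = ‖(s * d) + (bPath A d s - s * d)‖ := by congr 1; ring
      _ ≤ ‖(s : ℂ) * d‖ + ‖bPath A d s - s * d‖ := norm_add_le _ _
      _ ≤ s + c₀ := by
        rw [norm_mul, hd, mul_one, Complex.norm_real, Real.norm_of_nonneg hs.le]; gcongr
  have hre : s * (d * q.1).re - c₀ * (‖y₁‖ + 1) ≤ (bPath A d s * q.1).re := by
    have e : (bPath A d s * q.1).re = s * (d * q.1).re + ((bPath A d s - s * d) * q.1).re := by
      rw [sub_mul, Complex.sub_re, mul_assoc, Complex.re_ofReal_mul]; ring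
    have h4 : -(c₀ * (‖y₁‖ + 1)) ≤ ((bPath A d s - s * d) * q.1).re := by
      refine neg_le_of_abs_le ((Complex.abs_re_le_norm _).trans ?_)
      rw [norm_mul]
      gcongr
    rw [e]; linarith
  have hpow : ‖bPath A d s‖ ^ i ≤ i.factorial / m ^ i * Real.exp (m * (s + c₀)) := by
    have := Real.pow_div_factorial_le_exp (m * (s + c₀)) (by positivity) i
    rw [div_le_iff₀' (by positivity), mul_pow] at this
    rw [div_mul_eq_mul_div, le_div_iff₀ (by positivity)]
    calc _ ≤ (s + c₀) ^ i * m ^ i := by gcongr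
      _ ≤ _ := by linarith
  have hexp1 : κ / ‖q.2‖ * ‖bPath A d s‖ ≤ a * (s + c₀) := by
    gcongr
  calc _ ≤ (i.factorial / m ^ i * Real.exp (m * (s + c₀))) * Real.exp (a * (s + c₀)) *
      Real.exp (-(s * (d * q.1).re - c₀ * (‖y₁‖ + 1))) := by gcongr
    _ = i.factorial / m ^ i * Real.exp (m * (s + c₀) + a * (s + c₀) +
      -(s * (d * q.1).re - c₀ * (‖y₁‖ + 1))) := by rw [Real.exp_add, Real.exp_add]; ring
    _ ≤ i.factorial / m ^ i * Real.exp ((m * c₀ + a * c₀ + c₀ * (‖y₁‖ + 1)) + -(m * s)) := by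
      refine mul_le_mul_of_nonneg_left (Real.exp_le_exp.2 ?_) (by positivity)
      have : s * ((d * y₁).re - m) ≤ s * (d * q.1).re := by gcongr
      have e : (d * y₁).re = κ / ‖ε₁‖ + 4 * m := by rw [hm]; ring
      rw [e] at this
      have e' : a = κ / ‖ε₁‖ + m := ha
      rw [e']
      nlinarith
    _ = _ := by rw [Real.exp_add]; ring

/-- A path in the set `K` of a Borel problem with a bound of the Taylor coefficients along it. -/
structure BorelPath (S : ℕ) (P : Polynomial ℂ) (𝒜 : Finset (ℕ × ℕ × ℕ))
    (ct : ℕ × ℕ × ℕ → ℕ → ℂ → ℂ) (w : ℕ → ℂ → ℂ → ℂ)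
    (ε₀ R : ℝ) (K : Set ℂ) (A d : ℂ) (κ C : ℝ) : Prop where
  norm_d : ‖d‖ = 1
  mem : ∀ s : ℝ, 0 ≤ s → bPath A d s ∈ K
  κ_nonneg : 0 ≤ κ
  C_nonneg : 0 ≤ C
  bd : ∀ ε ∈ pdisc ε₀, ∀ s : ℝ, 0 < s → ∀ n, ‖borelCoef S P 𝒜 ct w n (bPath A d s) ε‖ ≤
    (C * (‖bPath A d s‖ * Real.exp (κ / ‖ε‖ * ‖bPath A d s‖))) * (R ^ n * n.factorial)

namespace BorelPath

variable {S : ℕ} {P : Polynomial ℂ} {𝒜 : Finset (ℕ × ℕ × ℕ)}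
  {c : ℕ × ℕ × ℕ → ℂ → ℂ → ℂ} {ct : ℕ × ℕ × ℕ → ℕ → ℂ → ℂ} {w : ℕ → ℂ → ℂ → ℂ}
  {ε₀ R β : ℝ} {K U : Set ℂ} {Bd : ℂ → ℂ → ℝ} {A d : ℂ} {κ C : ℝ}

lemma norm_borelSol_le (p : BorelPath S P 𝒜 ct w ε₀ R K A d κ C)
    (h : BorelProblem S P 𝒜 c ct w ε₀ R β K U Bd) (j : ℕ) {z ε : ℂ}
    (hz : z ∈ Metric.ball 0 β) (hε : ε ∈ pdisc ε₀) {s : ℝ} (hs : 0 < s) :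
    ‖borelSol S P 𝒜 ct w j (bPath A d s) z ε‖ ≤ (C * ((2 * R) ^ j * j.factorial) * 2) *
      (‖bPath A d s‖ * Real.exp (κ / ‖ε‖ * ‖bPath A d s‖)) := by
  refine (h.norm_borelSol_le j hz (p.bd ε hε s hs)).trans (le_of_eq ?_)
  ring

/-- The factor |u| in the bound of the Borel solution cancels the 1/u of the kernel, so there is no
singularity at the start of the path. -/
lemma norm_kernel_le (p : BorelPath S P 𝒜 ct w ε₀ R K A d κ C)
    (h : BorelProblem S P 𝒜 c ct w ε₀ R β K U Bd) (i j : ℕ) {y z ε : ℂ}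
    (hz : z ∈ Metric.ball 0 β) (hε : ε ∈ pdisc ε₀) {s : ℝ} (hs : 0 < s) :
    ‖lapKernel (fun τ => borelSol S P 𝒜 ct w j τ z ε * τ ^ i) y⁻¹ (bPath A d s) * bVel A d s‖ ≤
      (C * ((2 * R) ^ j * j.factorial) * 2) * (‖A‖ + 1) * (‖bPath A d s‖ ^ i *
        Real.exp (κ / ‖ε‖ * ‖bPath A d s‖) * Real.exp (-(bPath A d s * y).re)) := by
  have hR := h.R_pos
  have hC := p.C_nonneg
  set u := bPath A d s with hu
  have hv : ‖bVel A d s‖ ≤ ‖A‖ + 1 := p.norm_d ▸ norm_bVel_le A d s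
  -- Nothing in the abstract setting prevents the path from returning to 0; there the kernel is 0, a
  -- quotient by 0.
  rcases eq_or_ne u 0 with h0 | h0
  · rw [h0, lapKernel, div_zero, zero_mul, norm_zero]
    positivity
  · have hu0 : 0 < ‖u‖ := norm_pos_iff.2 h0
    have hb := p.norm_borelSol_le h j hz hε hs
    rw [← hu] at hb
    rw [norm_mul, norm_lapKernel, norm_mul, norm_pow]
    calc _ ≤ ((C * ((2 * R) ^ j * j.factorial) * 2) * (‖u‖ * Real.exp (κ / ‖ε‖ * ‖u‖)) *
        ‖u‖ ^ i) * Real.exp (-(u * y).re) / ‖u‖ * (‖A‖ + 1) := by gcongr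
      _ = _ := by field_simp

lemma aestronglyMeasurable (p : BorelPath S P 𝒜 ct w ε₀ R K A d κ C)
    (h : BorelProblem S P 𝒜 c ct w ε₀ R β K U Bd) (i j : ℕ) (y : ℂ) {z ε : ℂ}
    (hz : z ∈ Metric.ball 0 β) (hε : ε ∈ pdisc ε₀) :
    AEStronglyMeasurable (fun s => lapKernel (fun τ => borelSol S P 𝒜 ct w j τ z ε * τ ^ i) y⁻¹
      (bPath A d s) * bVel A d s) (volume.restrict (Ioi 0)) := by
  have hφ := continuous_bPath A d
  have h1 : ContinuousOn (fun s => borelSol S P 𝒜 ct w j (bPath A d s) z ε) (Ioi 0) :=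
    (h.continuousOn_borelSol j).comp (f := fun s : ℝ => (bPath A d s, z, ε))
      (by fun_prop) fun s hs => ⟨p.mem s (le_of_lt hs), hz, hε⟩
  have h2 := h1.aestronglyMeasurable (μ := volume) measurableSet_Ioi
  refine AEStronglyMeasurable.mul ?_ (measurable_bVel A d).aestronglyMeasurable
  unfold lapKernel
  simp only [div_eq_mul_inv]
  refine AEStronglyMeasurable.mul (AEStronglyMeasurable.mul (h2.mul ?_) ?_) ?_
  · exact (hφ.pow i).aestronglyMeasurable
  · exact Continuous.aestronglyMeasurable (by fun_prop)
  · exact hφ.measurable.inv.aestronglyMeasurable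

/-- One integrable majorant, locally uniform in (y, ε) and uniform in z: it justifies integrability
and every differentiation under the integral sign below. -/
lemma exists_dominated (p : BorelPath S P 𝒜 ct w ε₀ R K A d κ C)
    (h : BorelProblem S P 𝒜 c ct w ε₀ R β K U Bd) (i j : ℕ) {y₁ ε₁ : ℂ} (hε₁ : ε₁ ∈ pdisc ε₀)
    (hy₁ : κ / ‖ε₁‖ < (d * y₁).re) :
    ∃ g : ℝ → ℝ, IntegrableOn g (Ioi 0) ∧ ∀ᶠ q : ℂ × ℂ in 𝓝 (y₁, ε₁), q.2 ∈ pdisc ε₀ ∧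
      ∀ z ∈ Metric.ball (0 : ℂ) β, ∀ s : ℝ, 0 < s →
        ‖lapKernel (fun τ => borelSol S P 𝒜 ct w j τ z q.2 * τ ^ i) q.1⁻¹ (bPath A d s) *
          bVel A d s‖ ≤ g s := by
  have hR := h.R_pos
  have hC := p.C_nonneg
  obtain ⟨m, C', hm, hC', hev⟩ := eventually_path_dominated A p.norm_d p.κ_nonneg
    (ne_zero_of_mem_pdisc hε₁) hy₁ i
  refine ⟨fun s => (C * ((2 * R) ^ j * j.factorial) * 2) * (‖A‖ + 1) *
    (C' * Real.exp (-(m * s))), ?_, ?_⟩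
  · have : IntegrableOn (fun s => Real.exp (-m * s)) (Ioi 0) := exp_neg_integrableOn_Ioi 0 hm
    simp only [← neg_mul]
    exact (this.const_mul C').const_mul _
  · have hmem : ∀ᶠ q : ℂ × ℂ in 𝓝 (y₁, ε₁), q.2 ∈ pdisc ε₀ :=
      continuousAt_snd.eventually ((isOpen_pdisc ε₀).mem_nhds hε₁)
    filter_upwards [hev, hmem] with q hq hq2
    refine ⟨hq2, fun z hz s hs => (p.norm_kernel_le h i j hz hq2 hs).trans ?_⟩
    exact mul_le_mul_of_nonneg_left (hq s hs) (by positivity)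

lemma integrableOn (p : BorelPath S P 𝒜 ct w ε₀ R K A d κ C)
    (h : BorelProblem S P 𝒜 c ct w ε₀ R β K U Bd) (i j : ℕ) {y z ε : ℂ}
    (hz : z ∈ Metric.ball 0 β) (hε : ε ∈ pdisc ε₀) (hy : κ / ‖ε‖ < (d * y).re) :
    IntegrableOn (fun s => lapKernel (fun τ => borelSol S P 𝒜 ct w j τ z ε * τ ^ i) y⁻¹
      (bPath A d s) * bVel A d s) (Ioi 0) := by
  obtain ⟨g, hg, hev⟩ := p.exists_dominated h i j hε hy
  refine Integrable.mono' hg (p.aestronglyMeasurable h i j y hz hε) ?_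
  filter_upwards [ae_restrict_mem measurableSet_Ioi] with s hs
  exact hev.self_of_nhds.2 z hz s hs

lemma hasDerivAt_right (p : BorelPath S P 𝒜 ct w ε₀ R K A d κ C)
    (h : BorelProblem S P 𝒜 c ct w ε₀ R β K U Bd) (j : ℕ) {y z ε : ℂ}
    (hz : z ∈ Metric.ball 0 β) (hε : ε ∈ pdisc ε₀) (hy : κ / ‖ε‖ < (d * y).re) :
    HasDerivAt (fun z => pathLap A d (fun τ => borelSol S P 𝒜 ct w j τ z ε) y)
      (pathLap A d (fun τ => borelSol S P 𝒜 ct w (j + 1) τ z ε) y) z := by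
  obtain ⟨g, hg, hev⟩ := p.exists_dominated h 0 (j + 1) hε hy
  have hev := hev.self_of_nhds.2
  simp only [pow_zero, mul_one] at hev
  have hmeas := fun j z hz => p.aestronglyMeasurable h 0 j y (z := z) hz hε
  simp only [pow_zero, mul_one] at hmeas
  have hint := p.integrableOn h 0 j hz hε hy
  simp only [pow_zero, mul_one] at hint
  refine (hasDerivAt_integral_of_dominated_loc_of_deriv_le (bound := g)
    (F := fun z s => lapKernel (fun τ => borelSol S P 𝒜 ct w j τ z ε) y⁻¹
      (bPath A d s) * bVel A d s)
    (F' := fun z s => lapKernel (fun τ => borelSol S P 𝒜 ct w (j + 1) τ z ε) y⁻¹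
      (bPath A d s) * bVel A d s)
    (Metric.isOpen_ball.mem_nhds hz) ?_ hint (hmeas _ _ hz) ?_ hg ?_).2
  · filter_upwards [Metric.isOpen_ball.mem_nhds hz] with z hz using hmeas _ _ hz
  · filter_upwards [ae_restrict_mem measurableSet_Ioi] with s hs z hz using hev z hz s hs
  · filter_upwards [ae_restrict_mem measurableSet_Ioi] with s hs z hz
    unfold lapKernel
    exact (((h.hasDerivAt_borelSol j (p.mem s (le_of_lt hs)) hε hz).mul_const _).div_const _).mul_const _

lemma hasDerivAt_left (p : BorelPath S P 𝒜 ct w ε₀ R K A d κ C)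
    (h : BorelProblem S P 𝒜 c ct w ε₀ R β K U Bd) (i j : ℕ) {y z ε : ℂ}
    (hz : z ∈ Metric.ball 0 β) (hε : ε ∈ pdisc ε₀) (hy : κ / ‖ε‖ < (d * y).re) :
    HasDerivAt (fun y => pathLap A d (fun τ => borelSol S P 𝒜 ct w j τ z ε * τ ^ i) y)
      (-(pathLap A d (fun τ => borelSol S P 𝒜 ct w j τ z ε * τ ^ (i + 1)) y)) y := by
  obtain ⟨g, hg, hev⟩ := p.exists_dominated h (i + 1) j hε hy
  have hev' : ∀ᶠ y' in 𝓝 y, ∀ s : ℝ, 0 < s →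
        ‖lapKernel (fun τ => borelSol S P 𝒜 ct w j τ z ε * τ ^ (i + 1)) y'⁻¹ (bPath A d s) *
          bVel A d s‖ ≤ g s := by
    have hc : ContinuousAt (fun y' : ℂ => (y', ε)) y := by fun_prop
    filter_upwards [hc.eventually hev] with y' hy' s hs using hy'.2 z hz s hs
  rw [pathLap, ← integral_neg]
  refine (hasDerivAt_integral_of_dominated_loc_of_deriv_le (bound := g)
    (F := fun y s => lapKernel (fun τ => borelSol S P 𝒜 ct w j τ z ε * τ ^ i) y⁻¹
      (bPath A d s) * bVel A d s)
    (F' := fun y s => -(lapKernel (fun τ => borelSol S P 𝒜 ct w j τ z ε * τ ^ (i + 1)) y⁻¹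
      (bPath A d s) * bVel A d s))
    hev' ?_ (p.integrableOn h i j hz hε hy) (p.aestronglyMeasurable h (i + 1) j y hz hε).neg
    ?_ hg ?_).2
  · exact Eventually.of_forall fun y => p.aestronglyMeasurable h i j y hz hε
  · filter_upwards [ae_restrict_mem measurableSet_Ioi] with s hs y' hy'
    rw [norm_neg]
    exact hy' s hs
  · filter_upwards with s y' _
    simp only [lapKernel, div_inv_eq_mul]
    set u := bPath A d s
    have h1 : HasDerivAt (fun y => Complex.exp (-(u * y))) (Complex.exp (-(u * y')) * (-u)) y' := by
      have : HasDerivAt (fun y => -(u * y)) (-u) y' := by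
        simpa using ((hasDerivAt_id y').const_mul u).fun_neg
      exact this.cexp
    convert! ((h1.const_mul (borelSol S P 𝒜 ct w j u z ε * u ^ i)).div_const u).mul_const
      (bVel A d s) using 1
    ring

/-- For a fixed point of the path the integrand is jointly holomorphic in (y, z, ε), also when that
point lies on the boundary of K, by `differentiableOn_borelSol_right`. -/
lemma differentiableOn (p : BorelPath S P 𝒜 ct w ε₀ R K A d κ C)
    (h : BorelProblem S P 𝒜 c ct w ε₀ R β K U Bd) :
    DifferentiableOn ℂ (fun q : ℂ × ℂ × ℂ =>
      pathLap A d (fun τ => borelSol S P 𝒜 ct w 0 τ q.2.1 q.2.2) q.1)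
      {q | q.2.1 ∈ Metric.ball 0 β ∧ q.2.2 ∈ pdisc ε₀ ∧ κ / ‖q.2.2‖ < (d * q.1).re} := by
  have hopen : IsOpen {q : ℂ × ℂ × ℂ |
      q.2.1 ∈ Metric.ball 0 β ∧ q.2.2 ∈ pdisc ε₀ ∧ κ / ‖q.2.2‖ < (d * q.1).re} := by
    rw [isOpen_iff_mem_nhds]
    intro q hq
    have c1 : ContinuousAt (fun q : ℂ × ℂ × ℂ => κ / ‖q.2.2‖) q :=
      continuousAt_const.div (by fun_prop) (norm_ne_zero_iff.2 (ne_zero_of_mem_pdisc hq.2.1))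
    have c2 : ContinuousAt (fun q : ℂ × ℂ × ℂ => (d * q.1).re) q :=
      (Complex.continuous_re.comp (by fun_prop)).continuousAt
    have c3 : ContinuousAt (fun q : ℂ × ℂ × ℂ => q.2.1) q := by fun_prop
    have c4 : ContinuousAt (fun q : ℂ × ℂ × ℂ => q.2.2) q := by fun_prop
    filter_upwards [c1.eventually_lt c2 hq.2.2, c3.eventually (Metric.isOpen_ball.mem_nhds hq.1),
      c4.eventually ((isOpen_pdisc ε₀).mem_nhds hq.2.1)] with q h1 h2 h3 using ⟨h2, h3, h1⟩
  refine differentiableOn_integral_of_dominated (F := fun (q : ℂ × ℂ × ℂ) s =>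
    lapKernel (fun τ => borelSol S P 𝒜 ct w 0 τ q.2.1 q.2.2) q.1⁻¹
      (bPath A d s) * bVel A d s) hopen (fun q hq => ?_) ?_ fun q hq => ?_
  · simpa using p.aestronglyMeasurable h 0 0 q.1 hq.1 hq.2.1
  · filter_upwards [ae_restrict_mem measurableSet_Ioi] with s hs
    unfold lapKernel
    simp only [div_inv_eq_mul]
    simp only [div_eq_mul_inv]
    have h1 := (h.differentiableOn_borelSol_right 0 (p.mem s (le_of_lt hs))).comp
      (f := fun q : ℂ × ℂ × ℂ => q.2) (s := {q : ℂ × ℂ × ℂ | q.2.1 ∈ Metric.ball 0 β ∧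
        q.2.2 ∈ pdisc ε₀ ∧ κ / ‖q.2.2‖ < (d * q.1).re}) (by fun_prop)
        fun q hq => ⟨hq.1, hq.2.1⟩
    refine DifferentiableOn.mul_const (DifferentiableOn.mul_const (DifferentiableOn.mul h1 ?_) _) _
    fun_prop
  · obtain ⟨g, hg, hev⟩ := p.exists_dominated h 0 0 hq.2.1 hq.2.2
    have hc : ContinuousAt (fun q : ℂ × ℂ × ℂ => (q.1, q.2.2)) q := by fun_prop
    have c3 : ContinuousAt (fun q : ℂ × ℂ × ℂ => q.2.1) q := by fun_prop
    refine ⟨_, inter_mem (hc.eventually hev) (c3.eventually (Metric.isOpen_ball.mem_nhds hq.1)),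
      g, hg, ?_⟩
    filter_upwards [ae_restrict_mem measurableSet_Ioi] with s hs x hx
    have := hx.1.2 x.2.1 hx.2 s hs
    simpa using this

/-! ### The equation -/

/-- With y = 1/(εt) one has μt²∂_t = -(μ/ε)∂_y, and -∂_y brings down a factor τ. The identity is
kept on the open set of all admissible t, since the induction differentiates it. -/
lemma iterate_irrD (p : BorelPath S P 𝒜 ct w ε₀ R K A d κ C)
    (h : BorelProblem S P 𝒜 c ct w ε₀ R β K U Bd) (μ : ℂ) (j : ℕ) {z ε : ℂ}
    (hz : z ∈ Metric.ball 0 β) (hε : ε ∈ pdisc ε₀) {v : ℂ → ℂ}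
    (hv : ∀ t, t ≠ 0 → κ / ‖ε‖ < (d * (ε * t)⁻¹).re →
      v t = pathLap A d (fun τ => borelSol S P 𝒜 ct w j τ z ε) (ε * t)⁻¹) (i : ℕ) :
    ∀ t, t ≠ 0 → κ / ‖ε‖ < (d * (ε * t)⁻¹).re → (irrD μ)^[i] v t =
      (μ / ε) ^ i * pathLap A d (fun τ => borelSol S P 𝒜 ct w j τ z ε * τ ^ i) (ε * t)⁻¹ := by
  have hε0 := ne_zero_of_mem_pdisc hε
  induction i with
  | zero => intro t ht0 ht; simpa using hv t ht0 ht
  | succ i ih =>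
    intro t ht0 ht
    rw [Function.iterate_succ_apply', irrD]
    have hev : (irrD μ)^[i] v =ᶠ[𝓝 t] fun t => (μ / ε) ^ i *
        pathLap A d (fun τ => borelSol S P 𝒜 ct w j τ z ε * τ ^ i) (ε * t)⁻¹ := by
      have hc : ContinuousAt (fun t : ℂ => (d * (ε * t)⁻¹).re) t := by
        refine Complex.continuous_re.continuousAt.comp (ContinuousAt.mul continuousAt_const ?_)
        exact ContinuousAt.inv₀ (by fun_prop) (mul_ne_zero hε0 ht0)
      filter_upwards [isOpen_ne.mem_nhds ht0, hc.eventually (lt_mem_nhds ht)] with t h1 h2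
        using ih t h1 h2
    rw [hev.deriv_eq]
    have h1 : HasDerivAt (fun t : ℂ => (ε * t)⁻¹) (-ε / (ε * t) ^ 2) t := by
      have : HasDerivAt (fun t : ℂ => ε * t) ε t := by
        simpa using (hasDerivAt_id t).const_mul ε
      exact this.fun_inv (mul_ne_zero hε0 ht0)
    have h2 := ((p.hasDerivAt_left h i j hz hε ht).comp t h1).const_mul ((μ / ε) ^ i)
    have h3 : deriv (fun t => (μ / ε) ^ i *
        pathLap A d (fun τ => borelSol S P 𝒜 ct w j τ z ε * τ ^ i) (ε * t)⁻¹) t = _ := h2.deriv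
    rw [h3, pow_succ (μ / ε)]
    generalize pathLap A d (fun τ => borelSol S P 𝒜 ct w j τ z ε * τ ^ (i + 1)) (ε * t)⁻¹ = X
    generalize (μ / ε) ^ i = Y
    field_simp

lemma iteratedDeriv_eq (p : BorelPath S P 𝒜 ct w ε₀ R K A d κ C)
    (h : BorelProblem S P 𝒜 c ct w ε₀ R β K U Bd) {y ε : ℂ} (hε : ε ∈ pdisc ε₀)
    (hy : κ / ‖ε‖ < (d * y).re) {v : ℂ → ℂ}
    (hv : ∀ z ∈ Metric.ball (0 : ℂ) β,
      v z = pathLap A d (fun τ => borelSol S P 𝒜 ct w 0 τ z ε) y) (j : ℕ) :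
    ∀ z ∈ Metric.ball (0 : ℂ) β, iteratedDeriv j v z =
      pathLap A d (fun τ => borelSol S P 𝒜 ct w j τ z ε) y := by
  induction j with
  | zero => simpa using hv
  | succ j ih =>
    intro z hz
    rw [iteratedDeriv_succ]
    have hev : iteratedDeriv j v =ᶠ[𝓝 z]
        fun z => pathLap A d (fun τ => borelSol S P 𝒜 ct w j τ z ε) y := by
      filter_upwards [Metric.isOpen_ball.mem_nhds hz] with z hz using ih z hz
    rw [hev.deriv_eq]
    exact (p.hasDerivAt_right h j hz hε hy).deriv

/-- In the variable 1/(εt) the Moebius map is a translation, so under the integral it becomes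
multiplication by e^{-kτ}. -/
lemma mul_moebius_inv {k : ℕ} {ε t : ℂ} (hε : ε ≠ 0) (ht : t ≠ 0) :
    (ε * moebius k ε t)⁻¹ = (ε * t)⁻¹ + k := by
  rw [moebius, ← mul_div_assoc, inv_div, add_div, mul_assoc, mul_div_cancel_right₀ _
    (mul_ne_zero hε ht), one_div]

/-- Both sides are finite sums of absolutely convergent integrals along the same path, and their
integrands coincide by `BorelProblem.equation`. -/
lemma equationAt (p : BorelPath S P 𝒜 ct w ε₀ R K A d κ C)
    (h : BorelProblem S P 𝒜 c ct w ε₀ R β K U Bd) {u : ℂ → ℂ → ℂ → ℂ} {t z ε : ℂ}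
    (hz : z ∈ Metric.ball 0 β) (hε : ε ∈ pdisc ε₀)
    (hu : ∀ t, t ≠ 0 → κ / ‖ε‖ < (d * (ε * t)⁻¹).re → ∀ z ∈ Metric.ball (0 : ℂ) β,
      u t z ε = pathLap A d (fun τ => borelSol S P 𝒜 ct w 0 τ z ε) (ε * t)⁻¹)
    (ht0 : t ≠ 0) (ht : κ / ‖ε‖ < (d * (ε * t)⁻¹).re)
    (htk : ∀ k ∈ 𝒜, 1 + (k.2.2 : ℂ) * ε * t ≠ 0 ∧ κ / ‖ε‖ < (d * ((ε * t)⁻¹ + k.2.2)).re) :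
    EquationAt S P 𝒜 c u t z ε := by
  have hε0 := ne_zero_of_mem_pdisc hε
  have hderiv : ∀ j, ∀ t, t ≠ 0 → κ / ‖ε‖ < (d * (ε * t)⁻¹).re →
      iteratedDeriv j (fun z' => u t z' ε) z =
        pathLap A d (fun τ => borelSol S P 𝒜 ct w j τ z ε) (ε * t)⁻¹ := by
    intro j t ht0 ht
    exact p.iteratedDeriv_eq h hε ht (fun z hz => hu t ht0 ht z hz) j z hz
  unfold EquationAt
  have hL : ∀ i, (irrD ε)^[i] (fun t' => iteratedDeriv S (fun z' => u t' z' ε) z) t =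
      pathLap A d (fun τ => borelSol S P 𝒜 ct w S τ z ε * τ ^ i) (ε * t)⁻¹ := by
    intro i
    rw [p.iterate_irrD h ε S hz hε (hderiv S) i t ht0 ht, div_self hε0, one_pow, one_mul]
  have hR : ∀ k ∈ 𝒜, (irrD 1)^[k.1] (fun t' => iteratedDeriv k.2.1 (fun z' => u t' z' ε) z)
      (moebius k.2.2 ε t) = (1 / ε) ^ k.1 * pathLap A d
        (fun τ => borelSol S P 𝒜 ct w k.2.1 τ z ε * τ ^ k.1) ((ε * t)⁻¹ + k.2.2) := by
    intro k hk
    have hm0 : moebius k.2.2 ε t ≠ 0 := div_ne_zero ht0 (htk k hk).1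
    rw [p.iterate_irrD h 1 k.2.1 hz hε (hderiv k.2.1) k.1 _ hm0, mul_moebius_inv hε0 ht0]
    rw [mul_moebius_inv hε0 ht0]
    exact (htk k hk).2
  have hLs : P.sum (fun i a => a * (irrD ε)^[i]
      (fun t' => iteratedDeriv S (fun z' => u t' z' ε) z) t) = ∑ i ∈ P.support, P.coeff i *
      pathLap A d (fun τ => borelSol S P 𝒜 ct w S τ z ε * τ ^ i) (ε * t)⁻¹ :=
    Finset.sum_congr rfl fun i _ => by simp only [hL i]
  have hRs : ∑ k ∈ 𝒜, c k z ε * (irrD 1)^[k.1] (fun t' => iteratedDeriv k.2.1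
      (fun z' => u t' z' ε) z) (moebius k.2.2 ε t) = ∑ k ∈ 𝒜, c k z ε * ((1 / ε) ^ k.1 *
      pathLap A d (fun τ => borelSol S P 𝒜 ct w k.2.1 τ z ε * τ ^ k.1) ((ε * t)⁻¹ + k.2.2)) :=
    Finset.sum_congr rfl fun k hk => by rw [hR k hk]
  refine hLs.trans (Eq.trans ?_ hRs.symm)
  simp only [pathLap, ← integral_const_mul]
  rw [← integral_finsetSum _ fun i _ => (p.integrableOn h i S hz hε ht).const_mul _,
    ← integral_finsetSum _ fun k hk =>
      ((p.integrableOn h k.1 k.2.1 hz hε (htk k hk).2).const_mul _).const_mul _]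
  refine setIntegral_congr_fun measurableSet_Ioi fun s hs => ?_
  have hτ := p.mem s (le_of_lt hs)
  have heq := h.equation hτ hε hz
  simp only [lapKernel, div_inv_eq_mul]
  set τ := bPath A d s
  have e1 : ∑ i ∈ P.support, P.coeff i * (borelSol S P 𝒜 ct w S τ z ε * τ ^ i *
      Complex.exp (-(τ * (ε * t)⁻¹)) / τ * bVel A d s) =
      (P.eval τ * borelSol S P 𝒜 ct w S τ z ε) * (Complex.exp (-(τ * (ε * t)⁻¹)) / τ *
        bVel A d s) := by
    rw [Polynomial.eval_eq_sum, Polynomial.sum_def, Finset.sum_mul, Finset.sum_mul]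
    refine Finset.sum_congr rfl fun i _ => ?_
    ring
  rw [e1, heq, Finset.sum_mul]
  refine Finset.sum_congr rfl fun k _ => ?_
  have e2 : Complex.exp (-(τ * ((ε * t)⁻¹ + k.2.2))) =
      Complex.exp (-(τ * (ε * t)⁻¹)) * Complex.exp (-(k.2.2 * τ)) := by
    rw [← Complex.exp_add]; congr 1; ring
  rw [e2, one_div, inv_pow]
  ring

end BorelPath

end SPCP

end

/-! ### Convergence in cones and bounded holomorphic solutions -/

open scoped ENNReal Topology

noncomputable section

namespace SPCP

open MeasureTheory Set Filter

/-! ### Absolutely convergent Laplace integrals -/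

theorem hasBrokenLaplace_pathLap {A : ℂ} {g : ℂ → ℂ} {x : ℂ}
    (hint : IntegrableOn (fun s => lapKernel g x (bPath A (-1) s) * bVel A (-1) s) (Ioi 0)) :
    HasBrokenLaplace A g x (pathLap A (-1) g x⁻¹) := by
  have h1 : EqOn (fun s => lapKernel g x (bPath A (-1) s) * bVel A (-1) s)
      (fun s : ℝ => lapKernel g x (s * A) * A) (Ioc 0 1) := by
    intro s hs
    simp only [bPath_of_le hs.2, bVel, if_pos hs.2]
  have h2 : EqOn (fun s => lapKernel g x (bPath A (-1) s) * bVel A (-1) s)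
      (fun s : ℝ => lapKernel g x (A - ((s - 1 : ℝ) : ℂ)) * (-1)) (Ioi 1) := by
    intro s hs
    have hs' : (1 : ℝ) < s := hs
    simp only [bPath_of_ge hs'.le, bVel, if_neg (not_le.2 hs'), mul_neg, mul_one, ← sub_eq_add_neg]
  have i1 := (hint.mono_set Ioc_subset_Ioi_self).congr_fun h1 measurableSet_Ioc
  have i2 := (hint.mono_set (Ioi_subset_Ioi zero_le_one)).congr_fun h2 measurableSet_Ioi
  have hmp : MeasurePreserving (fun s : ℝ => s - 1) volume volume :=
    measurePreserving_sub_right volume 1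
  have hemb : MeasurableEmbedding (fun s : ℝ => s - 1) := measurableEmbedding_subRight 1
  have hpre : (fun s : ℝ => s - 1) ⁻¹' Ioi 0 = Ioi 1 := by
    ext s; simp
  have i3 : IntegrableOn (fun s : ℝ => lapKernel g x (A - s) * (-1)) (Ioi 0) := by
    rw [← hmp.integrableOn_comp_preimage hemb, hpre]
    exact i2
  have e3 : ∫ s in Ioi (1 : ℝ), lapKernel g x (A - ((s - 1 : ℝ) : ℂ)) * (-1) =
      ∫ s in Ioi (0 : ℝ), lapKernel g x (A - s) * (-1) := by
    rw [← hpre]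
    exact hmp.setIntegral_preimage_emb hemb (fun s : ℝ => lapKernel g x (A - s) * (-1)) _
  refine ⟨(intervalIntegrable_iff_integrableOn_Ioc_of_le zero_le_one).2 i1, ?_, ?_⟩
  · have := i3.neg
    refine this.congr_fun (fun s _ => ?_) measurableSet_Ioi
    simp
  · rw [pathLap, inv_inv, ← Ioc_union_Ioi_eq_Ioi (zero_le_one' ℝ),
      setIntegral_union Ioc_disjoint_Ioi_same measurableSet_Ioi
        (hint.mono_set Ioc_subset_Ioi_self) (hint.mono_set (Ioi_subset_Ioi zero_le_one)),
      setIntegral_congr_fun measurableSet_Ioc h1, setIntegral_congr_fun measurableSet_Ioi h2, e3,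
      intervalIntegral.integral_of_le zero_le_one, Ioc_union_Ioi_eq_Ioi (zero_le_one' ℝ)]

lemma bPath_self (d : ℂ) (s : ℝ) : bPath d d s = s * d := by
  rcases le_total s 1 with h | h
  · exact bPath_of_le h
  · rw [bPath_of_ge h]; push_cast; ring

lemma bVel_self (d : ℂ) (s : ℝ) : bVel d d s = d := by
  unfold bVel; split_ifs <;> rfl

theorem hasRayLaplace_pathLap {γ : ℝ} {g : ℂ → ℂ} {x d : ℂ} (hd : d = Complex.exp (γ * Complex.I))
    (hint : IntegrableOn (fun s => lapKernel g x (bPath d d s) * bVel d d s) (Ioi 0)) :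
    HasRayLaplace γ g x (pathLap d d g x⁻¹) := by
  subst hd
  simp only [bPath_self, bVel_self] at hint
  refine ⟨hint, ?_⟩
  simp only [pathLap, bPath_self, bVel_self, inv_inv]

/-! ### Cones -/

lemma InCone.le_cos {η : ℝ} (hη : 0 < η) :
    ∃ Δ : ℝ, 0 < Δ ∧ ∀ x, InCone η x → Δ ≤ Real.cos x := by
  rcases lt_or_ge η (Real.pi / 2) with h | h
  · refine ⟨Real.sin η, Real.sin_pos_of_pos_of_lt_pi hη (by linarith [Real.pi_pos]), ?_⟩
    rintro x ⟨m, hm⟩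
    have e : Real.cos x = Real.cos (x + 2 * Real.pi * m) := by
      rw [mul_comm (2 * Real.pi)]; exact (Real.cos_add_int_mul_two_pi x m).symm
    rw [e, ← Real.cos_pi_div_two_sub, ← Real.cos_abs (x + 2 * Real.pi * m)]
    refine Real.cos_le_cos_of_nonneg_of_le_pi (abs_nonneg _) (by linarith [Real.pi_pos]) ?_
    exact abs_le.2 ⟨by linarith [hm.1], hm.2.le⟩
  -- For η ≥ π/2 the interval is empty, and any Δ would do.
  · refine ⟨1, one_pos, ?_⟩
    rintro x ⟨m, hm⟩
    exact absurd (hm.1.trans hm.2) (by linarith)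

lemma re_exp_mul_inv {ε t : ℂ} (ψ : ℝ) :
    (Complex.exp (ψ * Complex.I) * (ε * t)⁻¹).re =
      Real.cos (ψ - ε.arg - t.arg) / (‖ε‖ * ‖t‖) := by
  have h1 : (ε * t)⁻¹ = ((‖ε‖ * ‖t‖ : ℝ) : ℂ)⁻¹ *
      Complex.exp ((-ε.arg - t.arg : ℝ) * Complex.I) := by
    conv_lhs => rw [← Complex.norm_mul_exp_arg_mul_I ε, ← Complex.norm_mul_exp_arg_mul_I t]
    rw [mul_mul_mul_comm, ← Complex.exp_add, mul_inv, ← Complex.exp_neg]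
    push_cast
    congr 2
    ring
  rw [h1, mul_left_comm, ← Complex.exp_add, ← add_mul, ← Complex.ofReal_add, ← Complex.ofReal_inv,
    Complex.re_ofReal_mul, Complex.exp_ofReal_mul_I_re, div_eq_inv_mul]
  congr 2
  ring

/-- The modulus of (εt)⁻¹ is at least 1/(rT ‖ε‖). Shrinking the sector in t therefore makes the
decay rate as large a multiple of 1/‖ε‖ as needed, in particular larger than the growth rate κ/‖ε‖.
-/
lemma re_exp_mul_inv_ge {ε t : ℂ} {ψ Δ rT : ℝ} (hΔ : 0 < Δ) (hε : ε ≠ 0) (ht : t ≠ 0)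
    (htr : ‖t‖ ≤ rT) (hc : Δ ≤ Real.cos (ψ - ε.arg - t.arg)) :
    Δ / rT / ‖ε‖ ≤ (Complex.exp (ψ * Complex.I) * (ε * t)⁻¹).re := by
  have h1 : 0 < ‖ε‖ := norm_pos_iff.2 hε
  have h2 : 0 < ‖t‖ := norm_pos_iff.2 ht
  have h3 := hΔ.le.trans hc
  rw [re_exp_mul_inv, div_div, mul_comm rT]
  gcongr

lemma norm_bPath_le_and_le_re {A d y : ℂ} {D : ℝ} (hd : ‖d‖ = 1)
    (hA : D * ‖A‖ ≤ (A * y).re) (hdy : D ≤ (d * y).re) {s : ℝ} (hs : 0 ≤ s) :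
    ‖bPath A d s‖ ≤ min s 1 * ‖A‖ + max (s - 1) 0 ∧
      D * (min s 1 * ‖A‖ + max (s - 1) 0) ≤ (bPath A d s * y).re := by
  have h1 : 0 ≤ min s 1 := le_min hs zero_le_one
  have h2 : 0 ≤ max (s - 1) 0 := le_max_right _ _
  constructor
  · refine (norm_add_le _ _).trans ?_
    rw [norm_mul, norm_mul, hd, mul_one, Complex.norm_real, Complex.norm_real,
      Real.norm_of_nonneg h1, Real.norm_of_nonneg h2]
  · rw [bPath, add_mul, Complex.add_re, mul_assoc, mul_assoc, Complex.re_ofReal_mul,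
      Complex.re_ofReal_mul]
    nlinarith

/-- In a cone, the Laplace kernel dominates the growth of exponential type `κ / |ε|`. -/
lemma cone_bound {A d y ε : ℂ} {D κ θ a : ℝ} (hd : ‖d‖ = 1) (hε : ε ≠ 0) (ha : 0 < a)
    (ha1 : a ≤ 1) (haA : a ≤ ‖A‖) (hκ : 0 ≤ κ) (hθ : 0 ≤ θ) (hD : κ + θ / a ≤ D)
    (hA : D / ‖ε‖ * ‖A‖ ≤ (A * y).re) (hdy : D / ‖ε‖ ≤ (d * y).re) {s : ℝ} (hs : 0 ≤ s) :
    κ / ‖ε‖ * ‖bPath A d s‖ + θ / ‖ε‖ * s ≤ (bPath A d s * y).re := by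
  obtain ⟨h1, h2⟩ := norm_bPath_le_and_le_re hd hA hdy hs
  set l := min s 1 * ‖A‖ + max (s - 1) 0 with hl
  have hε0 : 0 < ‖ε‖ := norm_pos_iff.2 hε
  have hls : a * s ≤ l := by
    rcases le_total s 1 with h | h
    · rw [hl, min_eq_left h, max_eq_right (by linarith)]; nlinarith
    · rw [hl, min_eq_right h, max_eq_left (by linarith)]; nlinarith
  have hl0 : 0 ≤ l := (mul_nonneg ha.le hs).trans hls
  calc _ ≤ κ / ‖ε‖ * l + θ / ‖ε‖ * (l / a) := by
        gcongr
        rw [le_div_iff₀' ha]; exact hls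
    _ = (κ + θ / a) / ‖ε‖ * l := by field_simp
    _ ≤ D / ‖ε‖ * l := by gcongr
    _ ≤ _ := h2

/-! ### Bounded holomorphic solutions -/

variable {S : ℕ} {P : Polynomial ℂ} {𝒜 : Finset (ℕ × ℕ × ℕ)}
  {c : ℕ × ℕ × ℕ → ℂ → ℂ → ℂ} {ct : ℕ × ℕ × ℕ → ℕ → ℂ → ℂ} {w : ℕ → ℂ → ℂ → ℂ}
  {ε₀ R β : ℝ} {K U : Set ℂ} {Bd : ℂ → ℂ → ℝ} {A d : ℂ} {κ C : ℝ}

lemma BorelPath.norm_kernel_le_of_cone (p : BorelPath S P 𝒜 ct w ε₀ R K A d κ C)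
    (h : BorelProblem S P 𝒜 c ct w ε₀ R β K U Bd) {y z ε : ℂ} {θ : ℝ}
    (hz : z ∈ Metric.ball 0 β) (hε : ε ∈ pdisc ε₀) {s : ℝ} (hs : 0 < s)
    (hcone : κ / ‖ε‖ * ‖bPath A d s‖ + θ / ‖ε‖ * s ≤ (bPath A d s * y).re) :
    ‖lapKernel (fun τ => borelSol S P 𝒜 ct w 0 τ z ε) y⁻¹ (bPath A d s) * bVel A d s‖ ≤
      C * 2 * (‖A‖ + 1) * Real.exp (-(θ / ‖ε‖ * s)) := by
  have h1 := p.norm_kernel_le h 0 0 (y := y) hz hε hs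
  have hC := p.C_nonneg
  simp only [pow_zero, mul_one, Nat.factorial_zero, Nat.cast_one, one_mul] at h1
  refine h1.trans (mul_le_mul_of_nonneg_left ?_ (by positivity))
  rw [← Real.exp_add]
  refine Real.exp_le_exp.2 ?_
  linarith

/-- The surplus θ/‖ε‖ in the exponent integrates to ‖ε‖/θ ≤ ε₀/θ, which makes the bound uniform in
ε, although the Borel solution itself is not bounded uniformly in ε. -/
lemma BorelPath.norm_pathLap_le (p : BorelPath S P 𝒜 ct w ε₀ R K A d κ C)
    (h : BorelProblem S P 𝒜 c ct w ε₀ R β K U Bd) {y z ε : ℂ} {θ : ℝ} (hθ : 0 < θ)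
    (hz : z ∈ Metric.ball 0 β) (hε : ε ∈ pdisc ε₀)
    (hcone : ∀ s, 0 ≤ s → κ / ‖ε‖ * ‖bPath A d s‖ + θ / ‖ε‖ * s ≤ (bPath A d s * y).re) :
    ‖pathLap A d (fun τ => borelSol S P 𝒜 ct w 0 τ z ε) y‖ ≤
      C * 2 * (‖A‖ + 1) * (ε₀ / θ) := by
  have hC := p.C_nonneg
  have hε0 : 0 < ‖ε‖ := norm_pos_iff.2 (ne_zero_of_mem_pdisc hε)
  refine (norm_tail_integral_le (div_pos hθ hε0) fun s hs =>
    p.norm_kernel_le_of_cone h hz hε hs (hcone s (le_of_lt hs))).trans ?_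
  rw [mul_zero, neg_zero, Real.exp_zero, one_div_div]
  have : ‖ε‖ ≤ ε₀ := (mem_ball_zero_iff.1 hε.1).le
  gcongr

/-- `u` is represented by the Laplace transform along the path `bPath A d`. -/
def IsLaplaceRep (S : ℕ) (P : Polynomial ℂ) (𝒜 : Finset (ℕ × ℕ × ℕ))
    (ct : ℕ × ℕ × ℕ → ℕ → ℂ → ℂ) (w : ℕ → ℂ → ℂ → ℂ) (ε₀ β κ : ℝ) (A d : ℂ)
    (u : ℂ → ℂ → ℂ → ℂ) : Prop :=
  ∀ t z ε, t ≠ 0 → z ∈ Metric.ball (0 : ℂ) β → ε ∈ pdisc ε₀ → κ / ‖ε‖ < (d * (ε * t)⁻¹).re →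
    u t z ε = pathLap A d (fun τ => borelSol S P 𝒜 ct w 0 τ z ε) (ε * t)⁻¹

/-- The convergence condition is open in (t, z, ε), so near the point u is the transform along one
fixed path. -/
lemma BorelPath.differentiableAt (p : BorelPath S P 𝒜 ct w ε₀ R K A d κ C)
    (h : BorelProblem S P 𝒜 c ct w ε₀ R β K U Bd) {u : ℂ → ℂ → ℂ → ℂ}
    (hu : IsLaplaceRep S P 𝒜 ct w ε₀ β κ A d u) {t z ε : ℂ} (ht : t ≠ 0)
    (hz : z ∈ Metric.ball (0 : ℂ) β) (hε : ε ∈ pdisc ε₀) (hy : κ / ‖ε‖ < (d * (ε * t)⁻¹).re) :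
    DifferentiableAt ℂ (fun q : ℂ × ℂ × ℂ => u q.1 q.2.1 q.2.2) (t, z, ε) := by
  have hε0 := ne_zero_of_mem_pdisc hε
  have dinv : DifferentiableAt ℂ (fun q : ℂ × ℂ × ℂ => (q.2.2 * q.1)⁻¹) (t, z, ε) :=
    DifferentiableAt.fun_inv (by fun_prop) (mul_ne_zero hε0 ht)
  have c1 : ContinuousAt (fun q : ℂ × ℂ × ℂ => κ / ‖q.2.2‖) (t, z, ε) :=
    continuousAt_const.div (by fun_prop) (norm_ne_zero_iff.2 hε0)
  have c2 : ContinuousAt (fun q : ℂ × ℂ × ℂ => (d * (q.2.2 * q.1)⁻¹).re) (t, z, ε) :=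
    Complex.continuous_re.continuousAt.comp (continuousAt_const.mul dinv.continuousAt)
  have c3 : ContinuousAt (fun q : ℂ × ℂ × ℂ => q.2.1) (t, z, ε) := by fun_prop
  have c4 : ContinuousAt (fun q : ℂ × ℂ × ℂ => q.2.2) (t, z, ε) := by fun_prop
  have c5 : ContinuousAt (fun q : ℂ × ℂ × ℂ => q.1) (t, z, ε) := by fun_prop
  have hev : ∀ᶠ q : ℂ × ℂ × ℂ in 𝓝 (t, z, ε), q.1 ≠ 0 ∧ q.2.1 ∈ Metric.ball 0 β ∧
      q.2.2 ∈ pdisc ε₀ ∧ κ / ‖q.2.2‖ < (d * (q.2.2 * q.1)⁻¹).re := by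
    filter_upwards [c1.eventually_lt c2 hy, c3.eventually (Metric.isOpen_ball.mem_nhds hz),
      c4.eventually ((isOpen_pdisc ε₀).mem_nhds hε), c5.eventually (isOpen_ne.mem_nhds ht)]
      with q h1 h2 h3 h4 using ⟨h4, h2, h3, h1⟩
  have hcomp : DifferentiableAt ℂ (fun q : ℂ × ℂ × ℂ =>
      pathLap A d (fun τ => borelSol S P 𝒜 ct w 0 τ q.2.1 q.2.2) (q.2.2 * q.1)⁻¹) (t, z, ε) := by
    have : DifferentiableWithinAt ℂ (fun q : ℂ × ℂ × ℂ =>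
        pathLap A d (fun τ => borelSol S P 𝒜 ct w 0 τ q.2.1 q.2.2) q.1)
        {q | q.2.1 ∈ Metric.ball 0 β ∧ q.2.2 ∈ pdisc ε₀ ∧ κ / ‖q.2.2‖ < (d * q.1).re}
        ((fun q : ℂ × ℂ × ℂ => ((q.2.2 * q.1)⁻¹, q.2)) (t, z, ε)) :=
      p.differentiableOn h ((ε * t)⁻¹, z, ε) ⟨hz, hε, hy⟩
    have d2 : DifferentiableAt ℂ (fun q : ℂ × ℂ × ℂ => ((q.2.2 * q.1)⁻¹, q.2)) (t, z, ε) :=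
      dinv.prodMk (by fun_prop)
    refine (this.comp (s := {q : ℂ × ℂ × ℂ | q.1 ≠ 0 ∧ q.2.1 ∈ Metric.ball 0 β ∧
      q.2.2 ∈ pdisc ε₀ ∧ κ / ‖q.2.2‖ < (d * (q.2.2 * q.1)⁻¹).re}) (t, z, ε)
      d2.differentiableWithinAt (fun q hq => hq.2)).differentiableAt hev
  exact hcomp.congr_of_eventuallyEq
    (hev.mono fun q hq => hu q.1 q.2.1 q.2.2 hq.1 hq.2.1 hq.2.2.1 hq.2.2.2)

/-- The path may vary with (t, ε), as it must on the sectors. Holomorphy and the equation are local,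
and near each point a single path represents u; only the bound has to be uniform. -/
theorem isBoundedHolSolution (h : BorelProblem S P 𝒜 c ct w ε₀ R β K U Bd)
    {u : ℂ → ℂ → ℂ → ℂ} {𝒯 𝓔 : Set ℂ} {Kb : ℝ} (h𝓔 : 𝓔 ⊆ pdisc ε₀)
    (H : ∀ t ∈ 𝒯, ∀ ε ∈ 𝓔, t ≠ 0 ∧ (∀ k ∈ 𝒜, 1 + (k.2.2 : ℂ) * ε * t ≠ 0) ∧
      ∃ A d C, BorelPath S P 𝒜 ct w ε₀ R K A d κ C ∧ IsLaplaceRep S P 𝒜 ct w ε₀ β κ A d u ∧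
        κ / ‖ε‖ < (d * (ε * t)⁻¹).re ∧ (∀ k ∈ 𝒜, κ / ‖ε‖ < (d * ((ε * t)⁻¹ + k.2.2)).re) ∧
        ∀ z ∈ Metric.ball (0 : ℂ) β, ‖u t z ε‖ ≤ Kb) :
    IsBoundedHolSolution S P 𝒜 c 𝒯 (Metric.ball 0 β) 𝓔 u := by
  refine ⟨?_, ⟨Kb, fun t ht z hz ε hε => ?_⟩, fun t ht z hz ε hε => ?_⟩
  · rintro ⟨t, z, ε⟩ ⟨hz, hε, ht⟩
    refine DifferentiableAt.differentiableWithinAt ?_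
    rcases ht with ht | ⟨k, hk, t', ht', e⟩
    · obtain ⟨ht0, -, A, d, C, p, hu, hy, -, -⟩ := H t ht ε hε
      exact p.differentiableAt h hu ht0 hz (h𝓔 hε) hy
    · obtain ⟨ht0, h1, A, d, C, p, hu, -, hy, -⟩ := H t' ht' ε hε
      dsimp only at e
      subst e
      refine p.differentiableAt h hu (div_ne_zero ht0 (h1 k hk)) hz (h𝓔 hε) ?_
      rw [BorelPath.mul_moebius_inv (ne_zero_of_mem_pdisc (h𝓔 hε)) ht0]
      exact hy k hk
  · obtain ⟨-, -, A, d, C, -, -, -, -, hb⟩ := H t ht ε hε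
    exact hb z hz
  · obtain ⟨ht0, h1, A, d, C, p, hu, hy, hyk, -⟩ := H t ht ε hε
    exact ⟨h1, p.equationAt h hz (h𝓔 hε) (fun t h1 h2 z hz => hu t z ε h1 hz (h𝓔 hε) h2) ht0 hy
      fun k hk => ⟨h1 k hk, hyk k hk⟩⟩

end SPCP

end

/-! ### Uniform growth rate and deformation of paths -/

open scoped ENNReal Topology

noncomputable section

namespace SPCP

open MeasureTheory Set Filter

/-! ### Taylor coefficients of the coefficients of the equation -/

/-- The coefficients are Cauchy integrals over the circle of radius ρ₁. This makes them holomorphic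
in ε and bounds them with the same constant for all ε. -/
theorem exists_taylor {c : ℂ → ℂ → ℂ} {ρ ρ₁ ε₀ Kc : ℝ} (hρ₁ : 0 < ρ₁) (hρ : ρ₁ < ρ)
    (hc : DifferentiableOn ℂ (fun q : ℂ × ℂ => c q.1 q.2) (Metric.ball 0 ρ ×ˢ Metric.ball 0 ε₀))
    (hK : ∀ z ∈ Metric.ball (0 : ℂ) ρ, ∀ ε ∈ Metric.ball (0 : ℂ) ε₀, ‖c z ε‖ ≤ Kc) :
    ∃ ct : ℕ → ℂ → ℂ, (∀ m, DifferentiableOn ℂ (ct m) (Metric.ball 0 ε₀)) ∧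
      (∀ m, ∀ ε ∈ Metric.ball (0 : ℂ) ε₀, ‖ct m ε‖ ≤ Kc * ρ₁⁻¹ ^ m) ∧
      ∀ ε ∈ Metric.ball (0 : ℂ) ε₀, ∀ z ∈ Metric.ball (0 : ℂ) ρ₁,
        (Summable fun m => ‖ct m ε * z ^ m‖) ∧ ∑' m, ct m ε * z ^ m = c z ε := by
  have hsph : ∀ θ : ℝ, circleMap 0 ρ₁ θ ∈ Metric.ball (0 : ℂ) ρ := by
    intro θ
    rw [mem_ball_zero_iff, norm_circleMap_zero, abs_of_pos hρ₁]
    exact hρ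
  have hne : ∀ θ : ℝ, circleMap 0 ρ₁ θ ≠ 0 := fun θ => circleMap_ne_center hρ₁.ne'
  have hcz : ∀ ε ∈ Metric.ball (0 : ℂ) ε₀,
      DifferentiableOn ℂ (fun z => c z ε) (Metric.ball 0 ρ) := fun ε hε =>
    hc.comp (f := fun z : ℂ => (z, ε)) (by fun_prop) fun z hz => ⟨hz, hε⟩
  have hcε : ∀ z ∈ Metric.ball (0 : ℂ) ρ,
      DifferentiableOn ℂ (c z) (Metric.ball 0 ε₀) := fun z hz =>
    hc.comp (f := fun ε : ℂ => (z, ε)) (by fun_prop) fun ε hε => ⟨hz, hε⟩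
  set ct : ℕ → ℂ → ℂ := fun m ε => cauchyPowerSeries (fun z => c z ε) 0 ρ₁ m fun _ => 1 with hct
  have hct' : ∀ m ε, ct m ε = (2 * Real.pi * Complex.I : ℂ)⁻¹ •
      ∮ z in C(0, ρ₁), (1 / (z - 0)) ^ m • (z - 0)⁻¹ • c z ε := fun m ε =>
    cauchyPowerSeries_apply _ _ _ _ _
  have hbd : ∀ m, ∀ ε ∈ Metric.ball (0 : ℂ) ε₀, ‖ct m ε‖ ≤ Kc * ρ₁⁻¹ ^ m := by
    intro m ε hε
    have := circleIntegral.norm_two_pi_i_inv_smul_integral_le_of_norm_le_const (c := 0) (R := ρ₁)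
      (f := fun z => (1 / (z - 0)) ^ m • (z - 0)⁻¹ • c z ε) (C := ρ₁⁻¹ ^ m * (ρ₁⁻¹ * Kc)) hρ₁.le ?_
    · rw [hct']
      refine this.trans (le_of_eq ?_)
      field_simp
    · intro z hz
      have hz' : ‖z‖ = ρ₁ := by simpa using hz
      have hzb : z ∈ Metric.ball (0 : ℂ) ρ := by rw [mem_ball_zero_iff, hz']; exact hρ
      rw [norm_smul, norm_smul, sub_zero, norm_pow, one_div, norm_inv, hz']
      have := hK z hzb ε hε
      gcongr
  refine ⟨ct, fun m => ?_, hbd, fun ε hε z hz => ?_⟩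
  · have : ct m = fun ε => (2 * Real.pi * Complex.I : ℂ)⁻¹ • ∫ θ in Ioc 0 (2 * Real.pi),
        deriv (circleMap 0 ρ₁) θ • ((1 / (circleMap 0 ρ₁ θ - 0)) ^ m •
          (circleMap 0 ρ₁ θ - 0)⁻¹ • c (circleMap 0 ρ₁ θ) ε) := by
      funext ε
      rw [hct', circleIntegral, intervalIntegral.integral_of_le (by positivity)]
    rw [this]
    suffices hInt : DifferentiableOn ℂ (fun ε => ∫ θ in Ioc 0 (2 * Real.pi),
        deriv (circleMap 0 ρ₁) θ • ((1 / (circleMap 0 ρ₁ θ - 0)) ^ m •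
          (circleMap 0 ρ₁ θ - 0)⁻¹ • c (circleMap 0 ρ₁ θ) ε)) (Metric.ball 0 ε₀) from
      DifferentiableOn.fun_const_smul hInt _
    refine differentiableOn_integral_of_dominated Metric.isOpen_ball
      (fun ε hε => ?_) (ae_of_all _ fun θ => ?_) fun ε hε => ?_
    · refine Continuous.aestronglyMeasurable ?_
      have h1 : Continuous fun θ => c (circleMap 0 ρ₁ θ) ε :=
        (hcz ε hε).continuousOn.comp_continuous (continuous_circleMap 0 ρ₁) hsph
      have h2 : Continuous fun θ => deriv (circleMap 0 ρ₁) θ := by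
        simp only [deriv_circleMap]
        exact (continuous_circleMap 0 ρ₁).mul continuous_const
      have h3 : Continuous fun θ => (circleMap 0 ρ₁ θ - 0)⁻¹ := by
        simp only [sub_zero]
        exact (continuous_circleMap 0 ρ₁).inv₀ hne
      simp only [one_div]
      exact h2.smul ((h3.pow m).smul (h3.smul h1))
    · exact (((hcε _ (hsph θ)).fun_const_smul ((circleMap 0 ρ₁ θ - 0)⁻¹)).fun_const_smul
        ((1 / (circleMap 0 ρ₁ θ - 0)) ^ m)).fun_const_smul (deriv (circleMap 0 ρ₁) θ)
    · refine ⟨_, Metric.isOpen_ball.mem_nhds hε, fun _ => ρ₁ * (ρ₁⁻¹ ^ m * (ρ₁⁻¹ * Kc)),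
        integrable_const _, ae_of_all _ fun θ x hx => ?_⟩
      have := hK _ (hsph θ) x hx
      rw [norm_smul, norm_smul, norm_smul, deriv_circleMap, norm_mul, Complex.norm_I, mul_one,
        sub_zero, norm_pow, one_div, norm_inv, norm_circleMap_zero, abs_of_pos hρ₁]
      change _ ≤ ρ₁ * (ρ₁⁻¹ ^ m * (ρ₁⁻¹ * Kc))
      gcongr
  · have hz1 : ‖z‖ < ρ₁ := mem_ball_zero_iff.1 hz
    constructor
    · refine Summable.of_nonneg_of_le (fun _ => norm_nonneg _) (fun m => ?_)
        ((summable_geometric_of_lt_one (r := ‖z‖ / ρ₁) (by positivity)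
          ((div_lt_one hρ₁).2 hz1)).mul_left Kc)
      rw [norm_mul, norm_pow, div_pow, div_eq_mul_inv, ← inv_pow, mul_comm (‖z‖ ^ m), ← mul_assoc]
      exact mul_le_mul_of_nonneg_right (hbd m ε hε) (by positivity)
    · have hd : DiffContOnCl ℂ (fun z => c z ε) (Metric.ball 0 ρ₁) := by
        refine DifferentiableOn.diffContOnCl ((hcz ε hε).mono ?_)
        rw [closure_ball _ hρ₁.ne']
        exact Metric.closedBall_subset_ball hρ
      lift ρ₁ to NNReal using hρ₁.le
      have hs := hd.hasFPowerSeriesOnBall (by exact_mod_cast hρ₁)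
      have h2 := hs.hasSum (y := z) (by simpa [Metric.eball_coe] using hz1)
      rw [zero_add] at h2
      refine HasSum.tsum_eq ?_
      have e : (fun m => ct m ε * z ^ m) =
          fun m => (cauchyPowerSeries (fun z => c z ε) 0 ρ₁ m) fun _ => z := funext fun m => by
        rw [FormalMultilinearSeries.apply_eq_pow_smul_coeff, smul_eq_mul, mul_comm]
        rfl
      rw [e]
      exact h2

/-- A nonconstant polynomial tends to infinity in modulus, so |P| attains its minimum on the closed
set, and this minimum is not 0. -/
lemma exists_pos_le_norm_eval {P : Polynomial ℂ} (hP : P ≠ 0) {Z : Set ℂ} (hZ : IsClosed Z)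
    (hroot : ∀ τ ∈ Z, ¬ P.IsRoot τ) : ∃ m : ℝ, 0 < m ∧ ∀ τ ∈ Z, m ≤ ‖P.eval τ‖ := by
  rcases Z.eq_empty_or_nonempty with rfl | ⟨τ₀, hτ₀⟩
  · exact ⟨1, one_pos, by simp⟩
  rcases le_or_gt P.degree 0 with hdeg | hdeg
  · rw [Polynomial.eq_C_of_degree_le_zero hdeg] at hP ⊢
    refine ⟨‖P.coeff 0‖, norm_pos_iff.2 fun h => hP (by rw [h, map_zero]), fun τ _ => ?_⟩
    rw [Polynomial.eval_C]
  · have ht : Tendsto (fun τ : ℂ => ‖P.eval τ‖) (cocompact ℂ) atTop :=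
      P.tendsto_norm_atTop hdeg tendsto_norm_cocompact_atTop
    obtain ⟨τ₁, h1, hmin⟩ := (P.continuous.norm.continuousOn (s := Z)).exists_isMinOn' hZ hτ₀
      ((ht.eventually (eventually_ge_atTop _)).filter_mono inf_le_left)
    exact ⟨‖P.eval τ₁‖, norm_pos_iff.2 (hroot τ₁ h1), fun τ hτ => hmin hτ⟩

/-! ### Growth of the Taylor coefficients -/

lemma summable_zetaR {b : ℝ} (hb : 1 < b) : Summable fun n : ℕ => 1 / ((n : ℝ) + 1) ^ b := by
  have := (summable_nat_add_iff 1).2 (Real.summable_one_div_nat_rpow.2 hb)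
  simpa using this

lemma rSeq_le_zetaR {b : ℝ} (hb : 1 < b) (n : ℕ) : rSeq b n ≤ zetaR b :=
  (summable_zetaR hb).sum_le_tsum _ fun i _ => by positivity

lemma rSeq_zero (b : ℝ) : rSeq b 0 = 1 := by simp [rSeq]

lemma one_le_zetaR {b : ℝ} (hb : 1 < b) : 1 ≤ zetaR b := rSeq_zero b ▸ rSeq_le_zetaR hb 0

/-- The Taylor coefficients in the Borel plane grow geometrically, at a rate that is uniform with
respect to the point and to the weight. -/
theorem exists_growth_rate {S : ℕ} {P : Polynomial ℂ} {𝒜 : Finset (ℕ × ℕ × ℕ)}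
    {ct : ℕ × ℕ × ℕ → ℕ → ℂ → ℂ} {ξ b σ₁ cP C₁ Kc ρ₁ ε₀ : ℝ} (hb : 1 < b)
    (hcond : ∀ k ∈ 𝒜, (k.2.1 : ℝ) + b * k.1 + b * k.2.2 / ξ ≤ S ∧ k.2.1 < S)
    (hσ₁ : 0 < σ₁) (hcP : 0 < cP) (hC₁ : 0 ≤ C₁) (hKc : 0 ≤ Kc) (hρ₁ : 0 < ρ₁)
    (hct : ∀ k ∈ 𝒜, ∀ m, ∀ ε ∈ Metric.ball (0 : ℂ) ε₀, ‖ct k m ε‖ ≤ Kc * ρ₁⁻¹ ^ m) :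
    ∃ R : ℝ, 1 ≤ R ∧ ∀ (w : ℕ → ℂ → ℂ → ℂ) (τ ε : ℂ) (X D : ℝ), ε ∈ Metric.ball (0 : ℂ) ε₀ →
      cP ≤ ‖P.eval τ‖ → 0 ≤ X → 0 ≤ D →
      (∀ k ∈ 𝒜, ∀ N : ℕ, 1 ≤ N → ‖Complex.exp (-(k.2.2 * τ))‖ ≤
        C₁ * (N : ℝ) ^ (b * k.2.2 / ξ) * Real.exp (1 / (N : ℝ) ^ b * X)) →
      (∀ j < S, ‖w j τ ε‖ ≤ D * Real.exp (σ₁ / ‖ε‖ * ‖τ‖ + X)) →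
      ∀ n, ‖borelCoef S P 𝒜 ct w n τ ε‖ ≤
        D * Real.exp (zetaR b * (σ₁ / ‖ε‖ * ‖τ‖ + X)) * (R ^ n * n.factorial) := by
  set C₀ : ℝ := ∑ k ∈ 𝒜, k.1.factorial / σ₁ ^ k.1 * C₁ / cP with hC₀
  have hC₀0 : 0 ≤ C₀ := Finset.sum_nonneg fun k _ => by positivity
  -- The three summands ensure R ≥ 1, ρ₁R ≥ 2 and the bound by R required in `norm_cauchySeq_le`;
  -- none involves τ, ε, X, D or the data.
  set R : ℝ := 1 + 2 / ρ₁ + 2 * 𝒜.card * Kc * C₀ * (S + 1) ^ S with hR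
  have hz1 : 0 ≤ 2 / ρ₁ := by positivity
  have hz2 : 0 ≤ 2 * 𝒜.card * Kc * C₀ * (S + 1) ^ S := by positivity
  refine ⟨R, by rw [hR]; linarith, fun w τ ε X D hε hP hX hD hexp hw n => ?_⟩
  have hL : 0 ≤ σ₁ / ‖ε‖ * ‖τ‖ + X := by positivity
  have main := norm_cauchySeq_le (fun k hk => (hcond k hk).2) (b := b)
    (L := σ₁ / ‖ε‖ * ‖τ‖ + X) (D := D) (C₀ := C₀) (Kc := Kc) (ρ := ρ₁) (R := R)
    (q := fun k => qCoef P k τ ε) (c := fun k m => ct k m ε) (w := fun j => w j τ ε)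
    (by linarith) hL hD hC₀0 hKc hρ₁ (by rw [hR]; linarith) ?_ (by rw [hR]; linarith) ?_ ?_
    (fun k hk m => hct k hk m ε hε) n
  · refine main.trans ?_
    have := rSeq_le_zetaR hb n
    calc _ ≤ D * (R ^ n * n.factorial) * Real.exp (zetaR b * (σ₁ / ‖ε‖ * ‖τ‖ + X)) := by
          have : 0 ≤ R := by rw [hR]; linarith
          gcongr
      _ = _ := by ring
  · calc (2 : ℝ) = ρ₁ * (2 / ρ₁) := by field_simp
      _ ≤ ρ₁ * R := by
        refine mul_le_mul_of_nonneg_left ?_ hρ₁.le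
        rw [hR]; linarith
  · intro j hj
    rw [rSeq_zero, one_mul]
    exact hw j hj
  · intro k hk N hN
    refine (norm_qCoef_le (hcond k hk) hσ₁ hX hC₁ hcP hP (hexp k hk) hN).trans ?_
    gcongr
    exact Finset.single_le_sum (f := fun k : ℕ × ℕ × ℕ => k.1.factorial / σ₁ ^ k.1 * C₁ / cP)
      (fun k _ => by positivity) hk

/-! ### Deformation of paths -/

/-- The bound `C |τ| exp(κ |τ| / |ε| + ς exp(ς₃ |τ|))`. -/
def expBd (C κ ς ς₃ : ℝ) (τ ε : ℂ) : ℝ :=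
  C * (‖τ‖ * Real.exp (κ / ‖ε‖ * ‖τ‖ + ς * Real.exp (ς₃ * ‖τ‖)))

lemma continuousOn_expBd (C κ ς ς₃ ε₀ : ℝ) :
    ContinuousOn (fun q : ℂ × ℂ => expBd C κ ς ς₃ q.1 q.2) (univ ×ˢ pdisc ε₀) := by
  unfold expBd
  have : ContinuousOn (fun q : ℂ × ℂ => κ / ‖q.2‖) (univ ×ˢ pdisc ε₀) :=
    continuousOn_const.div (by fun_prop)
      fun q hq => norm_ne_zero_iff.2 (ne_zero_of_mem_pdisc hq.2)
  fun_prop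

variable {S : ℕ} {P : Polynomial ℂ} {𝒜 : Finset (ℕ × ℕ × ℕ)}
  {c : ℕ × ℕ × ℕ → ℂ → ℂ → ℂ} {ct : ℕ × ℕ × ℕ → ℕ → ℂ → ℂ} {w w₁ w₂ : ℕ → ℂ → ℂ → ℂ}
  {ε₀ R β : ℝ} {K U K₁ U₁ K₂ U₂ : Set ℂ} {Bd Bd₁ Bd₂ : ℂ → ℂ → ℝ} {A d A₁ d₁ A₂ d₂ : ℂ}
  {κ C C₁ C₂ ς ς₃ : ℝ}

lemma BorelProblem.norm_borelSol_zero_le (h : BorelProblem S P 𝒜 c ct w ε₀ R β K U Bd)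
    {τ z ε : ℂ} (hτ : τ ∈ K) (hz : z ∈ Metric.ball 0 β) (hε : ε ∈ pdisc ε₀) :
    ‖borelSol S P 𝒜 ct w 0 τ z ε‖ ≤ Bd τ ε * 2 := by
  simpa using h.norm_borelSol_le 0 hz (h.bd τ hτ ε hε)

lemma norm_lapKernel_le (hC : 0 ≤ C)
    (h : BorelProblem S P 𝒜 c ct w ε₀ R β K U (expBd C κ ς ς₃))
    {u y z ε : ℂ} (hu : u ∈ K) (hz : z ∈ Metric.ball 0 β) (hε : ε ∈ pdisc ε₀) :
    ‖lapKernel (fun τ => borelSol S P 𝒜 ct w 0 τ z ε) y⁻¹ u‖ ≤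
      2 * C * Real.exp (κ / ‖ε‖ * ‖u‖ + ς * Real.exp (ς₃ * ‖u‖) - (u * y).re) := by
  rcases eq_or_ne u 0 with rfl | h0
  · rw [lapKernel, div_zero, norm_zero]; positivity
  · have hu0 : 0 < ‖u‖ := norm_pos_iff.2 h0
    have hb := h.norm_borelSol_zero_le hu hz hε
    rw [norm_lapKernel, div_le_iff₀ hu0]
    calc _ ≤ expBd C κ ς ς₃ u ε * 2 * Real.exp (-(u * y).re) := by gcongr
      _ = _ := by rw [expBd, sub_eq_add_neg, Real.exp_add _ (-(u * y).re)]; ring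

/-- The pole of 1/u has to lie on the boundary of V or nowhere in its interior, whence `h0'`;
boundedness near 0 comes from the factor ‖τ‖ in `expBd`. -/
lemma isHolConvex_lapKernel (hC : 0 ≤ C) (hκ : 0 ≤ κ) (hς : 0 ≤ ς) (hς₃ : 0 ≤ ς₃)
    (h : BorelProblem S P 𝒜 c ct w ε₀ R β K U (expBd C κ ς ς₃)) {V : Set ℂ} (hV : Convex ℝ V)
    (hVn : (interior V).Nonempty) (hVK : V ⊆ K) (hVU : interior V ⊆ U) (h0 : (0 : ℂ) ∈ V)
    (h0' : (0 : ℂ) ∉ interior V) {y z ε : ℂ} (hz : z ∈ Metric.ball 0 β) (hε : ε ∈ pdisc ε₀) :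
    IsHolConvex (lapKernel (fun τ => borelSol S P 𝒜 ct w 0 τ z ε) y⁻¹) V := by
  refine ⟨hV, hVn, h0, ?_, ?_, fun r => ⟨2 * C * Real.exp (κ / ‖ε‖ * r +
    ς * Real.exp (ς₃ * r) + r * ‖y‖), fun u hu hur => ?_⟩⟩
  · have h1 : DifferentiableOn ℂ (fun τ => borelSol S P 𝒜 ct w 0 τ z ε) (interior V) :=
      (h.differentiableOn_borelSol 0).comp (f := fun τ : ℂ => (τ, z, ε)) (by fun_prop)
        fun τ hτ => ⟨hVU hτ, hz, hε⟩
    have h2 : DifferentiableOn ℂ (fun u : ℂ => u⁻¹) (interior V) :=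
      DifferentiableOn.fun_inv (by fun_prop) fun u hu h => h0' (h ▸ hu)
    unfold lapKernel
    simp only [div_inv_eq_mul]
    simp only [div_eq_mul_inv]
    fun_prop
  · have h1 : ContinuousOn (fun τ => borelSol S P 𝒜 ct w 0 τ z ε) (V \ {0}) :=
      (h.continuousOn_borelSol 0).comp (f := fun τ : ℂ => (τ, z, ε)) (by fun_prop)
        fun τ hτ => ⟨hVK hτ.1, hz, hε⟩
    have h2 : ContinuousOn (fun u : ℂ => u⁻¹) (V \ {0}) :=
      continuousOn_id.inv₀ fun u hu => hu.2
    unfold lapKernel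
    simp only [div_inv_eq_mul]
    simp only [div_eq_mul_inv]
    fun_prop
  · refine (norm_lapKernel_le hC h (hVK hu) hz hε).trans ?_
    have h1 : -(u * y).re ≤ r * ‖y‖ := by
      refine (neg_le_abs _).trans ((Complex.abs_re_le_norm _).trans ?_)
      rw [norm_mul]; gcongr
    rw [sub_eq_add_neg]
    gcongr

/-- Two Laplace transforms along paths that can be deformed into each other inside `V`, up to
the parameter value `l`, are exponentially close. -/
theorem norm_pathLap_sub_le (hκ : 0 ≤ κ) (hς : 0 ≤ ς) (hς₃ : 0 ≤ ς₃)
    (h : BorelProblem S P 𝒜 c ct w ε₀ R β K U (expBd C κ ς ς₃))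
    (h₁ : BorelProblem S P 𝒜 c ct w₁ ε₀ R β K₁ U₁ Bd₁)
    (h₂ : BorelProblem S P 𝒜 c ct w₂ ε₀ R β K₂ U₂ Bd₂)
    (p₁ : BorelPath S P 𝒜 ct w₁ ε₀ R K₁ A₁ d₁ κ C) (p₂ : BorelPath S P 𝒜 ct w₂ ε₀ R K₂ A₂ d₂ κ C)
    {V : Set ℂ} {y z ε : ℂ} (hz : z ∈ Metric.ball 0 β) (hε : ε ∈ pdisc ε₀) (hVK : V ⊆ K)
    (hV : IsHolConvex (lapKernel (fun τ => borelSol S P 𝒜 ct w 0 τ z ε) y⁻¹) V)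
    {l D a a' θ : ℝ} (hl : 0 < l) (hθ : 0 < θ) (ha : 0 < a) (ha1 : a ≤ 1) (ha' : 1 ≤ a')
    (hD : κ * a' + 2 * θ ≤ D * a)
    (hV₁ : ∀ s ∈ Icc 0 l, bPath A₁ d₁ s ∈ V) (hV₂ : ∀ s ∈ Icc 0 l, bPath A₂ d₂ s ∈ V)
    (hw₁ : ∀ s ∈ Ioc 0 l, borelSol S P 𝒜 ct w₁ 0 (bPath A₁ d₁ s) z ε =
      borelSol S P 𝒜 ct w 0 (bPath A₁ d₁ s) z ε)
    (hw₂ : ∀ s ∈ Ioc 0 l, borelSol S P 𝒜 ct w₂ 0 (bPath A₂ d₂ s) z ε =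
      borelSol S P 𝒜 ct w 0 (bPath A₂ d₂ s) z ε)
    (hA₁ : a ≤ ‖A₁‖) (hA₁' : ‖A₁‖ ≤ a') (hA₂ : a ≤ ‖A₂‖) (hA₂' : ‖A₂‖ ≤ a')
    (hAy₁ : D / ‖ε‖ * ‖A₁‖ ≤ (A₁ * y).re) (hdy₁ : D / ‖ε‖ ≤ (d₁ * y).re)
    (hAy₂ : D / ‖ε‖ * ‖A₂‖ ≤ (A₂ * y).re) (hdy₂ : D / ‖ε‖ ≤ (d₂ * y).re) :
    ‖pathLap A₁ d₁ (fun τ => borelSol S P 𝒜 ct w₁ 0 τ z ε) y -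
      pathLap A₂ d₂ (fun τ => borelSol S P 𝒜 ct w₂ 0 τ z ε) y‖ ≤
      8 * C * (a' + 1) * (ε₀ / θ) *
        Real.exp (-(θ * l / ‖ε‖) + ς * Real.exp (ς₃ * (a' * l))) := by
  have hC := p₁.C_nonneg
  have hε0 := ne_zero_of_mem_pdisc hε
  have hεp : 0 < ‖ε‖ := norm_pos_iff.2 hε0
  have hεε₀ : ‖ε‖ ≤ ε₀ := (mem_ball_zero_iff.1 hε.1).le
  have hD0 : κ + θ / a ≤ D := by
    have : κ * a + θ ≤ D * a := by nlinarith
    calc κ + θ / a = (κ * a + θ) / a := by field_simp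
      _ ≤ D * a / a := by gcongr
      _ = D := by field_simp
  have hDpos : 0 ≤ D := le_trans (by positivity) hD0
  have hκD : κ < D := lt_of_lt_of_le (by linarith [div_pos hθ ha]) hD0
  have hy : ∀ {d : ℂ}, D / ‖ε‖ ≤ (d * y).re → κ / ‖ε‖ < (d * y).re := fun hd =>
    lt_of_lt_of_le (by gcongr) hd
  have hi₁ := p₁.integrableOn h₁ 0 0 hz hε (hy hdy₁)
  have hi₂ := p₂.integrableOn h₂ 0 0 hz hε (hy hdy₂)
  simp only [pow_zero, mul_one] at hi₁ hi₂
  have hcone₁ := fun s (hs : 0 ≤ s) => cone_bound p₁.norm_d hε0 ha ha1 hA₁ hκ hθ.le hD0 hAy₁ hdy₁ hs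
  have hcone₂ := fun s (hs : 0 ≤ s) => cone_bound p₂.norm_d hε0 ha ha1 hA₂ hκ hθ.le hD0 hAy₂ hdy₂ hs
  -- the point reached by each path
  have hpt : ∀ {A d : ℂ}, ‖d‖ = 1 → a ≤ ‖A‖ → ‖A‖ ≤ a' → D / ‖ε‖ * ‖A‖ ≤ (A * y).re →
      D / ‖ε‖ ≤ (d * y).re → ‖bPath A d l‖ ≤ a' * l ∧ D / ‖ε‖ * (a * l) ≤ (bPath A d l * y).re := by
    intro A d hd hA hA' hAy hdy
    obtain ⟨e1, e2⟩ := norm_bPath_le_and_le_re hd hAy hdy hl.le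
    have hl1 : min l 1 * ‖A‖ + max (l - 1) 0 ≤ a' * l := by
      rcases le_total l 1 with h | h
      · rw [min_eq_left h, max_eq_right (by linarith)]; nlinarith
      · rw [min_eq_right h, max_eq_left (by linarith)]; nlinarith
    have hl2 : a * l ≤ min l 1 * ‖A‖ + max (l - 1) 0 := by
      rcases le_total l 1 with h | h
      · rw [min_eq_left h, max_eq_right (by linarith)]; nlinarith
      · rw [min_eq_right h, max_eq_left (by linarith)]; nlinarith
    exact ⟨e1.trans hl1, le_trans (by gcongr) e2⟩
  obtain ⟨n₁, r₁⟩ := hpt p₁.norm_d hA₁ hA₁' hAy₁ hdy₁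
  obtain ⟨n₂, r₂⟩ := hpt p₂.norm_d hA₂ hA₂' hAy₂ hdy₂
  set E := Real.exp (ς * Real.exp (ς₃ * (a' * l))) with hE
  have hE1 : 1 ≤ E := Real.one_le_exp (by positivity)
  -- A half-plane and a disc are convex: both ends satisfy Re(uy) ≥ D a l/‖ε‖ and ‖u‖ ≤ a'l, hence
  -- so does the segment. By κa' + 2θ ≤ Da the decay 2θl/‖ε‖ is left over.
  have hseg : ∀ u ∈ segment ℝ (bPath A₂ d₂ l) (bPath A₁ d₁ l),
      ‖lapKernel (fun τ => borelSol S P 𝒜 ct w 0 τ z ε) y⁻¹ u‖ ≤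
        2 * C * (E * Real.exp (-(2 * θ * l / ‖ε‖))) := by
    intro u hu
    have huV : u ∈ V := hV.convex.segment_subset (hV₂ l ⟨hl.le, le_rfl⟩) (hV₁ l ⟨hl.le, le_rfl⟩) hu
    have hun : ‖u‖ ≤ a' * l := by
      have := (convex_closedBall (0 : ℂ) (a' * l)).segment_subset
        (by simpa using n₂) (by simpa using n₁) hu
      simpa using this
    have hur : D / ‖ε‖ * (a * l) ≤ (u * y).re := by
      have hcv : Convex ℝ {v : ℂ | D / ‖ε‖ * (a * l) ≤ (v * y).re} :=
        convex_halfSpace_ge (IsLinearMap.mk (fun v w => by rw [add_mul, Complex.add_re])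
          fun r v => by rw [Complex.real_smul, mul_assoc, Complex.re_ofReal_mul, smul_eq_mul]) _
      exact hcv.segment_subset r₂ r₁ hu
    refine (norm_lapKernel_le hC h (hVK huV) hz hε).trans ?_
    rw [hE, ← Real.exp_add]
    refine mul_le_mul_of_nonneg_left (Real.exp_le_exp.2 ?_) (by positivity)
    have e1 : κ / ‖ε‖ * ‖u‖ ≤ κ / ‖ε‖ * (a' * l) := by gcongr
    have e2 : ς * Real.exp (ς₃ * ‖u‖) ≤ ς * Real.exp (ς₃ * (a' * l)) := by gcongr
    have e3 : κ / ‖ε‖ * (a' * l) + 2 * θ * l / ‖ε‖ ≤ D / ‖ε‖ * (a * l) := by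
      have : (κ * a' + 2 * θ) * (l / ‖ε‖) ≤ D * a * (l / ‖ε‖) := by gcongr
      calc _ = (κ * a' + 2 * θ) * (l / ‖ε‖) := by ring
        _ ≤ _ := this
        _ = _ := by ring
    linarith
  have hB : ∀ {A : ℂ}, ‖A‖ ≤ a' → C * 2 * (‖A‖ + 1) ≤ C * 2 * (a' + 1) := fun hA => by gcongr
  have main := norm_integral_bPath_sub_le hV hl (div_pos hθ hεp) hi₁ hi₂ hV₁ hV₂
    (fun s hs => by simp only [lapKernel, hw₁ s hs]) (fun s hs => by simp only [lapKernel, hw₂ s hs])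
    (B := C * 2 * (a' + 1))
    (fun s hs => (p₁.norm_kernel_le_of_cone h₁ hz hε (hl.trans hs)
      (hcone₁ s (hl.trans hs).le)).trans (by gcongr))
    (fun s hs => (p₂.norm_kernel_le_of_cone h₂ hz hε (hl.trans hs)
      (hcone₂ s (hl.trans hs).le)).trans (by gcongr)) hseg
  refine main.trans ?_
  -- One of the two factors e^{-θl/‖ε‖} is spent on the length of the segment, so the constant does
  -- not depend on l.
  have hx : l * Real.exp (-(2 * θ * l / ‖ε‖)) ≤ ‖ε‖ / θ * Real.exp (-(θ * l / ‖ε‖)) := by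
    have h1 : θ * l / ‖ε‖ ≤ Real.exp (θ * l / ‖ε‖) :=
      (by linarith [Real.add_one_le_exp (θ * l / ‖ε‖)])
    have e1 : Real.exp (-(2 * θ * l / ‖ε‖)) =
        Real.exp (-(θ * l / ‖ε‖)) * Real.exp (-(θ * l / ‖ε‖)) := by
      rw [← Real.exp_add]; congr 1; ring
    have e2 : l = ‖ε‖ / θ * (θ * l / ‖ε‖) := by field_simp
    have e3 : Real.exp (θ * l / ‖ε‖) * Real.exp (-(θ * l / ‖ε‖)) = 1 := by
      rw [← Real.exp_add, add_neg_cancel, Real.exp_zero]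
    calc l * Real.exp (-(2 * θ * l / ‖ε‖)) = ‖ε‖ / θ * (θ * l / ‖ε‖) *
          (Real.exp (-(θ * l / ‖ε‖)) * Real.exp (-(θ * l / ‖ε‖))) := by rw [e1, ← e2]
      _ ≤ ‖ε‖ / θ * Real.exp (θ * l / ‖ε‖) *
          (Real.exp (-(θ * l / ‖ε‖)) * Real.exp (-(θ * l / ‖ε‖))) := by gcongr
      _ = ‖ε‖ / θ * ((Real.exp (θ * l / ‖ε‖) * Real.exp (-(θ * l / ‖ε‖))) *
          Real.exp (-(θ * l / ‖ε‖))) := by ring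
      _ = _ := by rw [e3, one_mul]
  have hdist : ‖bPath A₁ d₁ l - bPath A₂ d₂ l‖ ≤ 2 * (a' * l) :=
    (norm_sub_le _ _).trans (by linarith)
  set X := Real.exp (-(θ * l / ‖ε‖)) with hX
  have hX0 : 0 < X := Real.exp_pos _
  have e4 : Real.exp (-(θ / ‖ε‖ * l)) / (θ / ‖ε‖) = ‖ε‖ / θ * X := by
    rw [hX, div_mul_eq_mul_div θ]; field_simp
  rw [e4, Real.exp_add, ← hX, ← hE]
  have hεθ : 0 ≤ ε₀ / θ := div_nonneg ((norm_nonneg _).trans hεε₀) hθ.le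
  have t1 : ‖ε‖ / θ * X ≤ ε₀ / θ * (X * E) := by
    refine mul_le_mul (by gcongr) ?_ hX0.le hεθ
    exact le_mul_of_one_le_right hX0.le hE1
  have t2 : 2 * C * (E * Real.exp (-(2 * θ * l / ‖ε‖))) * ‖bPath A₁ d₁ l - bPath A₂ d₂ l‖ ≤
      4 * C * a' * (ε₀ / θ * (X * E)) := by
    calc _ ≤ 2 * C * (E * Real.exp (-(2 * θ * l / ‖ε‖))) * (2 * (a' * l)) := by gcongr
      _ = 4 * C * a' * (E * (l * Real.exp (-(2 * θ * l / ‖ε‖)))) := by ring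
      _ ≤ 4 * C * a' * (E * (‖ε‖ / θ * X)) := by gcongr
      _ ≤ 4 * C * a' * (E * (ε₀ / θ * X)) := by gcongr
      _ = _ := by ring
  have t3 : 2 * (C * 2 * (a' + 1) * (‖ε‖ / θ * X)) ≤ 4 * C * (a' + 1) * (ε₀ / θ * (X * E)) := by
    calc _ = 4 * C * (a' + 1) * (‖ε‖ / θ * X) := by ring
      _ ≤ _ := by gcongr
  have t4 : 4 * C * a' * (ε₀ / θ * (X * E)) ≤ 4 * C * (a' + 1) * (ε₀ / θ * (X * E)) := by
    refine mul_le_mul_of_nonneg_right ?_ (mul_nonneg hεθ (mul_nonneg hX0.le (by positivity)))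
    gcongr; linarith
  calc _ ≤ 4 * C * (a' + 1) * (ε₀ / θ * (X * E)) + 4 * C * (a' + 1) * (ε₀ / θ * (X * E)) :=
        add_le_add t3 (t2.trans t4)
    _ = _ := by ring

end SPCP

end

/-! ### Geometry of strips and sectors; pointwise content of the norms -/

open scoped ENNReal Topology

noncomputable section

namespace SPCP

open MeasureTheory Set Filter

/-! ### Strips -/

lemma strip_eq (a b : ℝ) : strip a b = Iic 0 ×ℂ Icc a b := by
  ext z
  simp only [strip, mem_ofPred_eq, Complex.mem_reProdIm, mem_Iic, mem_Icc]
  tauto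

lemma convex_strip (a b : ℝ) : Convex ℝ (strip a b) := by
  rw [strip_eq]
  exact ((convex_Iic (0 : ℝ)).linear_preimage Complex.reLm).inter
    ((convex_Icc a b).linear_preimage Complex.imLm)

lemma interior_strip (a b : ℝ) : interior (strip a b) = Iio 0 ×ℂ Ioo a b := by
  rw [strip_eq, Complex.interior_reProdIm, interior_Iic, interior_Icc]

lemma closure_interior_strip {a b : ℝ} (h : a < b) : closure (interior (strip a b)) = strip a b := by
  rw [interior_strip, Complex.closure_reProdIm, closure_Iio, closure_Ioo h.ne, strip_eq]

lemma zero_notMem_interior_strip (a b : ℝ) : (0 : ℂ) ∉ interior (strip a b) := by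
  rw [interior_strip]
  exact fun h => lt_irrefl (0 : ℝ) h.1

lemma nonempty_interior_strip {a b : ℝ} (h : a < b) : (interior (strip a b)).Nonempty := by
  rw [interior_strip]
  obtain ⟨x, hx⟩ := nonempty_Ioo.2 h
  exact ⟨⟨-1, x⟩, by constructor <;> simp [hx.1, hx.2]⟩

lemma strip_subset_strip {a b a' b' : ℝ} (ha : a' ≤ a) (hb : b ≤ b') : strip a b ⊆ strip a' b' :=
  fun _ hz => ⟨ha.trans hz.1, hz.2.1.trans hb, hz.2.2⟩

namespace IsStripSystem

variable {n : ℕ} {a b c d : ℤ → ℝ}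

lemma le_c (h : IsStripSystem n a b c d) (k : ℤ) (hk : -(n : ℤ) ≤ k) (hkn : k ≤ n) :
    c (-n) ≤ c k := by
  induction k, hk using Int.leInduction with
  | base => exact le_rfl
  | succ k hk ih =>
    have hk' : k < n := by omega
    have h1 := h.overlap k hk hk'.le
    have h2 := h.disjoint_J k hk hk'
    linarith [ih hk'.le]

lemma b_le (h : IsStripSystem n a b c d) (k : ℤ) (hk : -(n : ℤ) ≤ k) (hkn : k ≤ n) :
    b k ≤ b n := by
  induction k, hkn using Int.leInductionDown with
  | base => exact le_rfl
  | pred k hkn ih =>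
    have hk' : -(n : ℤ) ≤ k := by omega
    have h1 := h.disjoint_H (k - 1) hk (by omega)
    rw [sub_add_cancel] at h1
    have h2 := h.lt_H k hk' hkn
    linarith [ih hk']

lemma d_le (h : IsStripSystem n a b c d) (k : ℤ) (hk : -(n : ℤ) ≤ k) (hkn : k ≤ n) :
    d k ≤ b n := by
  rcases hkn.lt_or_eq with hlt | rfl
  · have h1 := h.disjoint_J k hk hlt
    have h2 := (h.overlap_succ k hk hlt).1
    linarith [h.b_le k hk hkn]
  · exact h.last.le

lemma strip_H_subset (h : IsStripSystem n a b c d) {k : ℤ} (hk : -(n : ℤ) ≤ k) (hkn : k ≤ n) :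
    strip (a k) (b k) ⊆ strip (c (-n)) (b n) :=
  strip_subset_strip ((h.le_c k hk hkn).trans (h.overlap k hk hkn).1.le) (h.b_le k hk hkn)

lemma strip_J_subset (h : IsStripSystem n a b c d) {k : ℤ} (hk : -(n : ℤ) ≤ k) (hkn : k ≤ n) :
    strip (c k) (d k) ⊆ strip (c (-n)) (b n) :=
  strip_subset_strip (h.le_c k hk hkn) (h.d_le k hk hkn)

/-- The overlaps leave no gap between consecutive strips; the induction climbs through the levels `b
m`. -/
lemma exists_mem (h : IsStripSystem n a b c d) {z : ℂ} (hz : z ∈ strip (c (-n)) (b n)) :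
    ∃ k : ℤ, -(n : ℤ) ≤ k ∧ k ≤ n ∧ (z ∈ strip (a k) (b k) ∨ z ∈ strip (c k) (d k)) := by
  have key : ∀ m : ℤ, -(n : ℤ) ≤ m → m ≤ n → z.im ≤ b m →
      ∃ k : ℤ, -(n : ℤ) ≤ k ∧ k ≤ n ∧ (z ∈ strip (a k) (b k) ∨ z ∈ strip (c k) (d k)) := by
    intro m hm
    induction m, hm using Int.leInduction with
    | base =>
      intro hmn hzm
      rcases le_total (a (-n)) z.im with h1 | h1
      · exact ⟨-n, le_rfl, hmn, Or.inl ⟨h1, hzm, hz.2.2⟩⟩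
      · exact ⟨-n, le_rfl, hmn, Or.inr ⟨hz.1, h1.trans (h.overlap _ le_rfl hmn).2.le, hz.2.2⟩⟩
    | succ m hm ih =>
      intro hmn hzm
      have hm' : m < n := by omega
      rcases le_total z.im (b m) with h1 | h1
      · exact ih hm'.le h1
      have h2 := h.overlap_succ m hm hm'
      rcases le_total (a (m + 1)) z.im with h3 | h3
      · exact ⟨m + 1, by omega, hmn, Or.inl ⟨h3, hzm, hz.2.2⟩⟩
      · exact ⟨m + 1, by omega, hmn, Or.inr ⟨by linarith,
          h3.trans (h.overlap _ (by omega) hmn).2.le, hz.2.2⟩⟩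
  exact key n (by omega) le_rfl hz.2.1

lemma c_lt_b (h : IsStripSystem n a b c d) : c (-n) < b n := by
  have h1 := h.overlap n (by omega) le_rfl
  linarith [h.le_c n (by omega) le_rfl, h.last]

lemma zero_mem_strip (h : IsStripSystem n a b c d) : (0 : ℂ) ∈ strip (c 0) (d 0) :=
  ⟨h.zero_mem.1.le, h.zero_mem.2.le, le_rfl⟩

lemma zero_mem_closure (h : IsStripSystem n a b c d) :
    (0 : ℂ) ∈ closure (strip (c 0) (d 0) \ {0}) := by
  have h1 : (0 : ℂ) ∈ closure (interior (strip (c 0) (d 0))) := by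
    rw [closure_interior_strip (h.zero_mem.1.trans h.zero_mem.2)]
    exact h.zero_mem_strip
  have h2 : interior (strip (c 0) (d 0)) ⊆ strip (c 0) (d 0) \ {0} := fun z hz =>
    ⟨interior_subset hz, fun h0 => zero_notMem_interior_strip _ _ ((mem_singleton_iff.1 h0) ▸ hz)⟩
  exact closure_mono h2 h1

end IsStripSystem

/-! ### Sectors -/

lemma smul_mem_unbSector {α θ s : ℝ} (hs : 0 < s) {z : ℂ} (hz : z ∈ unbSector α θ) :
    (s : ℂ) * z ∈ unbSector α θ := by
  refine ⟨mul_ne_zero (by exact_mod_cast hs.ne') hz.1, ?_⟩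
  rw [mul_assoc, Complex.arg_real_mul _ hs]
  exact hz.2

lemma exp_mem_unbSector {α θ φ : ℝ} (hφ : |φ| < θ) (hπ : |φ| < Real.pi) :
    Complex.exp ((α + φ : ℝ) * Complex.I) ∈ unbSector α θ := by
  refine ⟨Complex.exp_ne_zero _, ?_⟩
  rw [← Complex.exp_add]
  have : ((α + φ : ℝ) : ℂ) * Complex.I + -(α : ℂ) * Complex.I = φ * Complex.I := by
    push_cast; ring
  rw [this, Complex.arg_exp_mul_I, (toIocMod_eq_self _).2]
  · exact hφ
  · have := abs_lt.1 hπ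
    constructor <;> linarith

lemma unbSector_nonempty {α θ : ℝ} (hθ : 0 < θ) : (unbSector α θ).Nonempty :=
  ⟨_, exp_mem_unbSector (φ := 0) (by simpa using hθ) (by simpa using Real.pi_pos)⟩

/-- A wider sector would contain both directions α ± π/2, whose real parts are opposite. The bound
on the aperture gives convexity of the sector, needed for the deformation of rays. -/
lemma le_pi_div_two_of_unbSector_subset {α θ : ℝ} (h : unbSector α θ ⊆ {z | 0 < z.re}) :
    θ ≤ Real.pi / 2 := by
  by_contra! hθ
  have hπ := Real.pi_pos
  have h1 := h (exp_mem_unbSector (α := α) (φ := Real.pi / 2)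
    (by rwa [abs_of_pos (by positivity)]) (by rw [abs_of_pos (by positivity)]; linarith))
  have h2 := h (exp_mem_unbSector (α := α) (φ := -(Real.pi / 2))
    (by rwa [abs_neg, abs_of_pos (by positivity)])
    (by rw [abs_neg, abs_of_pos (by positivity)]; linarith))
  simp only [mem_ofPred_eq, Complex.exp_ofReal_mul_I_re] at h1 h2
  rw [Real.cos_add_pi_div_two] at h1
  rw [← sub_eq_add_neg, Real.cos_sub_pi_div_two] at h2
  linarith

lemma re_mul_exp (w : ℂ) (φ : ℝ) :
    (w * Complex.exp (φ * Complex.I)).re = ‖w‖ * Real.cos (w.arg + φ) := by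
  conv_lhs => rw [← Complex.norm_mul_exp_arg_mul_I w]
  rw [mul_assoc, ← Complex.exp_add, ← add_mul, ← Complex.ofReal_add, Complex.re_ofReal_mul,
    Complex.exp_ofReal_mul_I_re]

/-- A sector of aperture at most π is an intersection of two open half-planes, hence open and
convex. -/
lemma unbSector_eq {α θ : ℝ} (hθ : 0 < θ) (hθ' : θ ≤ Real.pi / 2) :
    unbSector α θ = {z | 0 < (Complex.exp (-(α : ℂ) * Complex.I) *
      Complex.exp ((Real.pi / 2 - θ : ℝ) * Complex.I) * z).re} ∩
      {z | 0 < (Complex.exp (-(α : ℂ) * Complex.I) *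
      Complex.exp ((-(Real.pi / 2 - θ) : ℝ) * Complex.I) * z).re} := by
  ext z
  simp only [unbSector, mem_ofPred_eq, mem_inter_iff]
  set φ := Real.pi / 2 - θ with hφ
  set w := z * Complex.exp (-(α : ℂ) * Complex.I) with hw
  have e1 : ∀ x : ℂ, Complex.exp (-(α : ℂ) * Complex.I) * x * z = w * x := fun x => by rw [hw]; ring
  rw [e1, e1, re_mul_exp, re_mul_exp]
  have hz : z ≠ 0 ↔ 0 < ‖w‖ := by
    rw [norm_pos_iff, hw, mul_ne_zero_iff]
    exact (and_iff_left (Complex.exp_ne_zero _)).symm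
  rw [hz]
  constructor
  · rintro ⟨h0, h1⟩
    have h2 := abs_lt.1 h1
    constructor
    · exact mul_pos h0 (Real.cos_pos_of_mem_Ioo ⟨by linarith, by linarith⟩)
    · exact mul_pos h0 (Real.cos_pos_of_mem_Ioo ⟨by linarith, by linarith⟩)
  · rintro ⟨h1, h2⟩
    have h0 : 0 < ‖w‖ := by
      rcases (norm_nonneg w).eq_or_lt with h | h
      · rw [← h, zero_mul] at h1; exact absurd h1 (lt_irrefl _)
      · exact h
    refine ⟨h0, ?_⟩
    have c1 := (pos_iff_pos_of_mul_pos h1).1 h0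
    have c2 := (pos_iff_pos_of_mul_pos h2).1 h0
    have hφ0 : 0 < Real.cos φ := Real.cos_pos_of_mem_Ioo ⟨by linarith, by linarith⟩
    have hc : 0 < Real.cos w.arg := by
      rw [Real.cos_add] at c1 c2
      rw [Real.cos_neg, Real.sin_neg] at c2
      have : 0 < Real.cos w.arg * Real.cos φ := by linarith
      exact (pos_iff_pos_of_mul_pos this).2 hφ0
    have hre : 0 < w.re := by
      rw [← Complex.norm_mul_cos_arg]; exact mul_pos h0 hc
    have harg := abs_lt.1 (Complex.abs_arg_lt_pi_div_two_iff.2 (Or.inl hre))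
    rw [abs_lt]
    constructor
    · by_contra! hcon
      refine absurd c2 (not_lt.2 ?_)
      rw [← Real.cos_neg]
      exact Real.cos_nonpos_of_pi_div_two_le_of_le (by linarith) (by linarith)
    · by_contra! hcon
      refine absurd c1 (not_lt.2 ?_)
      exact Real.cos_nonpos_of_pi_div_two_le_of_le (by linarith) (by linarith)

lemma convex_re_mul_pos (c : ℂ) : Convex ℝ {z : ℂ | 0 < (c * z).re} :=
  convex_halfSpace_gt (IsLinearMap.mk (fun v w => by rw [mul_add, Complex.add_re])
    fun r v => by rw [Complex.real_smul, mul_left_comm, Complex.re_ofReal_mul, smul_eq_mul]) _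

lemma convex_unbSector {α θ : ℝ} (hθ : 0 < θ) (hθ' : θ ≤ Real.pi / 2) :
    Convex ℝ (unbSector α θ) := by
  rw [unbSector_eq hθ hθ']
  exact (convex_re_mul_pos _).inter (convex_re_mul_pos _)

lemma isOpen_unbSector {α θ : ℝ} (hθ : 0 < θ) (hθ' : θ ≤ Real.pi / 2) :
    IsOpen (unbSector α θ) := by
  rw [unbSector_eq hθ hθ']
  exact (isOpen_lt continuous_const (by fun_prop)).inter (isOpen_lt continuous_const (by fun_prop))

lemma zero_mem_closure_unbSector {α θ : ℝ} (hθ : 0 < θ) : (0 : ℂ) ∈ closure (unbSector α θ) := by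
  obtain ⟨z, hz⟩ := unbSector_nonempty (α := α) hθ
  have ht : Tendsto (fun n : ℕ => ((1 / ((n : ℝ) + 1) : ℝ) : ℂ) * z) atTop (𝓝 0) := by
    have := (Complex.continuous_ofReal.tendsto 0).comp tendsto_one_div_add_atTop_nhds_zero_nat
    simpa using this.mul_const z
  exact mem_closure_of_tendsto ht (Eventually.of_forall fun n =>
    smul_mem_unbSector (by positivity) hz)

lemma interior_closure_unbSector {α θ : ℝ} (hθ : 0 < θ) (hθ' : θ ≤ Real.pi / 2) :
    interior (closure (unbSector α θ)) = unbSector α θ := by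
  have ho := isOpen_unbSector (α := α) hθ hθ'
  rw [(convex_unbSector hθ hθ').interior_closure_eq_interior_of_nonempty_interior
    (by rw [ho.interior_eq]; exact unbSector_nonempty hθ), ho.interior_eq]

lemma re_nonneg_of_mem_closure {T : Set ℂ} (h : T ⊆ {z | 0 < z.re}) {z : ℂ} (hz : z ∈ closure T) :
    0 ≤ z.re := by
  have : closure T ⊆ {z | 0 ≤ z.re} := closure_minimal (fun z hz => (show 0 < z.re from h hz).le)
    (isClosed_le continuous_const Complex.continuous_re)
  exact this hz

/-! ### From norms to pointwise bounds -/

/-- The term of index 0 in the sum attached to h = j has weight δ⁰/0! = 1. -/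
lemma SmallData.norm_le {S : ℕ} {δ I : ℝ} {N : ℕ → ℝ≥0∞} (h : SmallData S δ I N) {j : ℕ}
    (hj : j < S) : N j ≤ ENNReal.ofReal I := by
  refine le_trans ?_ (h j hj)
  have := Finset.single_le_sum (f := fun i => N (i + j) *
    ENNReal.ofReal (δ ^ i / (i.factorial : ℝ))) (fun _ _ => zero_le)
    (Finset.mem_range.2 (Nat.sub_pos_of_lt hj))
  simpa using this

lemma norm_le_of_weighted_le {x t e : ℝ} (ht : 0 < t)
    (h : ENNReal.ofReal (x / t * Real.exp e) ≤ ENNReal.ofReal 1) : x ≤ t * Real.exp (-e) := by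
  have h1 := (ENNReal.ofReal_le_ofReal_iff zero_le_one).1 h
  rw [div_mul_eq_mul_div, div_le_iff₀ ht, one_mul] at h1
  rw [Real.exp_neg, ← div_eq_mul_inv, le_div_iff₀ (Real.exp_pos _)]
  exact h1

lemma norm_le_of_sedNorm_le {b M σ₁ σ₂ σ₃ : ℝ} {H : Set ℂ} {ε : ℂ} {v : ℂ → ℂ}
    (h : sedNorm b M 0 σ₁ σ₂ σ₃ H ε v ≤ ENNReal.ofReal 1) (h0 : v 0 = 0) {τ : ℂ} (hτ : τ ∈ H) :
    ‖v τ‖ ≤ ‖τ‖ * Real.exp (σ₁ / ‖ε‖ * ‖τ‖ - σ₂ * (M - 1) * Real.exp (σ₃ * ‖τ‖)) := by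
  rcases eq_or_ne τ 0 with rfl | hτ0
  · simp [h0]
  refine (norm_le_of_weighted_le (norm_pos_iff.2 hτ0) (iSup₂_le_iff.1 h τ hτ)).trans (le_of_eq ?_)
  rw [sSeq, rSeq_zero]
  congr 2; ring

lemma norm_le_of_segNorm_le {b σ₁ ς₂ ς₃ : ℝ} {J : Set ℂ} {ε : ℂ} {v : ℂ → ℂ}
    (h : segNorm b 0 σ₁ ς₂ ς₃ J ε v ≤ ENNReal.ofReal 1) {τ : ℂ} (hτ0 : τ ≠ 0)
    (hτ : τ ∈ J) :
    ‖v τ‖ ≤ ‖τ‖ * Real.exp (σ₁ / ‖ε‖ * ‖τ‖ + ς₂ * Real.exp (ς₃ * ‖τ‖)) := by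
  refine (norm_le_of_weighted_le (norm_pos_iff.2 hτ0) (iSup₂_le_iff.1 h τ hτ)).trans (le_of_eq ?_)
  rw [rSeq_zero]
  congr 2; ring

lemma norm_le_of_egNorm_le {b σ₁ : ℝ} {T : Set ℂ} {ε : ℂ} {v : ℂ → ℂ}
    (h : egNorm b 0 σ₁ T ε v ≤ ENNReal.ofReal 1) {τ : ℂ} (hτ0 : τ ≠ 0) (hτ : τ ∈ T) :
    ‖v τ‖ ≤ ‖τ‖ * Real.exp (σ₁ / ‖ε‖ * ‖τ‖) := by
  refine (norm_le_of_weighted_le (norm_pos_iff.2 hτ0) (iSup₂_le_iff.1 h τ hτ)).trans (le_of_eq ?_)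
  rw [rSeq_zero]
  congr 2; ring

/-- The weighted norms say nothing at τ = 0, where the quotient by ‖τ‖ is 0. Continuity recovers the
value there, and the pointwise bounds extend to τ = 0. -/
lemma eq_zero_of_norm_le {T : Set ℂ} {f : ℂ → ℂ} {g : ℝ → ℝ} (hf : ContinuousOn f T)
    (hg : Continuous g) (h0 : (0 : ℂ) ∈ T) (hcl : (0 : ℂ) ∈ closure (T \ {0}))
    (h : ∀ τ ∈ T, τ ≠ 0 → ‖f τ‖ ≤ ‖τ‖ * g ‖τ‖) : f 0 = 0 := by
  have h1 : ‖f 0‖ ≤ ‖(0 : ℂ)‖ * g ‖(0 : ℂ)‖ :=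
    ContinuousWithinAt.closure_le hcl ((hf 0 h0).norm.mono sdiff_subset)
      (Continuous.continuousWithinAt (by fun_prop)) fun τ hτ => h τ hτ.1 hτ.2
  simpa using h1

end SPCP

end

/-! ### Borel problems attached to data on the strips and on the sectors -/

open scoped ENNReal Topology

noncomputable section

namespace SPCP

open MeasureTheory Set Filter

/-- The equation in the Borel plane together with the growth of the Taylor coefficients in `z` of
its solutions, on a set `Z` free of roots of `P`. -/
structure BorelSetup (S : ℕ) (P : Polynomial ℂ) (𝒜 : Finset (ℕ × ℕ × ℕ))
    (c : ℕ × ℕ × ℕ → ℂ → ℂ → ℂ) (ct : ℕ × ℕ × ℕ → ℕ → ℂ → ℂ)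
    (ε₀ R β b M σ₁ σ₂ σ₃ ς₂ ς₃ r : ℝ) (Z : Set ℂ) : Prop where
  one_lt_b : 1 < b
  zeta_lt : zetaR b < M
  σ₁_pos : 0 < σ₁
  σ₂_pos : 0 < σ₂
  ς₂_pos : 0 < ς₂
  ς₃_pos : 0 < ς₃
  lt_S : ∀ k ∈ 𝒜, k.2.1 < S
  ct_diff : ∀ k ∈ 𝒜, ∀ m, DifferentiableOn ℂ (ct k m) (Metric.ball 0 ε₀)
  ct_sum : ∀ k ∈ 𝒜, ∀ ε ∈ Metric.ball (0 : ℂ) ε₀, ∀ z ∈ Metric.ball (0 : ℂ) β,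
    (Summable fun m => ‖ct k m ε * z ^ m‖) ∧ ∑' m, ct k m ε * z ^ m = c k z ε
  R_pos : 0 < R
  R_le : 4 * R * β ≤ 1
  eval_ne_zero : ∀ τ ∈ Z, P.eval τ ≠ 0
  decay : ∀ (w : ℕ → ℂ → ℂ → ℂ), ∀ τ ∈ Z, ∀ ε ∈ pdisc ε₀,
    (∀ j < S, ‖w j τ ε‖ ≤
      ‖τ‖ * Real.exp (σ₁ / ‖ε‖ * ‖τ‖ - σ₂ * (M - 1) * Real.exp (σ₃ * ‖τ‖))) →
    ∀ n, ‖borelCoef S P 𝒜 ct w n τ ε‖ ≤ ‖τ‖ * Real.exp (σ₁ * zetaR b / ‖ε‖ * ‖τ‖ -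
      σ₂ * (M - zetaR b) * Real.exp (σ₃ * ‖τ‖)) * (R ^ n * n.factorial)
  growth : ∀ (w : ℕ → ℂ → ℂ → ℂ), ∀ τ ∈ Z, ∀ ε ∈ pdisc ε₀,
    (∀ j < S, ‖w j τ ε‖ ≤ ‖τ‖ * Real.exp (σ₁ / ‖ε‖ * ‖τ‖ + ς₂ * Real.exp (ς₃ * ‖τ‖))) →
    ∀ n, ‖borelCoef S P 𝒜 ct w n τ ε‖ ≤ ‖τ‖ * Real.exp (σ₁ * zetaR b / ‖ε‖ * ‖τ‖ +
      ς₂ * zetaR b * Real.exp (ς₃ * ‖τ‖)) * (R ^ n * n.factorial)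
  expGrowth : ∀ (w : ℕ → ℂ → ℂ → ℂ), ∀ τ ∈ Z, -r ≤ τ.re → ∀ ε ∈ pdisc ε₀,
    (∀ j < S, ‖w j τ ε‖ ≤ ‖τ‖ * Real.exp (σ₁ / ‖ε‖ * ‖τ‖)) →
    ∀ n, ‖borelCoef S P 𝒜 ct w n τ ε‖ ≤ ‖τ‖ * Real.exp (σ₁ * zetaR b / ‖ε‖ * ‖τ‖) *
      (R ^ n * n.factorial)

/-- All three growth statements are instances of `exists_growth_rate` with the same R: only the
exponent X and the prefactor D change with the weight. -/
theorem exists_borelSetup {S : ℕ} {P : Polynomial ℂ} {𝒜 : Finset (ℕ × ℕ × ℕ)}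
    {c : ℕ × ℕ × ℕ → ℂ → ℂ → ℂ} {ρ ε₀ ξ b M σ₁ σ₂ σ₃ ς₂ ς₃ r : ℝ} {Z : Set ℂ}
    (hP : P ≠ 0) (hρ : 0 < ρ)
    (hc_hol : ∀ k ∈ 𝒜, DifferentiableOn ℂ (fun q : ℂ × ℂ => c k q.1 q.2)
      (Metric.ball 0 ρ ×ˢ Metric.ball 0 ε₀))
    (hc_bdd : ∀ k ∈ 𝒜, ∃ K : ℝ, ∀ z ∈ Metric.ball (0 : ℂ) ρ, ∀ ε ∈ Metric.ball (0 : ℂ) ε₀,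
      ‖c k z ε‖ ≤ K)
    (hξ : 0 < ξ) (hb : 1 < b) (hM : zetaR b < M)
    (hcond : ∀ k ∈ 𝒜, (k.2.1 : ℝ) + b * k.1 + b * k.2.2 / ξ ≤ S ∧ k.2.1 < S)
    (hσ₁ : 0 < σ₁) (hσ₂ : 0 < σ₂) (hς₂ : 0 < ς₂) (hς₃ : 0 < ς₃) (hξσ : ξ ≤ min σ₃ ς₃)
    (hZ : IsClosed Z) (hroot : ∀ τ ∈ Z, ¬ P.IsRoot τ) :
    ∃ (ct : ℕ × ℕ × ℕ → ℕ → ℂ → ℂ) (R δ₁ : ℝ), 0 < δ₁ ∧ δ₁ < 1 ∧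
      BorelSetup S P 𝒜 c ct ε₀ R (ρ / 2 * δ₁) b M σ₁ σ₂ σ₃ ς₂ ς₃ r Z := by
  have hb0 : 0 ≤ b := by linarith
  obtain ⟨cP, hcP, hcPle⟩ := exists_pos_le_norm_eval hP hZ hroot
  have hKc : ∃ Kc : ℝ, 0 ≤ Kc ∧ ∀ k ∈ 𝒜, ∀ z ∈ Metric.ball (0 : ℂ) ρ,
      ∀ ε ∈ Metric.ball (0 : ℂ) ε₀, ‖c k z ε‖ ≤ Kc := by
    choose! K hK using hc_bdd
    refine ⟨∑ k ∈ 𝒜, |K k|, Finset.sum_nonneg fun _ _ => abs_nonneg _, fun k hk z hz ε hε => ?_⟩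
    exact (hK k hk z hz ε hε).trans ((le_abs_self _).trans
      (Finset.single_le_sum (f := fun k => |K k|) (fun _ _ => abs_nonneg _) hk))
  obtain ⟨Kc, hKc0, hKc⟩ := hKc
  have htay : ∀ k, ∃ ct : ℕ → ℂ → ℂ, k ∈ 𝒜 → _ := fun k => by
    by_cases hk : k ∈ 𝒜
    · obtain ⟨ct, h⟩ := exists_taylor (half_pos hρ) (half_lt_self hρ) (hc_hol k hk) (hKc k hk)
      exact ⟨ct, fun _ => h⟩
    · exact ⟨fun _ _ => 0, fun h => absurd h hk⟩
  choose ct hct using htay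
  choose CH hCH0 hCH using fun k : ℕ => exp_mul_le hξ hb0 hσ₂ (hξσ.trans (min_le_left _ _)) k
  choose CJ hCJ0 hCJ using fun k : ℕ => exp_mul_le hξ hb0 hς₂ (hξσ.trans (min_le_right _ _)) k
  -- The bounds on e^{-k₂τ} for the two double exponential weights and for Re τ ≥ -r are added up,
  -- so that one constant serves the three cases.
  set f : ℕ × ℕ × ℕ → ℝ := fun k => CH k.2.2 + CJ k.2.2 + Real.exp (k.2.2 * r) with hf
  have hf0 : ∀ k, 0 ≤ f k := fun k => add_nonneg (add_nonneg (hCH0 _) (hCJ0 _)) (Real.exp_pos _).le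
  have hfle : ∀ k ∈ 𝒜, f k ≤ ∑ k ∈ 𝒜, f k := fun k hk =>
    Finset.single_le_sum (fun k _ => hf0 k) hk
  obtain ⟨R, hR1, hR⟩ := exists_growth_rate (P := P) (ε₀ := ε₀) hb hcond hσ₁ hcP
    (Finset.sum_nonneg fun k (_ : k ∈ 𝒜) => hf0 k) hKc0 (half_pos hρ) fun k hk => (hct k hk).2.1
  have hnorm : ∀ (k : ℕ) (τ : ℂ), ‖Complex.exp (-(k * τ))‖ ≤ Real.exp (k * ‖τ‖) := fun k τ => by
    rw [Complex.norm_exp]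
    refine Real.exp_le_exp.2 ((Complex.re_le_norm _).trans ?_)
    rw [norm_neg, norm_mul, Complex.norm_natCast]
  have hN0 : ∀ (k : ℕ) (N : ℕ), 0 ≤ (N : ℝ) ^ (b * k / ξ) := fun k N => by positivity
  have hden : 0 < 2 + 4 * R * (ρ / 2) := by positivity
  have hζ := one_le_zetaR hb
  -- This δ₁ makes 4Rβ ≤ 1 for β = (ρ/2)δ₁, and stays below 1.
  refine ⟨ct, R, 1 / (2 + 4 * R * (ρ / 2)), by positivity, ?_, ?_⟩
  · rw [div_lt_one hden]; nlinarith [mul_pos (zero_lt_one.trans_le hR1) hρ]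
  have hδ₁ : 1 / (2 + 4 * R * (ρ / 2)) ≤ 1 := by
    rw [div_le_one hden]; nlinarith [mul_pos (zero_lt_one.trans_le hR1) hρ]
  refine
    { one_lt_b := hb, zeta_lt := hM, σ₁_pos := hσ₁, σ₂_pos := hσ₂, ς₂_pos := hς₂, ς₃_pos := hς₃
      lt_S := fun k hk => (hcond k hk).2
      ct_diff := fun k hk => (hct k hk).1
      ct_sum := fun k hk ε hε z hz => (hct k hk).2.2 ε hε z (Metric.ball_subset_ball
        (mul_le_of_le_one_right (half_pos hρ).le hδ₁) hz)
      R_pos := zero_lt_one.trans_le hR1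
      R_le := ?_
      eval_ne_zero := fun τ hτ => norm_pos_iff.1 (hcP.trans_le (hcPle τ hτ))
      decay := fun w τ hτ ε hε hw n => ?_
      growth := fun w τ hτ ε hε hw n => ?_
      expGrowth := fun w τ hτ hτr ε hε hw n => ?_ }
  · rw [mul_one_div, ← mul_div_assoc, div_le_one hden]; linarith
  -- Split exp(-σ₂(M - r)e^{σ₃|τ|}) as exp(-σ₂Me^{σ₃|τ|}) exp(rσ₂e^{σ₃|τ|}): the first factor goes
  -- into D, and the second is a growing weight. Decay is thereby reduced to the case of growth.
  · refine (hR w τ ε (σ₂ * Real.exp (σ₃ * ‖τ‖)) (‖τ‖ * Real.exp (-(σ₂ * M * Real.exp (σ₃ * ‖τ‖))))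
      hε.1 (hcPle τ hτ) (by positivity) (by positivity) (fun k hk N hN => ?_)
      (fun j hj => ?_) n).trans (le_of_eq ?_)
    · refine (hnorm k.2.2 τ).trans ((hCH k.2.2 _ N hN).trans ?_)
      refine mul_le_mul_of_nonneg_right (mul_le_mul_of_nonneg_right ?_ (hN0 _ _))
        (Real.exp_pos _).le
      exact le_trans (by linarith [hCJ0 k.2.2, Real.exp_pos (k.2.2 * r)]) (hfle k hk)
    · refine (hw j hj).trans (le_of_eq ?_)
      rw [mul_assoc ‖τ‖, ← Real.exp_add]; congr 2; ring
    · rw [mul_assoc ‖τ‖, ← Real.exp_add]; congr 3; ring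
  · refine (hR w τ ε (ς₂ * Real.exp (ς₃ * ‖τ‖)) ‖τ‖ hε.1 (hcPle τ hτ) (by positivity)
      (norm_nonneg _) (fun k hk N hN => ?_) hw n).trans (le_of_eq ?_)
    · refine (hnorm k.2.2 τ).trans ((hCJ k.2.2 _ N hN).trans ?_)
      refine mul_le_mul_of_nonneg_right (mul_le_mul_of_nonneg_right ?_ (hN0 _ _))
        (Real.exp_pos _).le
      exact le_trans (by linarith [hCH0 k.2.2, Real.exp_pos (k.2.2 * r)]) (hfle k hk)
    · congr 3; ring
  -- For Re τ ≥ -r the factor e^{-k₂τ} is bounded, so no double exponential is needed and X = 0.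
  · refine (hR w τ ε 0 ‖τ‖ hε.1 (hcPle τ hτ) le_rfl
      (norm_nonneg _) (fun k hk N hN => ?_) (by simpa using hw) n).trans (le_of_eq ?_)
    · rw [mul_zero, Real.exp_zero, mul_one, Complex.norm_exp]
      have h1 : (-((k.2.2 : ℂ) * τ)).re ≤ k.2.2 * r := by
        rw [Complex.neg_re, ← Complex.ofReal_natCast, Complex.re_ofReal_mul]
        nlinarith [Nat.cast_nonneg (α := ℝ) k.2.2]
      have h2 : Real.exp (k.2.2 * r) ≤ ∑ k ∈ 𝒜, f k :=
        le_trans (by linarith [hCJ0 k.2.2, hCH0 k.2.2]) (hfle k hk)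
      have h3 : 1 ≤ (N : ℝ) ^ (b * k.2.2 / ξ) :=
        Real.one_le_rpow (by exact_mod_cast hN) (by positivity)
      exact ((Real.exp_le_exp.2 h1).trans h2).trans (le_mul_of_one_le_right
        (Finset.sum_nonneg fun k _ => hf0 k) h3)
    · congr 3; ring

/-! ### Dependence on the initial data -/

variable {S : ℕ} {P : Polynomial ℂ} {𝒜 : Finset (ℕ × ℕ × ℕ)}
  {c : ℕ × ℕ × ℕ → ℂ → ℂ → ℂ} {ct : ℕ × ℕ × ℕ → ℕ → ℂ → ℂ}
  {ε₀ R β b M σ₁ σ₂ σ₃ ς₂ ς₃ r κ C : ℝ} {Z K U : Set ℂ} {Bd : ℂ → ℂ → ℝ}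

lemma cauchySeq_congr (hS : ∀ k ∈ 𝒜, k.2.1 < S) (q : ℕ × ℕ × ℕ → ℂ) (c : ℕ × ℕ × ℕ → ℕ → ℂ)
    {w w' : ℕ → ℂ} (h : ∀ j < S, w j = w' j) (n : ℕ) :
    cauchySeq S 𝒜 q c w n = cauchySeq S 𝒜 q c w' n := by
  induction n using Nat.strong_induction_on with
  | _ n ih =>
    rcases lt_or_ge n S with hn | hn
    · rw [cauchySeq_of_lt _ _ _ hn, cauchySeq_of_lt _ _ _ hn, h n hn]
    · obtain ⟨m, rfl⟩ := Nat.exists_eq_add_of_le' hn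
      rw [cauchySeq_add hS, cauchySeq_add hS]
      refine Finset.sum_congr rfl fun k hk => ?_
      congr 1
      refine Finset.sum_congr rfl fun p hp => ?_
      rw [ih _ (by have := hS k hk; have := Finset.HasAntidiagonal.mem_antidiagonal.1 hp; omega)]

/-- The value at (τ, ε) depends on the data at that point alone, τ and ε being parameters. Agreement
of the data on a disc thus passes to the solutions, with no identity theorem. -/
lemma borelSol_congr (hS : ∀ k ∈ 𝒜, k.2.1 < S) {w w' : ℕ → ℂ → ℂ → ℂ} {τ ε : ℂ}
    (h : ∀ j < S, w j τ ε = w' j τ ε) (j : ℕ) (z : ℂ) :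
    borelSol S P 𝒜 ct w j τ z ε = borelSol S P 𝒜 ct w' j τ z ε := by
  unfold borelSol borelCoef
  congr 1
  funext n
  exact cauchySeq_congr hS _ _ h _

namespace BorelSetup

lemma zeta_pos (h : BorelSetup S P 𝒜 c ct ε₀ R β b M σ₁ σ₂ σ₃ ς₂ ς₃ r Z) : 0 < zetaR b :=
  zero_lt_one.trans_le (one_le_zetaR h.one_lt_b)

lemma κ_nonneg (h : BorelSetup S P 𝒜 c ct ε₀ R β b M σ₁ σ₂ σ₃ ς₂ ς₃ r Z) :
    0 ≤ σ₁ * zetaR b := (mul_pos h.σ₁_pos h.zeta_pos).le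

end BorelSetup

/-- Initial data on the strips, bounded by `1` in the norms of the strips. -/
structure StripData (S : ℕ) (ε₀ b M σ₁ σ₂ σ₃ ς₂ ς₃ : ℝ) (n : ℕ) (aH bH cJ dJ : ℤ → ℝ)
    (w : ℕ → ℂ → ℂ → ℂ) : Prop where
  strips : IsStripSystem n aH bH cJ dJ
  diff : ∀ j < S, DifferentiableOn ℂ (fun q : ℂ × ℂ => w j q.1 q.2)
    (interior (strip (cJ (-n)) (bH n)) ×ˢ pdisc ε₀)
  cont : ∀ j < S, ContinuousOn (fun q : ℂ × ℂ => w j q.1 q.2)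
    (strip (cJ (-n)) (bH n) ×ˢ pdisc ε₀)
  norm_H : ∀ j < S, ∀ ε ∈ pdisc ε₀, ∀ k : ℤ, -(n : ℤ) ≤ k → k ≤ n →
    sedNorm b M 0 σ₁ σ₂ σ₃ (strip (aH k) (bH k)) ε (fun τ => w j τ ε) ≤ ENNReal.ofReal 1
  norm_J : ∀ j < S, ∀ ε ∈ pdisc ε₀, ∀ k : ℤ, -(n : ℤ) ≤ k → k ≤ n →
    segNorm b 0 σ₁ ς₂ ς₃ (strip (cJ k) (dJ k)) ε (fun τ => w j τ ε) ≤ ENNReal.ofReal 1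

/-- Initial data on the union of a sector and a disc, of norm at most `1`. -/
structure SectorData (S : ℕ) (ε₀ b σ₁ r α θ : ℝ) (w : ℕ → ℂ → ℂ → ℂ) : Prop where
  r_pos : 0 < r
  θ_pos : 0 < θ
  subset : unbSector α θ ⊆ {z | 0 < z.re}
  diff : ∀ j < S, DifferentiableOn ℂ (fun q : ℂ × ℂ => w j q.1 q.2)
    ((unbSector α θ ∪ Metric.ball 0 r) ×ˢ pdisc ε₀)
  cont : ∀ j < S, ContinuousOn (fun q : ℂ × ℂ => w j q.1 q.2)
    ((closure (unbSector α θ) ∪ Metric.closedBall 0 r) ×ˢ pdisc ε₀)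
  norm_le : ∀ j < S, ∀ ε ∈ pdisc ε₀,
    egNorm b 0 σ₁ (closure (unbSector α θ) ∪ Metric.closedBall 0 r) ε (fun τ => w j τ ε) ≤
      ENNReal.ofReal 1

namespace StripData

variable {n : ℕ} {aH bH cJ dJ : ℤ → ℝ} {w : ℕ → ℂ → ℂ → ℂ}

lemma apply_zero (d : StripData S ε₀ b M σ₁ σ₂ σ₃ ς₂ ς₃ n aH bH cJ dJ w) {j : ℕ} (hj : j < S)
    {ε : ℂ} (hε : ε ∈ pdisc ε₀) : w j 0 ε = 0 := by
  refine eq_zero_of_norm_le (T := strip (cJ 0) (dJ 0)) (f := fun τ => w j τ ε)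
    (g := fun x => Real.exp (σ₁ / ‖ε‖ * x + ς₂ * Real.exp (ς₃ * x))) ?_ (by fun_prop)
    d.strips.zero_mem_strip d.strips.zero_mem_closure fun τ hτ hτ0 =>
      norm_le_of_segNorm_le (d.norm_J j hj ε hε 0 (by omega) (by omega)) hτ0 hτ
  exact (d.cont j hj).comp (f := fun τ : ℂ => (τ, ε)) (by fun_prop) fun τ hτ =>
    ⟨d.strips.strip_J_subset (by omega) (by omega) hτ, hε⟩

lemma norm_coef_H_le (d : StripData S ε₀ b M σ₁ σ₂ σ₃ ς₂ ς₃ n aH bH cJ dJ w)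
    (h : BorelSetup S P 𝒜 c ct ε₀ R β b M σ₁ σ₂ σ₃ ς₂ ς₃ r Z) (hZ : {τ | τ.re ≤ 0} ⊆ Z)
    {k : ℤ} (hk : -(n : ℤ) ≤ k) (hkn : k ≤ n) {τ ε : ℂ} (hτ : τ ∈ strip (aH k) (bH k))
    (hε : ε ∈ pdisc ε₀) (m : ℕ) :
    ‖borelCoef S P 𝒜 ct w m τ ε‖ ≤ ‖τ‖ * Real.exp (σ₁ * zetaR b / ‖ε‖ * ‖τ‖ -
      σ₂ * (M - zetaR b) * Real.exp (σ₃ * ‖τ‖)) * (R ^ m * m.factorial) :=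
  h.decay w τ (hZ hτ.2.2) ε hε (fun j hj => norm_le_of_sedNorm_le (d.norm_H j hj ε hε k hk hkn)
    (d.apply_zero hj hε) hτ) m

lemma norm_coef_J_le (d : StripData S ε₀ b M σ₁ σ₂ σ₃ ς₂ ς₃ n aH bH cJ dJ w)
    (h : BorelSetup S P 𝒜 c ct ε₀ R β b M σ₁ σ₂ σ₃ ς₂ ς₃ r Z) (hZ : {τ | τ.re ≤ 0} ⊆ Z)
    {k : ℤ} (hk : -(n : ℤ) ≤ k) (hkn : k ≤ n) {τ ε : ℂ} (hτ : τ ∈ strip (cJ k) (dJ k))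
    (hε : ε ∈ pdisc ε₀) (m : ℕ) :
    ‖borelCoef S P 𝒜 ct w m τ ε‖ ≤ ‖τ‖ * Real.exp (σ₁ * zetaR b / ‖ε‖ * ‖τ‖ +
      ς₂ * zetaR b * Real.exp (ς₃ * ‖τ‖)) * (R ^ m * m.factorial) := by
  refine h.growth w τ (hZ hτ.2.2) ε hε (fun j hj => ?_) m
  rcases eq_or_ne τ 0 with rfl | hτ0
  · simp [d.apply_zero hj hε]
  · exact norm_le_of_segNorm_le (d.norm_J j hj ε hε k hk hkn) hτ0 hτ

/-- On H_k the decaying bound is stronger than the growing one, so the growing bound holds on all of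
HJ_n, which is where paths are deformed. -/
lemma norm_coef_le (d : StripData S ε₀ b M σ₁ σ₂ σ₃ ς₂ ς₃ n aH bH cJ dJ w)
    (h : BorelSetup S P 𝒜 c ct ε₀ R β b M σ₁ σ₂ σ₃ ς₂ ς₃ r Z) (hZ : {τ | τ.re ≤ 0} ⊆ Z)
    {τ ε : ℂ} (hτ : τ ∈ strip (cJ (-n)) (bH n)) (hε : ε ∈ pdisc ε₀) (m : ℕ) :
    ‖borelCoef S P 𝒜 ct w m τ ε‖ ≤ ‖τ‖ * Real.exp (σ₁ * zetaR b / ‖ε‖ * ‖τ‖ +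
      ς₂ * zetaR b * Real.exp (ς₃ * ‖τ‖)) * (R ^ m * m.factorial) := by
  have hR := h.R_pos
  obtain ⟨k, hk, hkn, hτ | hτ⟩ := d.strips.exists_mem hτ
  · refine (d.norm_coef_H_le h hZ hk hkn hτ hε m).trans ?_
    have h1 : 0 ≤ σ₂ * (M - zetaR b) * Real.exp (σ₃ * ‖τ‖) :=
      mul_nonneg (mul_nonneg h.σ₂_pos.le (sub_nonneg.2 h.zeta_lt.le)) (Real.exp_pos _).le
    have h2 : 0 ≤ ς₂ * zetaR b * Real.exp (ς₃ * ‖τ‖) :=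
      mul_nonneg (mul_nonneg h.ς₂_pos.le h.zeta_pos.le) (Real.exp_pos _).le
    refine mul_le_mul_of_nonneg_right (mul_le_mul_of_nonneg_left (Real.exp_le_exp.2 ?_)
      (norm_nonneg _)) (by positivity)
    linarith
  · exact d.norm_coef_J_le h hZ hk hkn hτ hε m

lemma borelProblem (d : StripData S ε₀ b M σ₁ σ₂ σ₃ ς₂ ς₃ n aH bH cJ dJ w)
    (h : BorelSetup S P 𝒜 c ct ε₀ R β b M σ₁ σ₂ σ₃ ς₂ ς₃ r Z) (hZ : {τ | τ.re ≤ 0} ⊆ Z)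
    (hC : 1 ≤ C) :
    BorelProblem S P 𝒜 c ct w ε₀ R β (strip (cJ (-n)) (bH n))
      (interior (strip (cJ (-n)) (bH n))) (expBd C (σ₁ * zetaR b) (ς₂ * zetaR b) ς₃) where
  lt_S := h.lt_S
  isOpen := isOpen_interior
  subset := interior_subset
  subset_closure := (closure_interior_strip d.strips.c_lt_b).ge
  eval_ne_zero := fun τ hτ => h.eval_ne_zero τ (hZ hτ.2.2)
  ct_diff := h.ct_diff
  ct_sum := h.ct_sum
  w_diff := d.diff
  w_cont := d.cont
  bd_cont := continuousOn_expBd _ _ _ _ _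
  bd := fun τ hτ ε hε m => by
    have hR := h.R_pos
    refine (d.norm_coef_le h hZ hτ hε m).trans (mul_le_mul_of_nonneg_right ?_ (by positivity))
    exact le_mul_of_one_le_left (by positivity) hC
  R_pos := h.R_pos
  R_le := h.R_le

lemma bPath_mem (d : StripData S ε₀ b M σ₁ σ₂ σ₃ ς₂ ς₃ n aH bH cJ dJ w)
    {k : ℤ} (hk : -(n : ℤ) ≤ k) (hkn : k ≤ n) {A : ℂ} (hA : A ∈ strip (aH k) (bH k))
    {s : ℝ} (hs : 0 ≤ s) : bPath A (-1) s ∈ strip (cJ (-n)) (bH n) ∧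
      (1 ≤ s → bPath A (-1) s ∈ strip (aH k) (bH k)) := by
  have h1 : 1 ≤ s → bPath A (-1) s ∈ strip (aH k) (bH k) := by
    intro hs1
    rw [bPath_of_ge hs1]
    refine ⟨?_, ?_, ?_⟩
    · simpa using hA.1
    · simpa using hA.2.1
    · have := hA.2.2
      simp only [Complex.add_re, Complex.re_ofReal_mul, Complex.neg_re, Complex.one_re]
      linarith
  refine ⟨?_, h1⟩
  rcases le_total s 1 with hs1 | hs1
  · rw [bPath_of_le hs1]
    have := (convex_strip (cJ (-n)) (bH n)).starConvex
      (d.strips.strip_J_subset (by omega) (by omega) d.strips.zero_mem_strip)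
    have := this.smul_mem (d.strips.strip_H_subset hk hkn hA) hs hs1
    rwa [Complex.real_smul] at this
  · exact d.strips.strip_H_subset hk hkn (h1 hs1)

/-- On the segment ‖τ‖ ≤ a', so the double exponential growth is at most the constant displayed; on
the halfline, which lies in H_k, the decaying bound applies. Either way only e^{κ‖τ‖/‖ε‖} remains.
-/
lemma borelPath (d : StripData S ε₀ b M σ₁ σ₂ σ₃ ς₂ ς₃ n aH bH cJ dJ w)
    (h : BorelSetup S P 𝒜 c ct ε₀ R β b M σ₁ σ₂ σ₃ ς₂ ς₃ r Z) (hZ : {τ | τ.re ≤ 0} ⊆ Z)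
    {k : ℤ} (hk : -(n : ℤ) ≤ k) (hkn : k ≤ n) {A : ℂ} (hA : A ∈ strip (aH k) (bH k)) {a' : ℝ}
    (ha' : ‖A‖ ≤ a') :
    BorelPath S P 𝒜 ct w ε₀ R (strip (cJ (-n)) (bH n)) A (-1) (σ₁ * zetaR b)
      (Real.exp (ς₂ * zetaR b * Real.exp (ς₃ * a'))) where
  norm_d := by simp
  mem := fun s hs => (d.bPath_mem hk hkn hA hs).1
  κ_nonneg := h.κ_nonneg
  C_nonneg := (Real.exp_pos _).le
  bd := fun ε hε s hs m => by
    have hR := h.R_pos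
    have hς := h.ς₂_pos
    have hς₃ := h.ς₃_pos
    have hζ := h.zeta_pos
    set φ := bPath A (-1) s with hφ
    rw [mul_left_comm (Real.exp _), ← Real.exp_add]
    rcases le_total s 1 with hs1 | hs1
    · refine (d.norm_coef_le h hZ (d.bPath_mem hk hkn hA hs.le).1 hε m).trans ?_
      have hn : ‖φ‖ ≤ a' := by
        rw [hφ, bPath_of_le hs1, norm_mul, Complex.norm_real, Real.norm_of_nonneg hs.le]
        exact (mul_le_of_le_one_left (norm_nonneg _) hs1).trans ha'
      refine mul_le_mul_of_nonneg_right (mul_le_mul_of_nonneg_left (Real.exp_le_exp.2 ?_)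
        (norm_nonneg _)) (by positivity)
      rw [add_comm]
      gcongr
    · refine (d.norm_coef_H_le h hZ hk hkn ((d.bPath_mem hk hkn hA hs.le).2 hs1) hε m).trans ?_
      have h1 : 0 ≤ σ₂ * (M - zetaR b) * Real.exp (σ₃ * ‖φ‖) :=
        mul_nonneg (mul_nonneg h.σ₂_pos.le (sub_nonneg.2 h.zeta_lt.le)) (Real.exp_pos _).le
      have h2 : 0 ≤ ς₂ * zetaR b * Real.exp (ς₃ * a') := by positivity
      refine mul_le_mul_of_nonneg_right (mul_le_mul_of_nonneg_left (Real.exp_le_exp.2 ?_)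
        (norm_nonneg _)) (by positivity)
      linarith

end StripData

namespace SectorData

variable {α θ : ℝ} {w : ℕ → ℂ → ℂ → ℂ}

lemma θ_le (d : SectorData S ε₀ b σ₁ r α θ w) : θ ≤ Real.pi / 2 :=
  le_pi_div_two_of_unbSector_subset d.subset

lemma apply_zero (d : SectorData S ε₀ b σ₁ r α θ w) {j : ℕ} (hj : j < S)
    {ε : ℂ} (hε : ε ∈ pdisc ε₀) : w j 0 ε = 0 := by
  refine eq_zero_of_norm_le (T := closure (unbSector α θ) ∪ Metric.closedBall 0 r)
    (f := fun τ => w j τ ε) (g := fun x => Real.exp (σ₁ / ‖ε‖ * x)) ?_ (by fun_prop)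
    (Or.inr (Metric.mem_closedBall_self d.r_pos.le)) ?_ fun τ hτ hτ0 =>
      norm_le_of_egNorm_le (d.norm_le j hj ε hε) hτ0 hτ
  · exact (d.cont j hj).comp (f := fun τ : ℂ => (τ, ε)) (by fun_prop) fun τ hτ => ⟨hτ, hε⟩
  · have hsub : unbSector α θ ⊆ (closure (unbSector α θ) ∪ Metric.closedBall 0 r) \ {0} :=
      fun z hz => ⟨Or.inl (subset_closure hz), hz.1⟩
    exact closure_mono hsub (zero_mem_closure_unbSector d.θ_pos)

lemma norm_coef_le (d : SectorData S ε₀ b σ₁ r α θ w)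
    (h : BorelSetup S P 𝒜 c ct ε₀ R β b M σ₁ σ₂ σ₃ ς₂ ς₃ r Z)
    (hZ : closure (unbSector α θ) ∪ Metric.closedBall 0 r ⊆ Z)
    {τ ε : ℂ} (hτ : τ ∈ closure (unbSector α θ) ∪ Metric.closedBall 0 r)
    (hε : ε ∈ pdisc ε₀) (m : ℕ) :
    ‖borelCoef S P 𝒜 ct w m τ ε‖ ≤ ‖τ‖ * Real.exp (σ₁ * zetaR b / ‖ε‖ * ‖τ‖) *
      (R ^ m * m.factorial) := by
  refine h.expGrowth w τ (hZ hτ) ?_ ε hε (fun j hj => ?_) m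
  · rcases hτ with hτ | hτ
    · linarith [re_nonneg_of_mem_closure d.subset hτ, d.r_pos]
    · have h1 := (Complex.abs_re_le_norm τ).trans (mem_closedBall_zero_iff.1 hτ)
      exact (abs_le.1 h1).1
  · rcases eq_or_ne τ 0 with rfl | hτ0
    · simp [d.apply_zero hj hε]
    · exact norm_le_of_egNorm_le (d.norm_le j hj ε hε) hτ0 hτ

lemma borelProblem (d : SectorData S ε₀ b σ₁ r α θ w)
    (h : BorelSetup S P 𝒜 c ct ε₀ R β b M σ₁ σ₂ σ₃ ς₂ ς₃ r Z)
    (hZ : closure (unbSector α θ) ∪ Metric.closedBall 0 r ⊆ Z) (hC : 1 ≤ C) :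
    BorelProblem S P 𝒜 c ct w ε₀ R β (closure (unbSector α θ) ∪ Metric.closedBall 0 r)
      (unbSector α θ ∪ Metric.ball 0 r) (expBd C (σ₁ * zetaR b) 0 ς₃) where
  lt_S := h.lt_S
  isOpen := (isOpen_unbSector d.θ_pos d.θ_le).union Metric.isOpen_ball
  subset := union_subset_union subset_closure Metric.ball_subset_closedBall
  subset_closure := by rw [closure_union, closure_ball _ d.r_pos.ne']
  eval_ne_zero := fun τ hτ => h.eval_ne_zero τ (hZ hτ)
  ct_diff := h.ct_diff
  ct_sum := h.ct_sum
  w_diff := d.diff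
  w_cont := d.cont
  bd_cont := continuousOn_expBd _ _ _ _ _
  bd := fun τ hτ ε hε m => by
    have hR := h.R_pos
    refine (d.norm_coef_le h hZ hτ hε m).trans (mul_le_mul_of_nonneg_right ?_ (by positivity))
    rw [expBd, zero_mul, add_zero]
    exact le_mul_of_one_le_left (by positivity) hC
  R_pos := h.R_pos
  R_le := h.R_le

lemma mul_mem_closure (d : SectorData S ε₀ b σ₁ r α θ w) {v : ℂ} (hv : v ∈ unbSector α θ) {s : ℝ}
    (hs : 0 ≤ s) : (s : ℂ) * v ∈ closure (unbSector α θ) := by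
  rcases hs.eq_or_lt with rfl | hs
  · simpa using zero_mem_closure_unbSector d.θ_pos
  · exact subset_closure (smul_mem_unbSector hs hv)

lemma borelPath (d : SectorData S ε₀ b σ₁ r α θ w)
    (h : BorelSetup S P 𝒜 c ct ε₀ R β b M σ₁ σ₂ σ₃ ς₂ ς₃ r Z)
    (hZ : closure (unbSector α θ) ∪ Metric.closedBall 0 r ⊆ Z) (hC : 1 ≤ C)
    {v : ℂ} (hv : v ∈ unbSector α θ) (hv1 : ‖v‖ = 1) :
    BorelPath S P 𝒜 ct w ε₀ R (closure (unbSector α θ) ∪ Metric.closedBall 0 r) v v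
      (σ₁ * zetaR b) C where
  norm_d := hv1
  mem := fun s hs => by rw [bPath_self]; exact Or.inl (d.mul_mem_closure hv hs)
  κ_nonneg := h.κ_nonneg
  C_nonneg := zero_le_one.trans hC
  bd := fun ε hε s hs m => by
    have hR := h.R_pos
    refine (d.norm_coef_le h hZ ?_ hε m).trans (mul_le_mul_of_nonneg_right ?_ (by positivity))
    · rw [bPath_self]; exact Or.inl (d.mul_mem_closure hv hs.le)
    · exact le_mul_of_one_le_left (by positivity) hC

/-- The Laplace transform does not depend on the direction within the sector. -/
theorem pathLap_eq (d : SectorData S ε₀ b σ₁ r α θ w)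
    (h : BorelSetup S P 𝒜 c ct ε₀ R β b M σ₁ σ₂ σ₃ ς₂ ς₃ r Z)
    (hZ : closure (unbSector α θ) ∪ Metric.closedBall 0 r ⊆ Z)
    {v₁ v₂ y z ε : ℂ} (hv₁ : v₁ ∈ unbSector α θ) (hv₁' : ‖v₁‖ = 1)
    (hv₂ : v₂ ∈ unbSector α θ) (hv₂' : ‖v₂‖ = 1)
    (hz : z ∈ Metric.ball 0 β) (hε : ε ∈ pdisc ε₀)
    (hy₁ : σ₁ * zetaR b / ‖ε‖ < (v₁ * y).re) (hy₂ : σ₁ * zetaR b / ‖ε‖ < (v₂ * y).re) :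
    pathLap v₁ v₁ (fun τ => borelSol S P 𝒜 ct w 0 τ z ε) y =
      pathLap v₂ v₂ (fun τ => borelSol S P 𝒜 ct w 0 τ z ε) y := by
  have hp := d.borelProblem h hZ (C := 1) le_rfl
  have p₁ := d.borelPath h hZ (C := 1) le_rfl hv₁ hv₁'
  have p₂ := d.borelPath h hZ (C := 1) le_rfl hv₂ hv₂'
  have hεp : 0 < ‖ε‖ := norm_pos_iff.2 (ne_zero_of_mem_pdisc hε)
  set m := min (v₁ * y).re (v₂ * y).re - σ₁ * zetaR b / ‖ε‖ with hm
  have hm0 : 0 < m := sub_pos.2 (lt_min hy₁ hy₂)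
  have hm₁ : σ₁ * zetaR b / ‖ε‖ + m ≤ (v₁ * y).re := by
    rw [hm, add_sub_cancel]; exact min_le_left _ _
  have hm₂ : σ₁ * zetaR b / ‖ε‖ + m ≤ (v₂ * y).re := by
    rw [hm, add_sub_cancel]; exact min_le_right _ _
  have hmε : m * ‖ε‖ / ‖ε‖ = m := by field_simp
  have hint := interior_closure_unbSector (α := α) d.θ_pos d.θ_le
  have hV : IsHolConvex (lapKernel (fun τ => borelSol S P 𝒜 ct w 0 τ z ε) y⁻¹)
      (closure (unbSector α θ)) := by
    refine isHolConvex_lapKernel zero_le_one h.κ_nonneg le_rfl h.ς₃_pos.le hp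
      (convex_unbSector d.θ_pos d.θ_le).closure ?_ subset_union_left ?_
      (zero_mem_closure_unbSector d.θ_pos) ?_ hz hε
    · rw [hint]; exact unbSector_nonempty d.θ_pos
    · rw [hint]; exact subset_union_left
    · rw [hint]; exact fun h0 => h0.1 rfl
  have hk : ∀ {v : ℂ}, ‖v‖ = 1 → σ₁ * zetaR b / ‖ε‖ + m ≤ (v * y).re → ∀ s : ℝ, 0 ≤ s →
      σ₁ * zetaR b / ‖ε‖ * ‖bPath v v s‖ + m * ‖ε‖ / ‖ε‖ * s ≤ (bPath v v s * y).re := by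
    intro v hv1 hv s hs
    rw [bPath_self, norm_mul, hv1, mul_one, Complex.norm_real, Real.norm_of_nonneg hs, hmε,
      mul_assoc (s : ℂ), Complex.re_ofReal_mul, ← add_mul, mul_comm]
    exact mul_le_mul_of_nonneg_left hv hs
  have hi : ∀ {v : ℂ}, BorelPath S P 𝒜 ct w ε₀ R
      (closure (unbSector α θ) ∪ Metric.closedBall 0 r) v v (σ₁ * zetaR b) 1 →
      σ₁ * zetaR b / ‖ε‖ < (v * y).re →
      IntegrableOn (fun s => lapKernel (fun τ => borelSol S P 𝒜 ct w 0 τ z ε) y⁻¹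
        (bPath v v s) * bVel v v s) (Ioi 0) := fun p hy => by
    simpa using p.integrableOn hp 0 0 hz hε hy
  -- Here y and ε are fixed and l → ∞, so the margin m may depend on y; the growth is purely
  -- exponential in the closed sector, and the whole rays can be deformed.
  have hbound : ∀ l : ℝ, 0 < l →
      ‖pathLap v₁ v₁ (fun τ => borelSol S P 𝒜 ct w 0 τ z ε) y -
        pathLap v₂ v₂ (fun τ => borelSol S P 𝒜 ct w 0 τ z ε) y‖ ≤
      16 / m * Real.exp (-(m / 2 * l)) := by
    intro l hl
    have hseg : ∀ u ∈ segment ℝ (bPath v₂ v₂ l) (bPath v₁ v₁ l),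
        ‖lapKernel (fun τ => borelSol S P 𝒜 ct w 0 τ z ε) y⁻¹ u‖ ≤ 2 * Real.exp (-(m * l)) := by
      intro u hu
      simp only [bPath_self] at hu
      have huV : u ∈ closure (unbSector α θ) := hV.convex.segment_subset
        (d.mul_mem_closure hv₂ hl.le) (d.mul_mem_closure hv₁ hl.le) hu
      have hun : ‖u‖ ≤ l := by
        have := (convex_closedBall (0 : ℂ) l).segment_subset
          (by simp [hv₂', abs_of_pos hl]) (by simp [hv₁', abs_of_pos hl]) hu
        simpa using this
      have hur : (σ₁ * zetaR b / ‖ε‖ + m) * l ≤ (u * y).re := by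
        have hcv : Convex ℝ {v : ℂ | (σ₁ * zetaR b / ‖ε‖ + m) * l ≤ (v * y).re} :=
          convex_halfSpace_ge (IsLinearMap.mk (fun v w => by rw [add_mul, Complex.add_re])
            fun r v => by rw [Complex.real_smul, mul_assoc, Complex.re_ofReal_mul, smul_eq_mul]) _
        have hmem : ∀ {v : ℂ}, σ₁ * zetaR b / ‖ε‖ + m ≤ (v * y).re →
            (σ₁ * zetaR b / ‖ε‖ + m) * l ≤ ((l : ℂ) * v * y).re := fun hv => by
          rw [mul_assoc (l : ℂ), Complex.re_ofReal_mul, mul_comm]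
          exact mul_le_mul_of_nonneg_left hv hl.le
        exact hcv.segment_subset (hmem hm₂) (hmem hm₁) hu
      refine (norm_lapKernel_le zero_le_one hp (Or.inl huV) hz hε).trans ?_
      rw [mul_one]
      refine mul_le_mul_of_nonneg_left (Real.exp_le_exp.2 ?_) zero_le_two
      have : σ₁ * zetaR b / ‖ε‖ * ‖u‖ ≤ σ₁ * zetaR b / ‖ε‖ * l :=
        mul_le_mul_of_nonneg_left hun (div_nonneg h.κ_nonneg hεp.le)
      linarith
    have htail : ∀ {v : ℂ}, ‖v‖ = 1 → σ₁ * zetaR b / ‖ε‖ + m ≤ (v * y).re →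
        BorelPath S P 𝒜 ct w ε₀ R
        (closure (unbSector α θ) ∪ Metric.closedBall 0 r) v v (σ₁ * zetaR b) 1 →
        ∀ s ∈ Ioi l, ‖lapKernel (fun τ => borelSol S P 𝒜 ct w 0 τ z ε) y⁻¹
          (bPath v v s) * bVel v v s‖ ≤ 4 * Real.exp (-(m * s)) := by
      intro v hv1 hv p s hs
      have hs0 : 0 < s := hl.trans hs
      refine (p.norm_kernel_le_of_cone hp hz hε hs0 (hk hv1 hv s hs0.le)).trans (le_of_eq ?_)
      rw [hmε, hv1]; norm_num
    have main := norm_integral_bPath_sub_le hV hl hm0 (hi p₁ hy₁) (hi p₂ hy₂)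
      (fun s hs => by rw [bPath_self]; exact d.mul_mem_closure hv₁ hs.1)
      (fun s hs => by rw [bPath_self]; exact d.mul_mem_closure hv₂ hs.1)
      (fun s _ => rfl) (fun s _ => rfl) (htail hv₁' hm₁ p₁) (htail hv₂' hm₂ p₂) hseg
    refine main.trans ?_
    have hdist : ‖bPath v₁ v₁ l - bPath v₂ v₂ l‖ ≤ 2 * l := by
      refine (norm_sub_le _ _).trans ?_
      rw [bPath_self, bPath_self, norm_mul, norm_mul, hv₁', hv₂', Complex.norm_real,
        Real.norm_of_nonneg hl.le]
      linarith
    set X := Real.exp (-(m / 2 * l)) with hX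
    have e1 : Real.exp (-(m * l)) = X * X := by rw [hX, ← Real.exp_add]; congr 1; ring
    have hX0 : 0 < X := Real.exp_pos _
    have hX1 : X ≤ 1 := Real.exp_le_one_iff.2 (by have : 0 ≤ m / 2 * l := by positivity
                                                  linarith)
    have e2 : l * X ≤ 2 / m := by
      have h1 : m / 2 * l ≤ Real.exp (m / 2 * l) := by linarith [Real.add_one_le_exp (m / 2 * l)]
      have h2 : Real.exp (m / 2 * l) * X = 1 := by rw [hX, ← Real.exp_add]; simp
      have h3 : m / 2 * l * X ≤ 1 := h2 ▸ mul_le_mul_of_nonneg_right h1 hX0.le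
      rw [le_div_iff₀ hm0]; linarith
    rw [e1]
    calc _ ≤ 2 * (4 * (X * 1 / m)) + 2 * (X * X) * (2 * l) := by gcongr
      _ = 8 / m * X + 4 * X * (l * X) := by ring
      _ ≤ 8 / m * X + 4 * X * (2 / m) := by gcongr
      _ = _ := by ring
  rw [← sub_eq_zero, ← norm_le_zero_iff]
  have ht : Tendsto (fun l : ℝ => 16 / m * Real.exp (-(m / 2 * l))) atTop (𝓝 0) := by
    have h1 : Tendsto (fun l : ℝ => m / 2 * l) atTop atTop :=
      tendsto_id.const_mul_atTop (half_pos hm0)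
    simpa using (Real.tendsto_exp_neg_atTop_nhds_zero.comp h1).const_mul (16 / m)
  exact ge_of_tendsto ht ((eventually_gt_atTop 0).mono hbound)

end SectorData

end SPCP

end

/-! ### Uniform constants, solutions and their differences -/

open scoped ENNReal Topology

noncomputable section

namespace SPCP

open MeasureTheory Set Filter

variable {S : ℕ} {P : Polynomial ℂ} {𝒜 : Finset (ℕ × ℕ × ℕ)}
  {c : ℕ × ℕ × ℕ → ℂ → ℂ → ℂ} {ct : ℕ × ℕ × ℕ → ℕ → ℂ → ℂ} {w w₁ w₂ : ℕ → ℂ → ℂ → ℂ}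
  {ε₀ R β b M σ₁ σ₂ σ₃ ς₂ ς₃ r κ C θ a a' D : ℝ} {Z K U K₁ U₁ K₂ U₂ : Set ℂ}
  {Bd Bd₁ Bd₂ : ℂ → ℂ → ℝ}

/-! ### Uniform constants -/

lemma exists_pos_forall_mem {ι : Type*} (s : Finset ι) (Q : ι → ℝ → Prop)
    (hmono : ∀ i ∈ s, ∀ x y, 0 < y → y ≤ x → Q i x → Q i y) (h : ∀ i ∈ s, ∃ x > 0, Q i x) :
    ∃ x : ℝ, 0 < x ∧ x ≤ 1 ∧ ∀ i ∈ s, Q i x := by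
  classical
  induction s using Finset.induction_on with
  | empty => exact ⟨1, one_pos, le_rfl, by simp⟩
  | insert i s hi ih =>
    obtain ⟨x, hx, hx1, hxs⟩ := ih (fun j hj => hmono j (Finset.mem_insert_of_mem hj))
      fun j hj => h j (Finset.mem_insert_of_mem hj)
    obtain ⟨y, hy, hyi⟩ := h i (Finset.mem_insert_self _ _)
    have hm : 0 < min x y := lt_min hx hy
    refine ⟨min x y, hm, (min_le_left _ _).trans hx1, fun j hj => ?_⟩
    rcases Finset.mem_insert.1 hj with rfl | hj'
    · exact hmono _ hj y _ hm (min_le_right _ _) hyi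
    · exact hmono _ hj x _ hm (min_le_left _ _) (hxs j hj')

/-- Finitely many sectors: the least of the constants serves all of them, both as a lower bound of
the cosines and for the lengths of the segments. -/
theorem exists_cone_bounds {n ι : ℕ} {𝒯 : Set ℂ} {EH : ℤ → Set ℂ} {ES : ℕ → Set ℂ} {A : ℤ → ℂ}
    {γ : ℕ → ℂ → ℂ → ℝ} {H : ℤ → Set ℂ} {T : ℕ → Set ℂ}
    (hH : ∀ k : ℤ, -(n : ℤ) ≤ k → k ≤ n →
      SectorHJ ε₀ 𝒯 (EH k) ∧ PathPoint 𝒯 (EH k) (H k) (A k))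
    (hS : ∀ p < ι, SectorS ε₀ 𝒯 (ES p) (T p) (γ p)) :
    ∃ x : ℝ, 0 < x ∧ x ≤ 1 ∧
      (∀ k : ℤ, -(n : ℤ) ≤ k → k ≤ n → x ≤ ‖A k‖ ∧ ‖A k‖ ≤ 1 / x ∧ ∀ ε ∈ EH k, ∀ t ∈ 𝒯,
        x ≤ Real.cos (Real.pi - ε.arg - t.arg) ∧ x ≤ Real.cos ((A k).arg - ε.arg - t.arg)) ∧
      ∀ p < ι, ∀ ε ∈ ES p, ∀ t ∈ 𝒯, x ≤ Real.cos (γ p t ε - ε.arg - t.arg) := by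
  obtain ⟨x, hx, hx1, hxH⟩ := exists_pos_forall_mem (Finset.Icc (-(n : ℤ)) n)
    (fun k x => x ≤ ‖A k‖ ∧ ‖A k‖ ≤ 1 / x ∧ ∀ ε ∈ EH k, ∀ t ∈ 𝒯,
      x ≤ Real.cos (Real.pi - ε.arg - t.arg) ∧ x ≤ Real.cos ((A k).arg - ε.arg - t.arg))
    (fun k _ x y hy hyx h => ⟨hyx.trans h.1, h.2.1.trans (one_div_le_one_div_of_le hy hyx),
      fun ε hε t ht => ⟨hyx.trans (h.2.2 ε hε t ht).1, hyx.trans (h.2.2 ε hε t ht).2⟩⟩)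
    (fun k hk => by
      obtain ⟨hk1, hk2⟩ := Finset.mem_Icc.1 hk
      obtain ⟨⟨-, -, η₁, hη₁, h1⟩, -, hA0, η₂, hη₂, h2⟩ := hH k hk1 hk2
      obtain ⟨x₁, hx₁, hc₁⟩ := InCone.le_cos hη₁
      obtain ⟨x₂, hx₂, hc₂⟩ := InCone.le_cos hη₂
      have hA : 0 < ‖A k‖ := norm_pos_iff.2 hA0
      have hpos : 0 < min (min x₁ x₂) (min ‖A k‖ (1 / ‖A k‖)) := by positivity
      refine ⟨_, hpos, (min_le_right _ _).trans (min_le_left _ _), ?_, fun ε hε t ht => ⟨?_, ?_⟩⟩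
      · rw [le_div_comm₀ hA hpos]
        exact (min_le_right _ _).trans (min_le_right _ _)
      · rw [sub_right_comm]
        exact ((min_le_left _ _).trans (min_le_left _ _)).trans (hc₁ _ (h1 ε hε t ht))
      · exact ((min_le_left _ _).trans (min_le_right _ _)).trans (hc₂ _ (h2 ε hε t ht)))
  obtain ⟨y, hy, -, hyS⟩ := exists_pos_forall_mem (Finset.range ι)
    (fun p x => ∀ ε ∈ ES p, ∀ t ∈ 𝒯, x ≤ Real.cos (γ p t ε - ε.arg - t.arg))
    (fun p _ x y _ hyx h ε hε t ht => hyx.trans (h ε hε t ht))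
    (fun p hp => by
      obtain ⟨-, -, η, hη, h1⟩ := hS p (Finset.mem_range.1 hp)
      obtain ⟨x, hx, hc⟩ := InCone.le_cos hη
      exact ⟨x, hx, fun ε hε t ht => by
        rw [sub_right_comm]; exact hc _ (h1 ε hε t ht).2⟩)
  have hm : 0 < min x y := lt_min hx hy
  refine ⟨min x y, hm, (min_le_left _ _).trans hx1, fun k hk hkn => ?_, fun p hp ε hε t ht =>
    (min_le_right _ _).trans (hyS p (Finset.mem_range.2 hp) ε hε t ht)⟩
  obtain ⟨h1, h2, h3⟩ := hxH k (Finset.mem_Icc.2 ⟨hk, hkn⟩)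
  exact ⟨(min_le_left _ _).trans h1, h2.trans (one_div_le_one_div_of_le hm (min_le_left _ _)),
    fun ε hε t ht => ⟨(min_le_left _ _).trans (h3 ε hε t ht).1,
      (min_le_left _ _).trans (h3 ε hε t ht).2⟩⟩

/-- Relations between the decay rate `D` in the directions of the paths, the growth rate `κ`, and
the lengths `a ≤ ‖A‖ ≤ a'` of the segments of the paths. -/
structure DecayRate (𝒜 : Finset (ℕ × ℕ × ℕ)) (ε₀ κ θ a a' D : ℝ) : Prop where
  θ_pos : 0 < θ
  a_pos : 0 < a
  a_le : a ≤ 1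
  le_a' : 1 ≤ a'
  le_mul : κ * a' + 2 * θ ≤ D * a
  le : κ + θ / a ≤ D
  le_shift : ∀ k ∈ 𝒜, κ + k.2.2 * ε₀ + 1 ≤ D

lemma exists_decayRate (𝒜 : Finset (ℕ × ℕ × ℕ)) (hε₀ : 0 ≤ ε₀) (hκ : 0 ≤ κ) (hθ : 0 < θ)
    (ha : 0 < a) (ha1 : a ≤ 1) (ha' : 1 ≤ a') : ∃ D, 0 < D ∧ DecayRate 𝒜 ε₀ κ θ a a' D := by
  have hs : 0 ≤ ∑ k ∈ 𝒜, (k.2.2 : ℝ) * ε₀ := Finset.sum_nonneg fun k _ => by positivity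
  have h1 : 0 ≤ (κ * a' + 2 * θ) / a := by positivity
  have h2 : 0 < θ / a := by positivity
  refine ⟨(κ * a' + 2 * θ) / a + (κ + θ / a) + ∑ k ∈ 𝒜, (k.2.2 : ℝ) * ε₀ + 1, by positivity,
    hθ, ha, ha1, ha', ?_, by linarith, fun k hk => ?_⟩
  · rw [← div_le_iff₀ ha]; linarith
  · have := Finset.single_le_sum (f := fun k : ℕ × ℕ × ℕ => (k.2.2 : ℝ) * ε₀)
      (fun _ _ => by positivity) hk
    linarith

lemma DecayRate.lt (e : DecayRate 𝒜 ε₀ κ θ a a' D) : κ < D :=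
  lt_of_lt_of_le (lt_add_of_pos_right _ (div_pos e.θ_pos e.a_pos)) e.le

/-- The kernel `exp (-u y)` decays at the rate `D / ‖ε‖` along the path given by `A` and `d`. -/
structure DecayPath (a a' D : ℝ) (ε y A d : ℂ) : Prop where
  le_norm : a ≤ ‖A‖
  norm_le : ‖A‖ ≤ a'
  le_re_A : D / ‖ε‖ * ‖A‖ ≤ (A * y).re
  le_re_d : D / ‖ε‖ ≤ (d * y).re

lemma DecayPath.lt_re {ε y A d : ℂ} (q : DecayPath a a' D ε y A d)
    (e : DecayRate 𝒜 ε₀ κ θ a a' D) (hε : ε ∈ pdisc ε₀) : κ / ‖ε‖ < (d * y).re :=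
  (div_lt_div_of_pos_right e.lt (norm_pos_iff.2 hε.2)).trans_le q.le_re_d

lemma decayPath_of_le_cos {ε t A d : ℂ} {Δ ψ : ℝ} (hΔ : 0 < Δ) (hD : 0 < D) (ha : a ≤ ‖A‖)
    (ha' : ‖A‖ ≤ a') (hε : ε ≠ 0) (ht : t ≠ 0) (htr : ‖t‖ ≤ Δ / D)
    (hA : Δ ≤ Real.cos (A.arg - ε.arg - t.arg)) (hd : d = Complex.exp (ψ * Complex.I))
    (hc : Δ ≤ Real.cos (ψ - ε.arg - t.arg)) : DecayPath a a' D ε (ε * t)⁻¹ A d := by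
  have e : Δ / (Δ / D) = D := by field_simp
  refine ⟨ha, ha', ?_, ?_⟩
  · have h := re_exp_mul_inv_ge hΔ hε ht htr hA
    rw [e] at h
    conv_rhs => rw [← Complex.norm_mul_exp_arg_mul_I A, mul_assoc, Complex.re_ofReal_mul]
    rw [mul_comm]
    exact mul_le_mul_of_nonneg_left h (norm_nonneg _)
  · have h := re_exp_mul_inv_ge hΔ hε ht htr hc
    rwa [e, ← hd] at h

/-! ### Solutions -/

/-- Translating y by k₂ lowers Re(dy) by at most k₂ ≤ k₂ε₀/‖ε‖, which `le_shift` allows for. Then y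
+ k₂ keeps a positive real part in the direction d, so it is nonzero and the Moebius maps have no
pole. -/
theorem isBoundedHolSolution_of_decay (h : BorelProblem S P 𝒜 c ct w ε₀ R β K U Bd)
    (e : DecayRate 𝒜 ε₀ κ θ a a' D) {u : ℂ → ℂ → ℂ → ℂ} {𝒯 𝓔 : Set ℂ} (h𝓔 : 𝓔 ⊆ pdisc ε₀)
    (hC : 0 ≤ C) (H : ∀ t ∈ 𝒯, ∀ ε ∈ 𝓔, t ≠ 0 ∧ ∃ A d, BorelPath S P 𝒜 ct w ε₀ R K A d κ C ∧
      IsLaplaceRep S P 𝒜 ct w ε₀ β κ A d u ∧ DecayPath a a' D ε (ε * t)⁻¹ A d) :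
    IsBoundedHolSolution S P 𝒜 c 𝒯 (Metric.ball 0 β) 𝓔 u := by
  refine isBoundedHolSolution (κ := κ) (Kb := C * 2 * (a' + 1) * (ε₀ / θ)) h h𝓔
    fun t ht ε hε => ?_
  obtain ⟨ht0, A, d, p, hu, q⟩ := H t ht ε hε
  have hεd := h𝓔 hε
  have hε0 : ε ≠ 0 := hεd.2
  have hεp : 0 < ‖ε‖ := norm_pos_iff.2 hε0
  have hεle : ‖ε‖ ≤ ε₀ := (mem_ball_zero_iff.1 hεd.1).le
  have hy := q.lt_re e hεd
  have hκ := p.κ_nonneg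
  have hshift : ∀ k ∈ 𝒜, κ / ‖ε‖ < (d * ((ε * t)⁻¹ + k.2.2)).re := by
    intro k hk
    have h1 : (κ + k.2.2 * ε₀ + 1) / ‖ε‖ ≤ (d * (ε * t)⁻¹).re :=
      (div_le_div_of_nonneg_right (e.le_shift k hk) hεp.le).trans q.le_re_d
    have h2 : -(k.2.2 : ℝ) ≤ (d * (k.2.2 : ℂ)).re := by
      have := (abs_le.1 (Complex.abs_re_le_norm (d * (k.2.2 : ℂ)))).1
      rwa [norm_mul, p.norm_d, one_mul, Complex.norm_natCast] at this
    have h3 : (k.2.2 : ℝ) ≤ k.2.2 * ε₀ / ‖ε‖ := by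
      rw [le_div_iff₀ hεp]; gcongr
    have h4 : 0 < 1 / ‖ε‖ := by positivity
    rw [add_div, add_div] at h1
    rw [mul_add, Complex.add_re]
    linarith
  refine ⟨ht0, fun k hk h0 => ?_, A, d, C, p, hu, hy, hshift, fun z hz => ?_⟩
  · have h1 : (ε * t)⁻¹ + (k.2.2 : ℂ) = 0 := by
      have : (ε * t)⁻¹ + (k.2.2 : ℂ) = (1 + k.2.2 * ε * t) * (ε * t)⁻¹ := by
        field_simp
      rw [this, h0, zero_mul]
    have h2 := hshift k hk
    rw [h1, mul_zero, Complex.zero_re] at h2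
    exact absurd h2 (not_lt.2 (by positivity))
  · rw [hu t z ε ht0 hz hεd hy]
    refine (p.norm_pathLap_le h e.θ_pos hz hεd fun s hs => cone_bound p.norm_d hε0 e.a_pos e.a_le
      q.le_norm hκ e.θ_pos.le e.le q.le_re_A q.le_re_d hs).trans ?_
    have hθ := e.θ_pos
    have : 0 ≤ ε₀ / θ := div_nonneg (hεp.le.trans hεle) hθ.le
    gcongr
    exact q.norm_le

lemma IsLaplaceRep.hasBrokenLaplace {A : ℂ} {u : ℂ → ℂ → ℂ → ℂ}
    (hu : IsLaplaceRep S P 𝒜 ct w ε₀ β κ A (-1) u)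
    (h : BorelProblem S P 𝒜 c ct w ε₀ R β K U Bd)
    (p : BorelPath S P 𝒜 ct w ε₀ R K A (-1) κ C) {t z ε : ℂ} (ht : t ≠ 0)
    (hz : z ∈ Metric.ball 0 β) (hε : ε ∈ pdisc ε₀) (hy : κ / ‖ε‖ < (-1 * (ε * t)⁻¹).re) (j : ℕ) :
    HasBrokenLaplace A (fun τ => borelSol S P 𝒜 ct w j τ z ε) (ε * t)
      (iteratedDeriv j (fun z => u t z ε) z) := by
  rw [p.iteratedDeriv_eq h hε hy (fun z hz => hu t z ε ht hz hε hy) j z hz]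
  exact hasBrokenLaplace_pathLap (by simpa using p.integrableOn h 0 j hz hε hy)

lemma IsLaplaceRep.hasRayLaplace {γ : ℝ} {d : ℂ} {u : ℂ → ℂ → ℂ → ℂ}
    (hu : IsLaplaceRep S P 𝒜 ct w ε₀ β κ d d u)
    (h : BorelProblem S P 𝒜 c ct w ε₀ R β K U Bd)
    (p : BorelPath S P 𝒜 ct w ε₀ R K d d κ C) (hd : d = Complex.exp (γ * Complex.I))
    {t z ε : ℂ} (ht : t ≠ 0)
    (hz : z ∈ Metric.ball 0 β) (hε : ε ∈ pdisc ε₀) (hy : κ / ‖ε‖ < (d * (ε * t)⁻¹).re) (j : ℕ) :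
    HasRayLaplace γ (fun τ => borelSol S P 𝒜 ct w j τ z ε) (ε * t)
      (iteratedDeriv j (fun z => u t z ε) z) := by
  rw [p.iteratedDeriv_eq h hε hy (fun z hz => hu t z ε ht hz hε hy) j z hz]
  exact hasRayLaplace_pathLap hd (by simpa using p.integrableOn h 0 j hz hε hy)

open Classical in
/-- The Laplace transform of the Borel solution along any halfline in the sector `T` on which
it converges. -/
def sectorSol (S : ℕ) (P : Polynomial ℂ) (𝒜 : Finset (ℕ × ℕ × ℕ)) (ct : ℕ × ℕ × ℕ → ℕ → ℂ → ℂ)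
    (w : ℕ → ℂ → ℂ → ℂ) (κ : ℝ) (T : Set ℂ) (t z ε : ℂ) : ℂ :=
  if h : ∃ v, v ∈ T ∧ ‖v‖ = 1 ∧ κ / ‖ε‖ < (v * (ε * t)⁻¹).re then
    pathLap h.choose h.choose (fun τ => borelSol S P 𝒜 ct w 0 τ z ε) (ε * t)⁻¹ else 0

/-- By `pathLap_eq` the direction picked in `sectorSol` is irrelevant, so any fixed direction
represents the solution wherever it converges. -/
lemma SectorData.isLaplaceRep {α φ : ℝ} (d : SectorData S ε₀ b σ₁ r α φ w)
    (h : BorelSetup S P 𝒜 c ct ε₀ R β b M σ₁ σ₂ σ₃ ς₂ ς₃ r Z)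
    (hZ : closure (unbSector α φ) ∪ Metric.closedBall 0 r ⊆ Z) {v : ℂ} (hv : v ∈ unbSector α φ)
    (hv1 : ‖v‖ = 1) : IsLaplaceRep S P 𝒜 ct w ε₀ β (σ₁ * zetaR b) v v
      (sectorSol S P 𝒜 ct w (σ₁ * zetaR b) (unbSector α φ)) := by
  intro t z ε _ hz hε hy
  have hex : ∃ v, v ∈ unbSector α φ ∧ ‖v‖ = 1 ∧ σ₁ * zetaR b / ‖ε‖ < (v * (ε * t)⁻¹).re :=
    ⟨v, hv, hv1, hy⟩
  rw [sectorSol, dif_pos hex]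
  exact d.pathLap_eq h hZ hex.choose_spec.1 hex.choose_spec.2.1 hv hv1 hz hε
    hex.choose_spec.2.2 hy

/-! ### Differences of Laplace transforms -/

/-- The deformation takes place in the part of the disc where Re(uy) ≥ 0. This set is convex,
contains the initial pieces of both paths and has 0 on its boundary. There ς = 0, and l is fixed,
hence plain exponential smallness. -/
theorem norm_pathLap_sub_le_of_disc (e : DecayRate 𝒜 ε₀ κ θ a a' D) (hς₃ : 0 ≤ ς₃)
    (h : BorelProblem S P 𝒜 c ct w ε₀ R β K U (expBd C κ 0 ς₃))
    (h₁ : BorelProblem S P 𝒜 c ct w₁ ε₀ R β K₁ U₁ Bd₁)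
    (h₂ : BorelProblem S P 𝒜 c ct w₂ ε₀ R β K₂ U₂ Bd₂) {A₁ d₁ A₂ d₂ : ℂ}
    (p₁ : BorelPath S P 𝒜 ct w₁ ε₀ R K₁ A₁ d₁ κ C) (p₂ : BorelPath S P 𝒜 ct w₂ ε₀ R K₂ A₂ d₂ κ C)
    (hU : Metric.ball 0 r ⊆ U) {y z ε : ℂ} (hz : z ∈ Metric.ball 0 β) (hε : ε ∈ pdisc ε₀)
    (q₁ : DecayPath a a' D ε y A₁ d₁) (q₂ : DecayPath a a' D ε y A₂ d₂) {l : ℝ}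
    (hl : 0 < l) (hl1 : l ≤ 1) (hlr : a' * l < r)
    (hw₁ : ∀ s ∈ Ioc 0 l, borelSol S P 𝒜 ct w₁ 0 (s * A₁) z ε = borelSol S P 𝒜 ct w 0 (s * A₁) z ε)
    (hw₂ : ∀ s ∈ Ioc 0 l, borelSol S P 𝒜 ct w₂ 0 (s * A₂) z ε =
      borelSol S P 𝒜 ct w 0 (s * A₂) z ε) :
    ‖pathLap A₁ d₁ (fun τ => borelSol S P 𝒜 ct w₁ 0 τ z ε) y -
      pathLap A₂ d₂ (fun τ => borelSol S P 𝒜 ct w₂ 0 τ z ε) y‖ ≤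
      8 * C * (a' + 1) * (ε₀ / θ) * Real.exp (-(θ * l / ‖ε‖)) := by
  have hκ := p₁.κ_nonneg
  have hεp : 0 < ‖ε‖ := norm_pos_iff.2 hε.2
  have hDε : 0 < D / ‖ε‖ := div_pos (hκ.trans_lt e.lt) hεp
  set V : Set ℂ := Metric.ball 0 r ∩ {u | 0 ≤ (u * y).re} with hVdef
  have hlin : IsLinearMap ℝ fun u : ℂ => (u * y).re :=
    IsLinearMap.mk (fun v w => by rw [add_mul, Complex.add_re])
      fun r v => by rw [Complex.real_smul, mul_assoc, Complex.re_ofReal_mul, smul_eq_mul]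
  have hre : ∀ {A d : ℂ}, DecayPath a a' D ε y A d → ∀ s : ℝ, 0 ≤ s →
      s * (D / ‖ε‖ * a) ≤ ((s : ℂ) * A * y).re := by
    intro A d q s hs
    rw [mul_assoc (s : ℂ), Complex.re_ofReal_mul]
    exact mul_le_mul_of_nonneg_left
      ((mul_le_mul_of_nonneg_left q.le_norm hDε.le).trans q.le_re_A) hs
  have hDa : 0 < D / ‖ε‖ * a := mul_pos hDε e.a_pos
  have hball : ∀ {A d : ℂ}, DecayPath a a' D ε y A d → ∀ s ∈ Icc 0 l,
      (s : ℂ) * A ∈ Metric.ball (0 : ℂ) r := by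
    intro A d q s hs
    rw [mem_ball_zero_iff, norm_mul, Complex.norm_real, Real.norm_of_nonneg hs.1]
    refine lt_of_le_of_lt ?_ hlr
    rw [mul_comm a']
    exact mul_le_mul hs.2 q.norm_le (norm_nonneg _) hl.le
  have hmem : ∀ {A d : ℂ}, DecayPath a a' D ε y A d → ∀ s ∈ Icc 0 l, bPath A d s ∈ V := by
    intro A d q s hs
    rw [bPath_of_le (hs.2.trans hl1)]
    exact ⟨hball q s hs, (mul_nonneg hs.1 hDa.le).trans (hre q s hs.1)⟩
  have hV : IsHolConvex (lapKernel (fun τ => borelSol S P 𝒜 ct w 0 τ z ε) y⁻¹) V := by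
    refine isHolConvex_lapKernel p₁.C_nonneg hκ le_rfl hς₃ h
      ((convex_ball _ _).inter (convex_halfSpace_ge hlin _)) ?_
      (inter_subset_left.trans (hU.trans h.subset))
      ((interior_subset.trans inter_subset_left).trans hU) ?_ ?_ hz hε
    · refine ⟨(l : ℂ) * A₁, mem_interior.2 ⟨Metric.ball 0 r ∩ {u | 0 < (u * y).re}, ?_, ?_, ?_⟩⟩
      · exact fun u hu => ⟨hu.1, (show 0 < (u * y).re from hu.2).le⟩
      · exact Metric.isOpen_ball.inter (isOpen_lt continuous_const (by fun_prop))
      · exact ⟨hball q₁ l ⟨hl.le, le_rfl⟩, lt_of_lt_of_le (mul_pos hl hDa) (hre q₁ l hl.le)⟩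
    · have := hmem q₁ 0 ⟨le_rfl, hl.le⟩
      rwa [bPath_of_le zero_le_one, Complex.ofReal_zero, zero_mul] at this
    -- The points -sA₁ with small s > 0 leave the half-plane.
    · intro h0
      have hc : Tendsto (fun s : ℝ => ((-s : ℝ) : ℂ) * A₁) (𝓝[>] 0) (𝓝 0) := by
        have : Continuous fun s : ℝ => ((-s : ℝ) : ℂ) * A₁ := by fun_prop
        simpa using (this.tendsto 0).mono_left nhdsWithin_le_nhds
      obtain ⟨s, hs, hs0⟩ := ((hc.eventually (mem_interior_iff_mem_nhds.1 h0)).and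
        self_mem_nhdsWithin).exists
      have h1 : 0 ≤ (((-s : ℝ) : ℂ) * A₁ * y).re := hs.2
      have h2 := hre q₁ s (le_of_lt hs0)
      have h3 : 0 < s * (D / ‖ε‖ * a) := mul_pos hs0 hDa
      rw [Complex.ofReal_neg, neg_mul, neg_mul, Complex.neg_re] at h1
      linarith
  have := norm_pathLap_sub_le (ς := 0) hκ le_rfl hς₃ h h₁ h₂ p₁ p₂ hz hε
    (inter_subset_left.trans (hU.trans h.subset)) hV hl e.θ_pos e.a_pos e.a_le e.le_a' e.le_mul
    (hmem q₁) (hmem q₂)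
    (fun s hs => by rw [bPath_of_le (hs.2.trans hl1)]; exact hw₁ s hs)
    (fun s hs => by rw [bPath_of_le (hs.2.trans hl1)]; exact hw₂ s hs)
    q₁.le_norm q₁.norm_le q₂.le_norm q₂.norm_le q₁.le_re_A q₁.le_re_d q₂.le_re_A q₂.le_re_d
  rwa [zero_mul, add_zero] at this

namespace StripData

variable {n : ℕ} {aH bH cJ dJ : ℤ → ℝ}

/-- With l = L/(ς₃a') and L = log(M₃/‖ε‖), the growth on the connecting segment is at most
exp(ςM₃/‖ε‖), ς = ς₂ζ(b). The choice of θ yields θl ≥ (ςM₃ + 1)L ≥ ςM₃ + L, so after compensation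
e^{-L/‖ε‖} is left. -/
theorem norm_pathLap_sub_le (d : StripData S ε₀ b M σ₁ σ₂ σ₃ ς₂ ς₃ n aH bH cJ dJ w)
    (h : BorelSetup S P 𝒜 c ct ε₀ R β b M σ₁ σ₂ σ₃ ς₂ ς₃ r Z) (hZ : {τ | τ.re ≤ 0} ⊆ Z)
    (e : DecayRate 𝒜 ε₀ (σ₁ * zetaR b) θ a a' D) {M₃ : ℝ} (hM₃ : M₃ = Real.exp 1 * (ε₀ + 1))
    (hθ : ς₃ * a' * (ς₂ * zetaR b * M₃ + 1) ≤ θ)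
    {k₁ k₂ : ℤ} (hk₁ : -(n : ℤ) ≤ k₁) (hk₁n : k₁ ≤ n) (hk₂ : -(n : ℤ) ≤ k₂) (hk₂n : k₂ ≤ n)
    {A₁ A₂ : ℂ} (hA₁ : A₁ ∈ strip (aH k₁) (bH k₁)) (hA₂ : A₂ ∈ strip (aH k₂) (bH k₂))
    {y z ε : ℂ} (hz : z ∈ Metric.ball 0 β) (hε : ε ∈ pdisc ε₀)
    (q₁ : DecayPath a a' D ε y A₁ (-1)) (q₂ : DecayPath a a' D ε y A₂ (-1)) :
    ‖pathLap A₁ (-1) (fun τ => borelSol S P 𝒜 ct w 0 τ z ε) y -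
      pathLap A₂ (-1) (fun τ => borelSol S P 𝒜 ct w 0 τ z ε) y‖ ≤
      8 * Real.exp (ς₂ * zetaR b * Real.exp (ς₃ * a')) * (a' + 1) * (ε₀ / θ) *
        Real.exp (-(1 / ‖ε‖ * Real.log (M₃ / ‖ε‖))) := by
  have hεp : 0 < ‖ε‖ := norm_pos_iff.2 hε.2
  have hεlt : ‖ε‖ < ε₀ := mem_ball_zero_iff.1 hε.1
  have hς₃ := h.ς₃_pos
  have hς : 0 < ς₂ * zetaR b := mul_pos h.ς₂_pos h.zeta_pos
  have ha' : 0 < a' := zero_lt_one.trans_le e.le_a'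
  have hθ0 := e.θ_pos
  have hC : 1 ≤ Real.exp (ς₂ * zetaR b * Real.exp (ς₃ * a')) := Real.one_le_exp (by positivity)
  have hp := d.borelProblem h hZ hC
  have p₁ := d.borelPath h hZ hk₁ hk₁n hA₁ q₁.norm_le
  have p₂ := d.borelPath h hZ hk₂ hk₂n hA₂ q₂.norm_le
  have h0V : (0 : ℂ) ∈ strip (cJ (-n)) (bH n) :=
    d.strips.strip_J_subset (by omega) (by omega) d.strips.zero_mem_strip
  have hV : IsHolConvex (lapKernel (fun τ => borelSol S P 𝒜 ct w 0 τ z ε) y⁻¹)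
      (strip (cJ (-n)) (bH n)) :=
    isHolConvex_lapKernel (zero_le_one.trans hC) h.κ_nonneg hς.le hς₃.le hp (convex_strip _ _)
      (nonempty_interior_strip d.strips.c_lt_b) subset_rfl subset_rfl h0V
      (zero_notMem_interior_strip _ _) hz hε
  have hM₃0 : 0 < M₃ := by rw [hM₃]; have := hεp.trans hεlt; positivity
  set L := Real.log (M₃ / ‖ε‖) with hL
  -- The factor e in M₃ serves to have L ≥ 1.
  have hL1 : 1 ≤ L := by
    rw [hL, Real.le_log_iff_exp_le (by positivity), le_div_iff₀ hεp, hM₃]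
    gcongr
    linarith
  set l := L / (ς₃ * a') with hl
  have hl0 : 0 < l := by positivity
  refine (SPCP.norm_pathLap_sub_le h.κ_nonneg hς.le hς₃.le hp hp hp p₁ p₂ hz hε subset_rfl hV hl0
    hθ0 e.a_pos e.a_le e.le_a' e.le_mul (fun s hs => p₁.mem s hs.1) (fun s hs => p₂.mem s hs.1)
    (fun _ _ => rfl) (fun _ _ => rfl) q₁.le_norm q₁.norm_le q₂.le_norm q₂.norm_le q₁.le_re_A
    q₁.le_re_d q₂.le_re_A q₂.le_re_d).trans ?_
  have hεθ : 0 ≤ ε₀ / θ := div_nonneg (hεp.trans hεlt).le hθ0.le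
  refine mul_le_mul_of_nonneg_left (Real.exp_le_exp.2 ?_) (by positivity)
  have e1 : ς₃ * (a' * l) = L := by rw [hl]; field_simp
  rw [e1, hL, Real.exp_log (by positivity), ← hL]
  have e2 : (ς₂ * zetaR b * M₃ + 1) * L ≤ θ * l := by
    rw [hl, ← mul_div_assoc, le_div_iff₀ (by positivity)]
    calc _ = ς₃ * a' * (ς₂ * zetaR b * M₃ + 1) * L := by ring
      _ ≤ _ := by gcongr
  have e3 : ς₂ * zetaR b * M₃ ≤ ς₂ * zetaR b * M₃ * L := le_mul_of_one_le_right (by positivity) hL1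
  have e4 : ς₂ * zetaR b * M₃ + L ≤ θ * l := by linarith
  have e5 := div_le_div_of_nonneg_right e4 hεp.le
  rw [add_div] at e5
  have e6 : ς₂ * zetaR b * (M₃ / ‖ε‖) = ς₂ * zetaR b * M₃ / ‖ε‖ := by ring
  have e7 : 1 / ‖ε‖ * L = L / ‖ε‖ := by ring
  linarith

lemma norm_borelSol_H_le (d : StripData S ε₀ b M σ₁ σ₂ σ₃ ς₂ ς₃ n aH bH cJ dJ w)
    (h : BorelSetup S P 𝒜 c ct ε₀ R β b M σ₁ σ₂ σ₃ ς₂ ς₃ r Z) (hZ : {τ | τ.re ≤ 0} ⊆ Z)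
    {s₁ s₂ : ℝ} (hs₁ : σ₁ ≤ s₁) (hs₂ : s₂ ≤ σ₂)
    {k : ℤ} (hk : -(n : ℤ) ≤ k) (hkn : k ≤ n) {τ z ε : ℂ} (hτ : τ ∈ strip (aH k) (bH k))
    (hz : z ∈ Metric.ball 0 β) (hε : ε ∈ pdisc ε₀) :
    ‖borelSol S P 𝒜 ct w 0 τ z ε‖ ≤ 2 * ‖τ‖ * Real.exp (s₁ / ‖ε‖ * zetaR b * ‖τ‖ -
      s₂ * (M - zetaR b) * Real.exp (σ₃ * ‖τ‖)) := by
  have h1 := (d.borelProblem h hZ (C := 1) le_rfl).norm_borelSol_le 0 hz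
    (d.norm_coef_H_le h hZ hk hkn hτ hε)
  refine h1.trans ?_
  have hζ := h.zeta_pos
  have hM := sub_pos.2 h.zeta_lt
  have e1 : σ₁ * zetaR b / ‖ε‖ * ‖τ‖ ≤ s₁ / ‖ε‖ * zetaR b * ‖τ‖ := by
    rw [div_mul_eq_mul_div s₁]; gcongr
  have e2 : s₂ * (M - zetaR b) * Real.exp (σ₃ * ‖τ‖) ≤
      σ₂ * (M - zetaR b) * Real.exp (σ₃ * ‖τ‖) := by gcongr
  calc _ = 2 * ‖τ‖ * Real.exp (σ₁ * zetaR b / ‖ε‖ * ‖τ‖ -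
      σ₂ * (M - zetaR b) * Real.exp (σ₃ * ‖τ‖)) := by simp; ring
    _ ≤ _ := mul_le_mul_of_nonneg_left (Real.exp_le_exp.2 (by linarith)) (by positivity)

lemma norm_borelSol_J_le (d : StripData S ε₀ b M σ₁ σ₂ σ₃ ς₂ ς₃ n aH bH cJ dJ w)
    (h : BorelSetup S P 𝒜 c ct ε₀ R β b M σ₁ σ₂ σ₃ ς₂ ς₃ r Z) (hZ : {τ | τ.re ≤ 0} ⊆ Z)
    {s₁ s₂ : ℝ} (hs₁ : σ₁ ≤ s₁) (hs₂ : ς₂ ≤ s₂)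
    {k : ℤ} (hk : -(n : ℤ) ≤ k) (hkn : k ≤ n) {τ z ε : ℂ} (hτ : τ ∈ strip (cJ k) (dJ k))
    (hz : z ∈ Metric.ball 0 β) (hε : ε ∈ pdisc ε₀) :
    ‖borelSol S P 𝒜 ct w 0 τ z ε‖ ≤ 2 * ‖τ‖ * Real.exp (s₁ / ‖ε‖ * zetaR b * ‖τ‖ +
      s₂ * zetaR b * Real.exp (ς₃ * ‖τ‖)) := by
  have h1 := (d.borelProblem h hZ (C := 1) le_rfl).norm_borelSol_le 0 hz
    (d.norm_coef_J_le h hZ hk hkn hτ hε)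
  refine h1.trans ?_
  have hζ := h.zeta_pos
  have e1 : σ₁ * zetaR b / ‖ε‖ * ‖τ‖ ≤ s₁ / ‖ε‖ * zetaR b * ‖τ‖ := by
    rw [div_mul_eq_mul_div s₁]; gcongr
  have e2 : ς₂ * zetaR b * Real.exp (ς₃ * ‖τ‖) ≤ s₂ * zetaR b * Real.exp (ς₃ * ‖τ‖) := by gcongr
  calc _ = 2 * ‖τ‖ * Real.exp (σ₁ * zetaR b / ‖ε‖ * ‖τ‖ +
      ς₂ * zetaR b * Real.exp (ς₃ * ‖τ‖)) := by simp; ring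
    _ ≤ _ := mul_le_mul_of_nonneg_left (Real.exp_le_exp.2 (by linarith)) (by positivity)

end StripData

lemma SectorData.norm_borelSol_le {α φ : ℝ} (d : SectorData S ε₀ b σ₁ r α φ w)
    (h : BorelSetup S P 𝒜 c ct ε₀ R β b M σ₁ σ₂ σ₃ ς₂ ς₃ r Z)
    (hZ : closure (unbSector α φ) ∪ Metric.closedBall 0 r ⊆ Z) {s₁ : ℝ} (hs₁ : σ₁ ≤ s₁)
    {τ z ε : ℂ} (hτ : τ ∈ unbSector α φ ∪ Metric.ball 0 r)
    (hz : z ∈ Metric.ball 0 β) (hε : ε ∈ pdisc ε₀) :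
    ‖borelSol S P 𝒜 ct w 0 τ z ε‖ ≤ 2 * ‖τ‖ * Real.exp (s₁ / ‖ε‖ * zetaR b * ‖τ‖) := by
  have hp := d.borelProblem h hZ (C := 1) le_rfl
  have h1 := hp.norm_borelSol_le 0 hz (d.norm_coef_le h hZ (hp.subset hτ) hε)
  refine h1.trans ?_
  have hζ := h.zeta_pos
  have e1 : σ₁ * zetaR b / ‖ε‖ * ‖τ‖ ≤ s₁ / ‖ε‖ * zetaR b * ‖τ‖ := by
    rw [div_mul_eq_mul_div s₁]; gcongr
  calc _ = 2 * ‖τ‖ * Real.exp (σ₁ * zetaR b / ‖ε‖ * ‖τ‖) := by simp; ring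
    _ ≤ _ := mul_le_mul_of_nonneg_left (Real.exp_le_exp.2 e1) (by positivity)

/-- The identity of two continuous functions extends from the interior of a strip to its
boundary. -/
lemma eq_of_eq_interior_strip {f g : ℂ → ℂ} {x y r : ℝ} (hxy : x < y)
    (hf : ContinuousOn f (strip x y)) (hg : ContinuousOn g (Metric.ball 0 r))
    (h : ∀ τ ∈ Metric.ball (0 : ℂ) r ∩ interior (strip x y), f τ = g τ) {τ : ℂ}
    (hτ : τ ∈ Metric.ball 0 r) (hτ' : τ ∈ strip x y) : f τ = g τ := by
  have h' : EqOn f g (Metric.ball 0 r ∩ interior (strip x y)) := h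
  refine h'.of_subset_closure (t := Metric.ball 0 r ∩ strip x y) (hf.mono inter_subset_right)
    (hg.mono inter_subset_left) (inter_subset_inter_right _ interior_subset) ?_ ⟨hτ, hτ'⟩
  have h1 := (Metric.isOpen_ball (x := (0 : ℂ)) (ε := r)).inter_closure (t := interior (strip x y))
  rwa [closure_interior_strip hxy] at h1

end SPCP

end

/-! ### Assembly: choice of the constants and verification of the claims -/

theorem theorem1
    -- the equation
    (S : ℕ) (hS : 1 ≤ S) (P : Polynomial ℂ) (hP : P ≠ 0)
    (hProots : ∀ τ : ℂ, P.IsRoot τ → 0 < τ.re)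
    (ρ ε₀ : ℝ) (hρ : 0 < ρ) (hε₀ : 0 < ε₀)
    (𝒜 : Finset (ℕ × ℕ × ℕ)) (c : ℕ × ℕ × ℕ → ℂ → ℂ → ℂ)
    (hc_hol : ∀ k ∈ 𝒜, DifferentiableOn ℂ (fun q : ℂ × ℂ => c k q.1 q.2)
      (Metric.ball 0 ρ ×ˢ Metric.ball 0 ε₀))
    (hc_bdd : ∀ k ∈ 𝒜, ∃ K : ℝ, ∀ z ∈ Metric.ball (0 : ℂ) ρ, ∀ ε ∈ Metric.ball (0 : ℂ) ε₀,
      ‖c k z ε‖ ≤ K)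
    -- growth constraints
    (ξ b M : ℝ) (hξ : 0 < ξ) (hb : 1 < b) (hM : SPCP.zetaR b < M)
    (hcond : ∀ k ∈ 𝒜, (k.2.1 : ℝ) + b * k.1 + b * k.2.2 / ξ ≤ S ∧ k.2.1 < S)
    (σ₁' σ₂' σ₃' ς₂' ς₃' : ℝ) (hσ₁ : 0 < σ₁') (hσ₂ : 0 < σ₂') (hσ₃ : 0 < σ₃')
    (hς₂ : 0 < ς₂') (hς₃ : 0 < ς₃') (hξσ : ξ ≤ min σ₃' ς₃')
    -- the strips `H k`, `J k`
    (n : ℕ) (hn : 1 ≤ n) (aH bH cJ dJ : ℤ → ℝ)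
    (hstrips : SPCP.IsStripSystem n aH bH cJ dJ)
    -- the disc of radius `r` and the sectors in the Borel plane
    (ι : ℕ) (hι : 2 ≤ ι) (dir θ : ℕ → ℝ) (r : ℝ) (hr : 0 < r)
    (hrJ : Metric.ball (0 : ℂ) r ∩ {z | z.re ≤ 0} ⊆ SPCP.strip (cJ 0) (dJ 0))
    (hθ : ∀ p < ι, 0 < θ p)
    (hSd : ∀ p < ι, SPCP.unbSector (dir p) (θ p) ⊆ {z | 0 < z.re})
    (hdir : ∀ p, p + 1 < ι → dir p < dir (p + 1) ∧
      SPCP.unbSector (dir p) (θ p) ∩ SPCP.unbSector (dir (p + 1)) (θ (p + 1)) = ∅)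
    (hPS : ∀ p < ι, ∀ τ ∈ closure (SPCP.unbSector (dir p) (θ p)) ∪ Metric.closedBall 0 r,
      ¬ P.IsRoot τ) :
    ∃ I δ δ₁ : ℝ, 0 < I ∧ 0 < δ ∧ δ < ρ ∧ 0 < δ₁ ∧ δ₁ < 1 ∧
    -- the sectors in `t` and `ε`, the paths, and the initial data in the Borel plane
    ∀ (𝒯 : Set ℂ) (EH : ℤ → Set ℂ) (ES : ℕ → Set ℂ) (A : ℤ → ℂ) (γ : ℕ → ℂ → ℂ → ℝ)
      (wH : ℕ → ℂ → ℂ → ℂ) (wS : ℕ → ℕ → ℂ → ℂ → ℂ),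
    (∃ R φ : ℝ, 0 < R ∧ 0 < φ ∧ φ ≤ Real.pi ∧ 𝒯 = SPCP.bddSector R 0 φ) →
    (∀ k : ℤ, -(n : ℤ) ≤ k → k ≤ n → SPCP.SectorHJ ε₀ 𝒯 (EH k) ∧
      SPCP.PathPoint 𝒯 (EH k) (SPCP.strip (aH k) (bH k)) (A k)) →
    (∀ p < ι, SPCP.SectorS ε₀ 𝒯 (ES p) (SPCP.unbSector (dir p) (θ p)) (γ p)) →
    SPCP.IsGoodCovering n ι EH ES →
    (∀ j < S, SPCP.AdmissibleHJ b M ε₀ n aH bH cJ dJ σ₁' σ₂' σ₃' ς₂' ς₃' (wH j)) →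
    (∀ p < ι, ∀ j < S,
      SPCP.AdmissibleS b ε₀ (SPCP.unbSector (dir p) (θ p)) r σ₁' (wS p j)) →
    -- all initial data continue one common function on the disc of radius `r`
    (∀ j < S, ∀ ε ∈ SPCP.pdisc ε₀, ∃ w₀ : ℂ → ℂ, DifferentiableOn ℂ w₀ (Metric.ball 0 r) ∧
      (∀ τ ∈ Metric.ball (0 : ℂ) r ∩ interior (SPCP.strip (cJ (-n)) (bH n)),
        wH j τ ε = w₀ τ) ∧
      ∀ p < ι, ∀ τ ∈ Metric.ball (0 : ℂ) r, wS p j τ ε = w₀ τ) →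
    -- smallness of the initial data
    (∀ ε ∈ SPCP.pdisc ε₀, ∀ k : ℤ, -(n : ℤ) ≤ k → k ≤ n →
      SPCP.SmallData S δ I (fun j => SPCP.sedNorm b M 0 σ₁' σ₂' σ₃'
        (SPCP.strip (aH k) (bH k)) ε (fun τ => wH j τ ε)) ∧
      SPCP.SmallData S δ I (fun j => SPCP.segNorm b 0 σ₁' ς₂' ς₃'
        (SPCP.strip (cJ k) (dJ k)) ε (fun τ => wH j τ ε))) →
    (∀ ε ∈ SPCP.pdisc ε₀, ∀ p < ι,
      SPCP.SmallData S δ I (fun j => SPCP.egNorm b 0 σ₁'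
        (closure (SPCP.unbSector (dir p) (θ p)) ∪ Metric.closedBall 0 r) ε
        (fun τ => wS p j τ ε))) →
    ∃ (rT : ℝ) (uH : ℤ → ℂ → ℂ → ℂ → ℂ) (WH : ℂ → ℂ → ℂ → ℂ)
      (uS : ℕ → ℂ → ℂ → ℂ → ℂ) (WS : ℕ → ℂ → ℂ → ℂ → ℂ), 0 < rT ∧
    -- 1) solutions on the sectors `EH k`
    ((∀ k : ℤ, -(n : ℤ) ≤ k → k ≤ n →
        SPCP.IsBoundedHolSolution S P 𝒜 c (𝒯 ∩ Metric.ball 0 rT) (Metric.ball 0 (δ * δ₁))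
          (EH k) (uH k) ∧
        (∀ j < S, ∀ t ∈ 𝒯 ∩ Metric.ball 0 rT, ∀ ε ∈ EH k,
          SPCP.HasBrokenLaplace (A k) (fun τ => wH j τ ε) (ε * t)
            (iteratedDeriv j (fun z => uH k t z ε) 0)) ∧
        (∀ t ∈ 𝒯 ∩ Metric.ball 0 rT, ∀ z ∈ Metric.ball (0 : ℂ) (δ * δ₁), ∀ ε ∈ EH k,
          SPCP.HasBrokenLaplace (A k) (fun τ => WH τ z ε) (ε * t) (uH k t z ε))) ∧
      DifferentiableOn ℂ (fun q : ℂ × ℂ × ℂ => WH q.1 q.2.1 q.2.2)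
        (interior (SPCP.strip (cJ (-n)) (bH n)) ×ˢ
          (Metric.ball (0 : ℂ) (δ * δ₁) ×ˢ SPCP.pdisc ε₀)) ∧
      ContinuousOn (fun q : ℂ × ℂ × ℂ => WH q.1 q.2.1 q.2.2)
        (SPCP.strip (cJ (-n)) (bH n) ×ˢ
          (Metric.ball (0 : ℂ) (δ * δ₁) ×ˢ SPCP.pdisc ε₀)) ∧
      (∀ σ₁ σ₂ ς₂ : ℝ, σ₁' < σ₁ → 0 < σ₂ → σ₂ < σ₂' → ς₂' < ς₂ →
        ∀ k : ℤ, -(n : ℤ) ≤ k → k ≤ n → ∃ CH CJ : ℝ, 0 < CH ∧ 0 < CJ ∧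
          ∀ z ∈ Metric.ball (0 : ℂ) (δ * δ₁), ∀ ε ∈ SPCP.pdisc ε₀,
            (∀ τ ∈ SPCP.strip (aH k) (bH k),
              ‖WH τ z ε‖ ≤ CH * ‖τ‖ * Real.exp (σ₁ / ‖ε‖ * SPCP.zetaR b * ‖τ‖
                - σ₂ * (M - SPCP.zetaR b) * Real.exp (σ₃' * ‖τ‖))) ∧
            (∀ τ ∈ SPCP.strip (cJ k) (dJ k),
              ‖WH τ z ε‖ ≤ CJ * ‖τ‖ * Real.exp (σ₁ / ‖ε‖ * SPCP.zetaR b * ‖τ‖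
                + ς₂ * SPCP.zetaR b * Real.exp (ς₃' * ‖τ‖)))) ∧
      (∀ k : ℤ, -(n : ℤ) ≤ k → k < n → ∃ M₁ M₂ M₃ : ℝ, 0 < M₁ ∧ 0 < M₂ ∧ 1 < M₃ ∧
        ∀ t ∈ 𝒯 ∩ Metric.ball 0 rT, ∀ z ∈ Metric.ball (0 : ℂ) (δ * δ₁),
          ∀ ε ∈ EH k ∩ EH (k + 1),
            ‖uH (k + 1) t z ε - uH k t z ε‖
              ≤ M₁ * Real.exp (-(M₂ / ‖ε‖ * Real.log (M₃ / ‖ε‖))))) ∧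
    -- 2) solutions on the sectors `ES p`
    ((∀ p < ι,
        SPCP.IsBoundedHolSolution S P 𝒜 c (𝒯 ∩ Metric.ball 0 rT) (Metric.ball 0 (δ * δ₁))
          (ES p) (uS p) ∧
        (∀ j < S, ∀ t ∈ 𝒯 ∩ Metric.ball 0 rT, ∀ ε ∈ ES p,
          SPCP.HasRayLaplace (γ p t ε) (fun τ => wS p j τ ε) (ε * t)
            (iteratedDeriv j (fun z => uS p t z ε) 0)) ∧
        (∀ t ∈ 𝒯 ∩ Metric.ball 0 rT, ∀ z ∈ Metric.ball (0 : ℂ) (δ * δ₁), ∀ ε ∈ ES p,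
          SPCP.HasRayLaplace (γ p t ε) (fun τ => WS p τ z ε) (ε * t) (uS p t z ε)) ∧
        DifferentiableOn ℂ (fun q : ℂ × ℂ × ℂ => WS p q.1 q.2.1 q.2.2)
          ((SPCP.unbSector (dir p) (θ p) ∪ Metric.ball 0 r) ×ˢ
            (Metric.ball (0 : ℂ) (δ * δ₁) ×ˢ SPCP.pdisc ε₀)) ∧
        ContinuousOn (fun q : ℂ × ℂ × ℂ => WS p q.1 q.2.1 q.2.2)
          ((closure (SPCP.unbSector (dir p) (θ p)) ∪ Metric.closedBall 0 r) ×ˢ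
            (Metric.ball (0 : ℂ) (δ * δ₁) ×ˢ SPCP.pdisc ε₀)) ∧
        (∀ σ₁ : ℝ, σ₁' < σ₁ → ∃ CS : ℝ, 0 < CS ∧
          ∀ τ ∈ SPCP.unbSector (dir p) (θ p) ∪ Metric.ball 0 r,
            ∀ z ∈ Metric.ball (0 : ℂ) (δ * δ₁), ∀ ε ∈ SPCP.pdisc ε₀,
              ‖WS p τ z ε‖ ≤ CS * ‖τ‖ * Real.exp (σ₁ / ‖ε‖ * SPCP.zetaR b * ‖τ‖))) ∧
      (∀ p, p + 1 < ι → ∃ M₁ M₂ : ℝ, 0 < M₁ ∧ 0 < M₂ ∧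
        ∀ t ∈ 𝒯 ∩ Metric.ball 0 rT, ∀ z ∈ Metric.ball (0 : ℂ) (δ * δ₁),
          ∀ ε ∈ ES (p + 1) ∩ ES p,
            ‖uS (p + 1) t z ε - uS p t z ε‖ ≤ M₁ * Real.exp (-(M₂ / ‖ε‖)))) ∧
    -- 3) the two remaining intersections
    (∃ M₁ M₂ : ℝ, 0 < M₁ ∧ 0 < M₂ ∧
      ∀ t ∈ 𝒯 ∩ Metric.ball 0 rT, ∀ z ∈ Metric.ball (0 : ℂ) (δ * δ₁),
        (∀ ε ∈ EH (-n) ∩ ES 0,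
          ‖uH (-n) t z ε - uS 0 t z ε‖ ≤ M₁ * Real.exp (-(M₂ / ‖ε‖))) ∧
        (∀ ε ∈ EH n ∩ ES (ι - 1),
          ‖uH n t z ε - uS (ι - 1) t z ε‖ ≤ M₁ * Real.exp (-(M₂ / ‖ε‖)))) := by
  have hrZ : ∀ p ∈ Finset.range ι, IsClosed (closure (SPCP.unbSector (dir p) (θ p)) ∪
      Metric.closedBall (0 : ℂ) r) := fun p _ => isClosed_closure.union Metric.isClosed_closedBall
  -- A closed set free of roots that contains the strips and all sectors with the disc: it yields
  -- one lower bound of |P|, hence one rate R.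
  set Z : Set ℂ := {τ : ℂ | τ.re ≤ 0} ∪ ⋃ p ∈ Finset.range ι,
    (closure (SPCP.unbSector (dir p) (θ p)) ∪ Metric.closedBall (0 : ℂ) r) with hZdef
  have hZcl : IsClosed Z := (isClosed_le Complex.continuous_re continuous_const).union
    (isClosed_biUnion_finset hrZ)
  have hZroot : ∀ τ ∈ Z, ¬ P.IsRoot τ := by
    rintro τ (hτ | hτ) hroot
    · exact absurd (hProots τ hroot) (not_lt.2 hτ)
    · obtain ⟨p, hp, hτ⟩ := Set.mem_iUnion₂.1 hτ
      exact hPS p (Finset.mem_range.1 hp) τ hτ hroot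
  have hZH : {τ : ℂ | τ.re ≤ 0} ⊆ Z := Set.subset_union_left
  have hZS : ∀ p < ι, closure (SPCP.unbSector (dir p) (θ p)) ∪ Metric.closedBall (0 : ℂ) r ⊆ Z :=
    fun p hp τ hτ => Or.inr (Set.mem_iUnion₂.2 ⟨p, Finset.mem_range.2 hp, hτ⟩)
  obtain ⟨ct, R, δ₁, hδ₁, hδ₁', h⟩ := SPCP.exists_borelSetup (r := r) hP hρ hc_hol hc_bdd hξ hb hM
    hcond hσ₁ hσ₂ hς₂ hς₃ hξσ hZcl hZroot
  -- δ₁ comes from the rate R, which does not see the size of the data; I = 1 is a normalisation.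
  refine ⟨1, ρ / 2, δ₁, one_pos, half_pos hρ, half_lt_self hρ, hδ₁, hδ₁', ?_⟩
  intro 𝒯 EH ES A γ wH wS h𝒯 hEH hES _ hwH hwS hcommon hsmallH hsmallS
  set β := ρ / 2 * δ₁ with hβ
  have h0β : (0 : ℂ) ∈ Metric.ball (0 : ℂ) β := Metric.mem_ball_self (by positivity)
  have dH : SPCP.StripData S ε₀ b M σ₁' σ₂' σ₃' ς₂' ς₃' n aH bH cJ dJ wH :=
    { strips := hstrips
      diff := fun j hj => (hwH j hj).1
      cont := fun j hj => (hwH j hj).2.1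
      norm_H := fun j hj ε hε k hk hkn => (hsmallH ε hε k hk hkn).1.norm_le hj
      norm_J := fun j hj ε hε k hk hkn => (hsmallH ε hε k hk hkn).2.norm_le hj }
  have dS : ∀ p < ι, SPCP.SectorData S ε₀ b σ₁' r (dir p) (θ p) (wS p) := fun p hp =>
    { r_pos := hr
      θ_pos := hθ p hp
      subset := hSd p hp
      diff := fun j hj => (hwS p hp j hj).1
      cont := fun j hj => (hwS p hp j hj).2.1
      norm_le := fun j hj ε hε => (hsmallS ε hε p hp).norm_le hj }
  obtain ⟨x, hx, hx1, hxH, hxS⟩ := SPCP.exists_cone_bounds hEH hES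
  set κ := σ₁' * SPCP.zetaR b with hκ
  set a' := 1 / x with ha'
  have ha'1 : 1 ≤ a' := (one_le_div hx).2 hx1
  have hζ := h.zeta_pos
  set M₃ := Real.exp 1 * (ε₀ + 1) with hM₃
  have hM₃1 : 1 < M₃ := one_lt_mul_of_lt_of_le (Real.one_lt_exp_iff.2 one_pos) (by linarith)
  -- The rate demanded by `StripData.norm_pathLap_sub_le`, used for all differences. It is fixed
  -- before D, and D before the radius x / D in t.
  set ϑ := ς₃' * a' * (ς₂' * SPCP.zetaR b * M₃ + 1) with hϑ
  have hϑ0 : 0 < ϑ := by positivity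
  obtain ⟨D, hD, e⟩ := SPCP.exists_decayRate 𝒜 hε₀.le h.κ_nonneg hϑ0 hx hx1 ha'1
  -- The constant of the strip paths is also used on the sectors, since the deformation lemma takes
  -- the same C for both paths.
  set C := Real.exp (ς₂' * SPCP.zetaR b * Real.exp (ς₃' * a')) with hCdef
  have hC : 1 ≤ C := Real.one_le_exp (by positivity)
  have hC0 : 0 ≤ C := zero_le_one.trans hC
  have h𝒯0 : ∀ t ∈ 𝒯, t ≠ 0 := by
    obtain ⟨R, φ, -, -, -, rfl⟩ := h𝒯
    exact fun t ht => ht.1.1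
  have hEHd : ∀ k : ℤ, -(n : ℤ) ≤ k → k ≤ n → EH k ⊆ SPCP.pdisc ε₀ := by
    intro k hk hkn ε hε
    obtain ⟨⟨⟨R, α, φ, -, -, -, hE⟩, hsub, -⟩, -⟩ := hEH k hk hkn
    exact ⟨hsub hε, by rw [hE] at hε; exact hε.1.1⟩
  have hESd : ∀ p < ι, ES p ⊆ SPCP.pdisc ε₀ := by
    intro p hp ε hε
    obtain ⟨⟨R, α, φ, -, -, -, hE⟩, hsub, -⟩ := hES p hp
    exact ⟨hsub hε, by rw [hE] at hε; exact hε.1.1⟩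
  have hAmem : ∀ k : ℤ, -(n : ℤ) ≤ k → k ≤ n → A k ∈ SPCP.strip (aH k) (bH k) :=
    fun k hk hkn => (hEH k hk hkn).2.1
  have hvmem : ∀ p < ι, ∀ ε ∈ ES p, ∀ t ∈ 𝒯,
      Complex.exp (γ p t ε * Complex.I) ∈ SPCP.unbSector (dir p) (θ p) := by
    intro p hp ε hε t ht
    obtain ⟨-, -, η, -, hη⟩ := hES p hp
    exact (hη ε hε t ht).1
  have hv1 : ∀ p t ε, ‖Complex.exp (γ p t ε * Complex.I)‖ = 1 := fun p t ε =>
    Complex.norm_exp_ofReal_mul_I _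
  have hqH : ∀ k : ℤ, -(n : ℤ) ≤ k → k ≤ n → ∀ ε ∈ EH k, ∀ t ∈ 𝒯 ∩ Metric.ball 0 (x / D),
      SPCP.DecayPath x a' D ε (ε * t)⁻¹ (A k) (-1) := by
    intro k hk hkn ε hε t ht
    obtain ⟨h1, h2, h3⟩ := hxH k hk hkn
    exact SPCP.decayPath_of_le_cos (ψ := Real.pi) hx hD h1 h2 (hEHd k hk hkn hε).2 (h𝒯0 t ht.1)
      (mem_ball_zero_iff.1 ht.2).le (h3 ε hε t ht.1).2 Complex.exp_pi_mul_I.symm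
      (h3 ε hε t ht.1).1
  have hqS : ∀ p < ι, ∀ ε ∈ ES p, ∀ t ∈ 𝒯 ∩ Metric.ball 0 (x / D),
      SPCP.DecayPath x a' D ε (ε * t)⁻¹ (Complex.exp (γ p t ε * Complex.I))
        (Complex.exp (γ p t ε * Complex.I)) := by
    intro p hp ε hε t ht
    have hq := SPCP.re_exp_mul_inv_ge hx (hESd p hp hε).2 (h𝒯0 t ht.1)
      (mem_ball_zero_iff.1 ht.2).le (hxS p hp ε hε t ht.1)
    have e1 : x / (x / D) = D := by field_simp
    rw [e1] at hq
    exact ⟨by rw [hv1]; exact hx1, by rw [hv1]; exact ha'1, by rwa [hv1, mul_one], hq⟩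
  have hpH := dH.borelProblem h hZH hC
  have hpathH : ∀ k : ℤ, -(n : ℤ) ≤ k → k ≤ n → SPCP.BorelPath S P 𝒜 ct wH ε₀ R
      (SPCP.strip (cJ (-n)) (bH n)) (A k) (-1) κ C := fun k hk hkn =>
    dH.borelPath h hZH hk hkn (hAmem k hk hkn) (hxH k hk hkn).2.1
  have hpS := fun p hp => (dS p hp).borelProblem h (hZS p hp) hC
  have hpathS := fun p hp ε hε t ht => (dS p hp).borelPath h (hZS p hp) hC
    (hvmem p hp ε hε t ht) (hv1 p t ε)
  set WH : ℂ → ℂ → ℂ → ℂ := fun τ z ε => SPCP.borelSol S P 𝒜 ct wH 0 τ z ε with hWH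
  set WS : ℕ → ℂ → ℂ → ℂ → ℂ := fun p τ z ε => SPCP.borelSol S P 𝒜 ct (wS p) 0 τ z ε with hWS
  set uH : ℤ → ℂ → ℂ → ℂ → ℂ := fun k t z ε =>
    SPCP.pathLap (A k) (-1) (fun τ => SPCP.borelSol S P 𝒜 ct wH 0 τ z ε) (ε * t)⁻¹ with huH
  set uS : ℕ → ℂ → ℂ → ℂ → ℂ := fun p =>
    SPCP.sectorSol S P 𝒜 ct (wS p) κ (SPCP.unbSector (dir p) (θ p)) with huS
  have hrepH : ∀ k, SPCP.IsLaplaceRep S P 𝒜 ct wH ε₀ β κ (A k) (-1) (uH k) :=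
    fun k t z ε _ _ _ _ => rfl
  have hrepS := fun p hp ε hε t ht => (dS p hp).isLaplaceRep h (hZS p hp)
    (hvmem p hp ε hε t ht) (hv1 p t ε)
  have huS_eq : ∀ p < ι, ∀ ε ∈ ES p, ∀ t ∈ 𝒯 ∩ Metric.ball 0 (x / D),
      ∀ z ∈ Metric.ball (0 : ℂ) β, uS p t z ε = SPCP.pathLap (Complex.exp (γ p t ε * Complex.I))
        (Complex.exp (γ p t ε * Complex.I)) (fun τ => SPCP.borelSol S P 𝒜 ct (wS p) 0 τ z ε)
        (ε * t)⁻¹ := fun p hp ε hε t ht z hz =>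
    hrepS p hp ε hε t ht.1 t z ε (h𝒯0 t ht.1) hz (hESd p hp hε)
      ((hqS p hp ε hε t ht).lt_re e (hESd p hp hε))
  -- Up to the parameter l all paths are still on their initial segments and inside the disc D(0,
  -- r).
  obtain ⟨l, hl, hl1, hlr⟩ : ∃ l : ℝ, 0 < l ∧ l ≤ 1 ∧ a' * l < r := by
    have ha'0 : 0 < a' := zero_lt_one.trans_le ha'1
    refine ⟨min 1 (r / (2 * a')), by positivity, min_le_left _ _, ?_⟩
    calc a' * min 1 (r / (2 * a')) ≤ a' * (r / (2 * a')) := by gcongr; exact min_le_right _ _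
      _ = r / 2 := by field_simp
      _ < r := half_lt_self hr
  have hsmall : ∀ {B d ε y : ℂ}, SPCP.DecayPath x a' D ε y B d → ∀ s ∈ Set.Ioc 0 l,
      (s : ℂ) * B ∈ Metric.ball (0 : ℂ) r := by
    intro B d ε y q s hs
    rw [mem_ball_zero_iff, norm_mul, Complex.norm_real, Real.norm_of_nonneg hs.1.le, mul_comm]
    exact (mul_le_mul q.norm_le hs.2 hs.1.le (zero_le_one.trans ha'1)).trans_lt hlr
  have hSS : ∀ p < ι, ∀ q < ι, ∀ ε ∈ SPCP.pdisc ε₀, ∀ τ ∈ Metric.ball (0 : ℂ) r, ∀ z,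
      SPCP.borelSol S P 𝒜 ct (wS p) 0 τ z ε = SPCP.borelSol S P 𝒜 ct (wS q) 0 τ z ε := by
    intro p hp q hq ε hε τ hτ z
    refine SPCP.borelSol_congr h.lt_S (fun j hj => ?_) 0 z
    obtain ⟨w₀, -, -, hw⟩ := hcommon j hj ε hε
    rw [hw p hp τ hτ, hw q hq τ hτ]
  have hHS : ∀ p < ι, ∀ ε ∈ SPCP.pdisc ε₀, ∀ τ ∈ Metric.ball (0 : ℂ) r,
      τ ∈ SPCP.strip (cJ (-n)) (bH n) → ∀ z,
      SPCP.borelSol S P 𝒜 ct wH 0 τ z ε = SPCP.borelSol S P 𝒜 ct (wS p) 0 τ z ε := by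
    intro p hp ε hε τ hτ hτ' z
    refine SPCP.borelSol_congr h.lt_S (fun j hj => ?_) 0 z
    obtain ⟨w₀, hw₀, hwH₀, hw⟩ := hcommon j hj ε hε
    rw [hw p hp τ hτ]
    -- The data agree with w₀ on the interior of the strip only, whereas a path may run along its
    -- boundary.
    refine SPCP.eq_of_eq_interior_strip (f := fun τ => wH j τ ε) hstrips.c_lt_b ?_
      hw₀.continuousOn hwH₀ hτ hτ'
    exact (dH.cont j hj).comp (f := fun τ : ℂ => (τ, ε)) (by fun_prop) fun τ hτ => ⟨hτ, hε⟩
  set M₁ := 8 * C * (a' + 1) * (ε₀ / ϑ) with hM₁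
  have hM₁0 : 0 < M₁ := by
    have : 0 < C := Real.exp_pos _
    positivity
  have hHSdiff : ∀ k : ℤ, -(n : ℤ) ≤ k → k ≤ n → ∀ p < ι, ∀ t ∈ 𝒯 ∩ Metric.ball 0 (x / D),
      ∀ z ∈ Metric.ball (0 : ℂ) β, ∀ ε ∈ EH k ∩ ES p,
      ‖uH k t z ε - uS p t z ε‖ ≤ M₁ * Real.exp (-(ϑ * l / ‖ε‖)) := by
    intro k hk hkn p hp t ht z hz ε hε
    rw [huS_eq p hp ε hε.2 t ht z hz]
    have hεd := hESd p hp hε.2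
    have qH := hqH k hk hkn ε hε.1 t ht
    refine SPCP.norm_pathLap_sub_le_of_disc e hς₃.le (hpS p hp) hpH (hpS p hp) (hpathH k hk hkn)
      (hpathS p hp ε hε.2 t ht.1) Set.subset_union_right hz hεd qH
      (hqS p hp ε hε.2 t ht) hl hl1 hlr (fun s hs => ?_) fun _ _ => rfl
    refine hHS p hp ε hεd _ (hsmall qH s hs) ?_ z
    have := (hpathH k hk hkn).mem s hs.1.le
    rwa [SPCP.bPath_of_le (hs.2.trans hl1)] at this
  refine ⟨x / D, uH, WH, uS, WS, by positivity, ⟨fun k hk hkn => ⟨?_, ?_, ?_⟩, ?_, ?_, ?_, ?_⟩,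
    ⟨fun p hp => ⟨?_, ?_, ?_, ?_, ?_, ?_⟩, fun p hp => ⟨M₁, ϑ * l, hM₁0, by positivity, ?_⟩⟩,
    M₁, ϑ * l, hM₁0, by positivity, fun t ht z hz => ⟨?_, ?_⟩⟩
  · exact SPCP.isBoundedHolSolution_of_decay hpH e (hEHd k hk hkn) hC0 fun t ht ε hε =>
      ⟨h𝒯0 t ht.1, A k, -1, hpathH k hk hkn, hrepH k, hqH k hk hkn ε hε t ht⟩
  · intro j hj t ht ε hε
    have hεd := hEHd k hk hkn hε
    have := (hrepH k).hasBrokenLaplace hpH (hpathH k hk hkn) (h𝒯0 t ht.1) h0β hεd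
      ((hqH k hk hkn ε hε t ht).lt_re e hεd) j
    simpa only [SPCP.BorelProblem.borelSol_zero wH hj] using this
  · intro t ht z hz ε hε
    have hεd := hEHd k hk hkn hε
    have := (hrepH k).hasBrokenLaplace hpH (hpathH k hk hkn) (h𝒯0 t ht.1) hz hεd
      ((hqH k hk hkn ε hε t ht).lt_re e hεd) 0
    simpa only [iteratedDeriv_zero] using this
  · exact hpH.differentiableOn_borelSol 0
  · exact hpH.continuousOn_borelSol 0
  · intro σ₁ σ₂ ς₂ hs₁ _ hs₂ hs₃ k hk hkn
    -- 2 is the sum of the geometric series ∑ 2⁻ⁿ that dominates the Taylor series in z.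
    exact ⟨2, 2, two_pos, two_pos, fun z hz ε hε =>
      ⟨fun τ hτ => dH.norm_borelSol_H_le h hZH hs₁.le hs₂.le hk hkn hτ hz hε,
        fun τ hτ => dH.norm_borelSol_J_le h hZH hs₁.le hs₃.le hk hkn hτ hz hε⟩⟩
  · intro k hk hkn
    refine ⟨M₁, 1, M₃, hM₁0, one_pos, hM₃1, fun t ht z hz ε hε => ?_⟩
    have hk' : -(n : ℤ) ≤ k + 1 := by omega
    have hkn' : k + 1 ≤ n := by omega
    exact dH.norm_pathLap_sub_le h hZH e hM₃ hϑ.ge hk' hkn' hk hkn.le (hAmem _ hk' hkn')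
      (hAmem _ hk hkn.le) hz (hEHd k hk hkn.le hε.1) (hqH _ hk' hkn' ε hε.2 t ht)
      (hqH k hk hkn.le ε hε.1 t ht)
  · exact SPCP.isBoundedHolSolution_of_decay (hpS p hp) e (hESd p hp) hC0 fun t ht ε hε =>
      ⟨h𝒯0 t ht.1, _, _, hpathS p hp ε hε t ht.1, hrepS p hp ε hε t ht.1, hqS p hp ε hε t ht⟩
  · intro j hj t ht ε hε
    have hεd := hESd p hp hε
    have := (hrepS p hp ε hε t ht.1).hasRayLaplace (hpS p hp) (hpathS p hp ε hε t ht.1) rfl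
      (h𝒯0 t ht.1) h0β hεd ((hqS p hp ε hε t ht).lt_re e hεd) j
    simpa only [SPCP.BorelProblem.borelSol_zero (wS p) hj] using this
  · intro t ht z hz ε hε
    have hεd := hESd p hp hε
    have := (hrepS p hp ε hε t ht.1).hasRayLaplace (hpS p hp) (hpathS p hp ε hε t ht.1) rfl
      (h𝒯0 t ht.1) hz hεd ((hqS p hp ε hε t ht).lt_re e hεd) 0
    simpa only [iteratedDeriv_zero] using this
  · exact (hpS p hp).differentiableOn_borelSol 0
  · exact (hpS p hp).continuousOn_borelSol 0
  · intro σ₁ hs₁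
    exact ⟨2, two_pos, fun τ hτ z hz ε hε =>
      (dS p hp).norm_borelSol_le h (hZS p hp) hs₁.le hτ hz hε⟩
  · intro t ht z hz ε hε
    have hp' : p < ι := by omega
    rw [huS_eq p hp' ε hε.2 t ht z hz, huS_eq (p + 1) hp ε hε.1 t ht z hz]
    have hεd := hESd p hp' hε.2
    have q₁ := hqS (p + 1) hp ε hε.1 t ht
    exact SPCP.norm_pathLap_sub_le_of_disc e hς₃.le (hpS p hp') (hpS (p + 1) hp) (hpS p hp')
      (hpathS (p + 1) hp ε hε.1 t ht.1) (hpathS p hp' ε hε.2 t ht.1) Set.subset_union_right hz hεd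
      q₁ (hqS p hp' ε hε.2 t ht) hl hl1 hlr
      (fun s hs => hSS (p + 1) hp p hp' ε hεd _ (hsmall q₁ s hs) z) fun _ _ => rfl
  · exact fun ε hε => hHSdiff (-n) le_rfl (by omega) 0 (by omega) t ht z hz ε hε
  · exact fun ε hε => hHSdiff n (by omega) le_rfl (ι - 1) (by omega) t ht z hz ε hε
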